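/- **Entropic and cutoff times.** Consider two cases. For an integer $k\ge 1$, let $(W_1(t))_{t\ge0}$ be the process on $\mathbb Z$ started at $0$ which is a Poisson process of rate $1/k$ in the *directed* case, and a continuous-time simple random walk of jump rate $1/k$ in the *undirected* case. Let $\nu_t$ be the law of $W_1(t)$ and $Q_1(t)=-\log\nu_t(W_1(t))$. For an integer $n\ge1$ and $\alpha\in\mathbb R$, the cutoff time $t_\alpha=t_\alpha(n,k)\ge 0$ is defined by $$\mathbb E[Q_1(t_\alpha)]=\frac{\log n+\alpha\sqrt{vk}}{k},\qquad v=\operatorname{Var}(Q_1(t_0)),$$ where $t_0$, the case $\alpha=0$, is the entropic time: $\mathbb E[Q_1(t_0)]=(\log n)/k$. For sequences of reals indexed by $N$, write $a\eqsim b$ if $a_N=(1+o(1))\,b_N$ as $N\to\infty$ (so $0\eqsim0$), and $a\ll b$, or $b\gg a$, if $a_N=o(b_N)$. In each of the two cases there are continuous functions $f,g:(0,\infty)\to(0,\infty)$, where $f_{\mathrm{directed}}\ne f_{\mathrm{undirected}}$ and $g_{\mathrm{directed}}\ne g_{\mathrm{undirected}}$ as functions, such that the following holds in that case. Let $n=n_N$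 and $k=k_N$ be sequences of positive integers with $n\to\infty$, $k\to\infty$ and $\log k\ll\log n$, and write $\kappa=k/\log n$. For every $\alpha\in\mathbb R$ the times $t_0$ and $t_\alpha$ are, for all large $N$, well defined (the defining equations have exactly one solution in $[0,\infty)$). The entropic time satisfies $$t_0\eqsim k\cdot\begin{cases} n^{2/k}/(2\pi e) & \text{if } k\ll\log n,\\ f(\lambda) & \text{if } k\eqsim\lambda\log n \text{ with } \lambda>0,\\ 1/(\kappa\log\kappa) & \text{if } k\gg\log n.\end{cases}$$ For every $\alpha\in\mathbb R$ one has $t_\alpha\eqsim t_0$ (in all three regimes, and also without assuming any of them), and furthermore $$t_\alpha-t_0\eqsim\frac{\alpha}{\sqrt k}\,t_0\cdot\begin{cases}\sqrt2 & \text{if } k\ll\log n,\\ g(\lambda) & \text{if } k\eqsim\lambda\log n \text{ with } \lambda>0,\\ \sqrt{\kappa\log\kappa} & \text{if } k\gg\log n.\end{cases}$$ -/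

import Mathlib

open Filter Asymptotics MeasureTheory ProbabilityTheory
open scoped Topology NNReal ENNReal

noncomputable section

namespace RandomCayley

/-- The two versions of the walk: in the directed case a selected generator is always added; in the
undirected case it is added or subtracted, each with probability one half. -/
inductive WalkCase where
  | directed
  | undirected

/-- The law of one step of the simple random walk on the integers: uniform on `{1, -1}`. -/
def srwStepLaw : Measure ℤ :=
  (2⁻¹ : ℝ≥0∞) • (Measure.dirac (1 : ℤ) + Measure.dirac (-1 : ℤ))

/-- The law after `m` steps of the discrete-time simple random walk on the integers started
at `0`. -/
def srwLaw : ℕ → Measure ℤ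
  | 0 => Measure.dirac 0
  | m + 1 => (srwLaw m).conv srwStepLaw

/-- The law at time `s` of the rate-one coordinate process started at `0`. Directed case: a rate-one
Poisson process, with law `Po(s)`. Undirected case: the rate-one continuous-time simple random walk
on the integers, that is, the simple random walk run for an independent `Po(s)` number of steps. -/
def rateOneLaw : WalkCase → ℝ≥0 → Measure ℤ
  | .directed, s => (poissonMeasure s).map (fun m : ℕ => (m : ℤ))
  | .undirected, s => (poissonMeasure s).bind srwLaw

/-- The law `ν_t` of `W₁(t)`, the coordinate process run at rate `1 / k`. It is used
for `0 ≤ t` and `1 ≤ k`. -/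
def coordLaw (c : WalkCase) (k : ℕ) (t : ℝ) : Measure ℤ :=
  rateOneLaw c (t / k).toNNReal

/-- The function `x ↦ -log ν_t(x)` on the integers; evaluated at `x = W₁(t)`, it is the random
variable `Q₁(t)`. Equivalently, it is `Q₁(t)` on the probability space `(ℤ, ν_t)`. -/
def Q₁ (c : WalkCase) (k : ℕ) (t : ℝ) (x : ℤ) : ℝ :=
  -Real.log ((coordLaw c k t).real {x})

/-- The expectation of `Q₁(t)`. -/
def meanQ (c : WalkCase) (k : ℕ) (t : ℝ) : ℝ :=
  ∫ x, Q₁ c k t x ∂(coordLaw c k t)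

/-- The variance of `Q₁(t)`. -/
def varQ (c : WalkCase) (k : ℕ) (t : ℝ) : ℝ :=
  variance (Q₁ c k t) (coordLaw c k t)

/-- `t` is a solution of the equation `E Q₁(t) = log n / k` that defines the entropic time. -/
def IsEntropicTime (c : WalkCase) (n k : ℕ) (t : ℝ) : Prop :=
  0 ≤ t ∧ meanQ c k t = Real.log n / k

/-- The entropic time `t₀(n, k)`: the solution of its defining equation. -/
def entropicTime (c : WalkCase) (n k : ℕ) : ℝ :=
  sInf {t : ℝ | IsEntropicTime c n k t}

/-- `t` is a solution of the equation `E Q₁(t) = (log n + α √(v k)) / k`, with `v = Var Q₁(t₀)`,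
that defines the cutoff time at `α`. -/
def IsCutoffTime (c : WalkCase) (n k : ℕ) (α t : ℝ) : Prop :=
  0 ≤ t ∧
    meanQ c k t = (Real.log n + α * Real.sqrt (varQ c k (entropicTime c n k) * k)) / k

/-- The cutoff time `t_α(n, k)`: the solution of its defining equation. -/
def cutoffTime (c : WalkCase) (n k : ℕ) (α : ℝ) : ℝ :=
  sInf {t : ℝ | IsCutoffTime c n k α t}

/-- At `α = 0` the cutoff time is the entropic time. -/
theorem cutoffTime_zero (c : WalkCase) (n k : ℕ) :
    cutoffTime c n k 0 = entropicTime c n k := by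
  simp [cutoffTime, entropicTime, IsCutoffTime, IsEntropicTime]

end RandomCayley

end

open RandomCayley

noncomputable section

namespace RandomCayley

open scoped Nat

/-! After rescaling time by s = t / k, everything concerns one rate-one process with point masses
ν_s(x) (`mass`), its entropy H(s) (`entropyFn`) and the variance V(s) of its surprisal (`varFn`).
The entropic equation reads H(s) = log n / k and the cutoff equation H(s) = log n / k + α √(V(s₀) /
k). Since H is a strictly increasing bijection of [0, ∞), both are uniquely solvable once the
right-hand side is nonnegative, and t₀ = k H⁻¹(log n / k). By the mean value theorem t_α - t₀ is
asymptotic to (α / √k) t₀ G(s₀), where G = √V / (s H') is `slopeFn`, provided that s_α / s₀ → 1 and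
that H' varies slowly. Hence f(λ) = H⁻¹(1/λ) and g(λ) = G(H⁻¹(1/λ)), and the other two regimes are
the limits s → ∞ and s → 0.

Two identities for the masses carry the computations: the forward equation `hasDerivAt_mass`, which
gives H' (`hasDerivAt_entropyFn`), and the Stein-type identity `mul_mass`, which gives the moments,
the tail bounds and the ratios of masses. Positivity of H' is Gibbs' inequality between ν_s and its
translates.

As s → 0 at most one jump matters. With h the entropy of one step (0 or log 2), both H' and √(V/s)
equal -log s + h + o(1), whence H / s = -log s + h + 1 + o(1) and G is asymptotic to 1 / √s. As s →
∞ the surprisal is log(2πs)/2 + (x - drift · s)² / (2s) up to an error tending to 0 in L². Thus H =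
log(2πes)/2 + o(1) and V → 1/2; a separate argument gives s H' → 1/2. The L² estimate comes from
Stirling's formula in the directed case; in the undirected case it comes from the return probability
(Laplace's method) and from bounds on ratios of Bessel functions (`antitone_of_ratio_rec`).

The hypothesis log k ≪ log n enters only when k ≫ log n: it makes k s₀ → ∞, so that the shift α
√(V/k) is small compared with H(s₀). When no regime is assumed, the statements are tested on
ultrafilters, along which log n / k has a limit in [0, ∞]. The two cases are told apart by h, which
can be recovered from either f or g through the behaviour at small s. -/

/-- The probability that a selected generator is added. -/
def stepProb : WalkCase → ℝ
  | .directed => 1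
  | .undirected => 1 / 2

/-- The probability that a selected generator is subtracted. -/
def stepProb' : WalkCase → ℝ
  | .directed => 0
  | .undirected => 1 / 2

lemma stepProb_pos (c : WalkCase) : 0 < stepProb c := by cases c <;> norm_num [stepProb]

lemma stepProb'_nonneg (c : WalkCase) : 0 ≤ stepProb' c := by cases c <;> norm_num [stepProb']

lemma stepProb_add (c : WalkCase) : stepProb c + stepProb' c = 1 := by
  cases c <;> norm_num [stepProb, stepProb']

lemma half_le_stepProb (c : WalkCase) : 1 / 2 ≤ stepProb c := by cases c <;> norm_num [stepProb]

/-! ### Weights of the discrete walk and point masses of the coordinate process -/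

/-- The weights of the discrete-time walk after `m` steps. -/
def stepWeight (c : WalkCase) : ℕ → ℤ → ℝ
  | 0, x => if x = 0 then 1 else 0
  | m + 1, x => stepProb c * stepWeight c m (x - 1) + stepProb' c * stepWeight c m (x + 1)

lemma stepWeight_nonneg (c : WalkCase) (m : ℕ) (x : ℤ) : 0 ≤ stepWeight c m x := by
  induction m generalizing x with
  | zero => simp only [stepWeight]; split_ifs <;> norm_num
  | succ m ih =>
    simp only [stepWeight]
    have := stepProb_pos c
    have := stepProb'_nonneg c
    have := ih (x - 1)
    have := ih (x + 1)
    positivity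

lemma stepWeight_le_one (c : WalkCase) (m : ℕ) (x : ℤ) : stepWeight c m x ≤ 1 := by
  induction m generalizing x with
  | zero => simp only [stepWeight]; split_ifs <;> norm_num
  | succ m ih =>
    simp only [stepWeight]
    nlinarith [stepProb_pos c, stepProb'_nonneg c, ih (x - 1), ih (x + 1), stepProb_add c]

lemma stepWeight_natCast_self (c : WalkCase) (m : ℕ) : stepProb c ^ m ≤ stepWeight c m m := by
  induction m with
  | zero => simp [stepWeight]
  | succ m ih =>
    have h : ((m + 1 : ℕ) : ℤ) - 1 = m := by push_cast; ring
    simp only [stepWeight, h, pow_succ']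
    nlinarith [mul_le_mul_of_nonneg_left ih (stepProb_pos c).le,
      mul_nonneg (stepProb'_nonneg c) (stepWeight_nonneg c m ((m + 1 : ℕ) + 1))]

lemma stepWeight_neg_natCast_self (c : WalkCase) (m : ℕ) :
    stepProb' c ^ m ≤ stepWeight c m (-m) := by
  induction m with
  | zero => simp [stepWeight]
  | succ m ih =>
    have h : -((m + 1 : ℕ) : ℤ) + 1 = -m := by push_cast; ring
    simp only [stepWeight, h, pow_succ']
    nlinarith [mul_le_mul_of_nonneg_left ih (stepProb'_nonneg c),
      mul_nonneg (stepProb_pos c).le (stepWeight_nonneg c m (-((m + 1 : ℕ) : ℤ) - 1))]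

/-- By exchangeability each of the m + 1 steps contributes equally to the position: on the event of
ending at x, the sum of the steps is x, while the expectation of the last step alone is the bracket
on the right. -/
lemma mul_stepWeight_succ (c : WalkCase) (m : ℕ) (x : ℤ) :
    x * stepWeight c (m + 1) x =
      (m + 1) * (stepProb c * stepWeight c m (x - 1) - stepProb' c * stepWeight c m (x + 1)) := by
  induction m generalizing x with
  | zero =>
    simp only [stepWeight, sub_eq_zero, add_eq_zero_iff_eq_neg]
    by_cases h1 : x = 1
    · subst h1; norm_num
    · by_cases h2 : x = -1
      · subst h2; norm_num
      · simp [h1, h2]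
  | succ m ih =>
    have e : ∀ y : ℤ, stepWeight c (m + 2) y =
      stepProb c * stepWeight c (m + 1) (y - 1) + stepProb' c * stepWeight c (m + 1) (y + 1) :=
      fun _ => rfl
    have e1 : ∀ y : ℤ, stepWeight c (m + 1) y =
      stepProb c * stepWeight c m (y - 1) + stepProb' c * stepWeight c m (y + 1) := fun _ => rfl
    have i1 := ih (x - 1)
    have i2 := ih (x + 1)
    rw [e]
    have j1 := e1 (x - 1)
    have j2 := e1 (x + 1)
    simp only [sub_add_cancel, add_sub_cancel_right] at i1 i2 j1 j2
    push_cast at i1 i2 ⊢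
    linear_combination stepProb c * i1 + stepProb' c * i2 -
      (m + 1) * (stepProb c * j1 - stepProb' c * j2)

/-- The point masses of the rate-one coordinate process at time `s`. -/
def mass (c : WalkCase) (s : ℝ) (x : ℤ) : ℝ :=
  Real.exp (-s) * ∑' m : ℕ, stepWeight c m x * (s ^ m / m !)

/-- Exponential generating functions of bounded sequences can be differentiated termwise. -/
lemma summable_mul_pow_div_factorial {a : ℕ → ℝ} (ha : ∀ m, |a m| ≤ 1) (s : ℝ) :
    Summable fun m => a m * (s ^ m / m !) := by
  refine Summable.of_norm_bounded (Real.summable_pow_div_factorial |s|) fun m => ?_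
  rw [norm_mul, norm_div, norm_pow, Real.norm_eq_abs, Real.norm_eq_abs, Real.norm_natCast]
  exact mul_le_of_le_one_left (by positivity) (ha m)

/-- On (-R, R) the derivatives are dominated by the terms of the exponential series at R. The
derivative of the term m = 0 vanishes, hence the index shift. -/
lemma hasDerivAt_tsum_pow_div_factorial {a : ℕ → ℝ} (ha : ∀ m, |a m| ≤ 1) (s : ℝ) :
    HasDerivAt (fun s => ∑' m, a m * (s ^ m / m !)) (∑' m, a (m + 1) * (s ^ m / m !)) s := by
  obtain ⟨R, hR⟩ := exists_gt |s|
  have hR0 : 0 < R := (abs_nonneg s).trans_lt hR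
  have key := hasDerivAt_tsum_of_isPreconnected (𝕜 := ℝ)
    (g := fun (m : ℕ) (s : ℝ) => a m * (s ^ m / m !))
    (g' := fun (m : ℕ) (s : ℝ) => a m * (m * s ^ (m - 1) / m !))
    (u := fun m : ℕ => m * R ^ (m - 1) / m !) (t := Set.Ioo (-R) R) (y₀ := s) (y := s)
    ?_ isOpen_Ioo isPreconnected_Ioo ?_ ?_ (abs_lt.1 hR) (summable_mul_pow_div_factorial ha s)
    (abs_lt.1 hR)
  · convert! key using 1
    have hs : Summable fun m : ℕ => a m * (m * s ^ (m - 1) / m !) := by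
      rw [← summable_nat_add_iff 1]
      convert! summable_mul_pow_div_factorial (fun m => ha (m + 1)) s using 2 with m
      rw [Nat.factorial_succ]; push_cast
      have : (m ! : ℝ) ≠ 0 := by positivity
      field_simp
    rw [hs.tsum_eq_zero_add]
    simp only [Nat.cast_zero, zero_mul, zero_div, mul_zero, zero_add]
    congr 1; ext m
    rw [Nat.factorial_succ]; push_cast
    have : (m ! : ℝ) ≠ 0 := by positivity
    field_simp
  · rw [← summable_nat_add_iff 1]
    convert! Real.summable_pow_div_factorial R using 2 with m
    rw [Nat.factorial_succ]; push_cast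
    have : (m ! : ℝ) ≠ 0 := by positivity
    field_simp
  · intro m y _
    exact ((hasDerivAt_pow m y).div_const _).const_mul _
  · intro m y hy
    have hy' : |y| ≤ R := (abs_lt.2 hy).le
    rw [norm_mul, norm_div, norm_mul, norm_pow, Real.norm_natCast, Real.norm_natCast,
      Real.norm_eq_abs, Real.norm_eq_abs]
    refine (mul_le_of_le_one_left (by positivity) (ha m)).trans ?_
    gcongr

lemma abs_stepWeight_le_one (c : WalkCase) (x : ℤ) (m : ℕ) : |stepWeight c m x| ≤ 1 := by
  rw [abs_of_nonneg (stepWeight_nonneg c m x)]; exact stepWeight_le_one c m x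

lemma summable_stepWeight (c : WalkCase) (s : ℝ) (x : ℤ) :
    Summable fun m : ℕ => stepWeight c m x * (s ^ m / m !) :=
  summable_mul_pow_div_factorial (abs_stepWeight_le_one c x) s

lemma tsum_stepWeight_succ (c : WalkCase) (s : ℝ) (x : ℤ) :
    ∑' m : ℕ, stepWeight c (m + 1) x * (s ^ m / m !) =
      stepProb c * ∑' m : ℕ, stepWeight c m (x - 1) * (s ^ m / m !) +
        stepProb' c * ∑' m : ℕ, stepWeight c m (x + 1) * (s ^ m / m !) := by
  rw [← tsum_mul_left, ← tsum_mul_left, ← Summable.tsum_add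
    ((summable_stepWeight c s _).mul_left _) ((summable_stepWeight c s _).mul_left _)]
  congr 1; ext m
  simp only [stepWeight]; ring

/-- The time derivative of the point masses. -/
def massDeriv (c : WalkCase) (s : ℝ) (x : ℤ) : ℝ :=
  stepProb c * mass c s (x - 1) + stepProb' c * mass c s (x + 1) - mass c s x

/-- Kolmogorov's forward equation: shifting the index of the weights is one step of the walk, and
differentiating the factor exp (-s) gives the loss term. -/
lemma hasDerivAt_mass (c : WalkCase) (s : ℝ) (x : ℤ) :
    HasDerivAt (fun s => mass c s x) (massDeriv c s x) s := by
  have h := ((hasDerivAt_neg s).exp).mul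
    (hasDerivAt_tsum_pow_div_factorial (abs_stepWeight_le_one c x) s)
  convert! h using 1
  rw [tsum_stepWeight_succ]
  simp only [massDeriv, mass]
  ring

/-- The continuous-time form of `mul_stepWeight_succ`, with s replacing the number of steps. For the
Poisson law it is the Chen–Stein identity, and for the simple random walk the three-term recursion
of Bessel functions. -/
lemma mul_mass (c : WalkCase) (s : ℝ) (x : ℤ) :
    x * mass c s x = s * (stepProb c * mass c s (x - 1) - stepProb' c * mass c s (x + 1)) := by
  have h : x * ∑' m : ℕ, stepWeight c m x * (s ^ m / m !) =
      s * (stepProb c * ∑' m : ℕ, stepWeight c m (x - 1) * (s ^ m / m !) -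
        stepProb' c * ∑' m : ℕ, stepWeight c m (x + 1) * (s ^ m / m !)) := by
    rw [← tsum_mul_left, ← tsum_mul_left, ← tsum_mul_left, ← Summable.tsum_sub
      ((summable_stepWeight c s _).mul_left _) ((summable_stepWeight c s _).mul_left _),
      ← tsum_mul_left, ((summable_stepWeight c s x).mul_left _).tsum_eq_zero_add]
    have h0 : (x : ℝ) * (stepWeight c 0 x * (s ^ 0 / (0 : ℕ)!)) = 0 := by
      simp only [stepWeight]; split_ifs with hx <;> simp [hx]
    rw [h0, zero_add]
    congr 1; ext m
    rw [← mul_assoc, mul_stepWeight_succ, Nat.factorial_succ]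
    push_cast
    have : (m ! : ℝ) ≠ 0 := by positivity
    field_simp
    ring
  simp only [mass]
  linear_combination Real.exp (-s) * h

lemma mass_nonneg (c : WalkCase) {s : ℝ} (hs : 0 ≤ s) (x : ℤ) : 0 ≤ mass c s x :=
  mul_nonneg (Real.exp_pos _).le (tsum_nonneg fun m =>
    mul_nonneg (stepWeight_nonneg c m x) (by positivity))

lemma mass_zero (c : WalkCase) (x : ℤ) : mass c 0 x = if x = 0 then 1 else 0 := by
  rw [mass, tsum_eq_single 0 (by intro m hm; simp [hm])]
  simp [stepWeight]

lemma mass_le_one (c : WalkCase) {s : ℝ} (hs : 0 ≤ s) (x : ℤ) : mass c s x ≤ 1 := by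
  have h : ∑' m : ℕ, stepWeight c m x * (s ^ m / m !) ≤ ∑' m : ℕ, s ^ m / m ! :=
    (summable_stepWeight c s x).tsum_le_tsum (fun m =>
      mul_le_of_le_one_left (by positivity) (stepWeight_le_one c m x))
      (Real.summable_pow_div_factorial s)
  have e : ∑' m : ℕ, s ^ m / m ! = Real.exp s := by
    rw [Real.exp_eq_exp_ℝ, NormedSpace.exp_eq_tsum_div]
  calc mass c s x ≤ Real.exp (-s) * Real.exp s := by
        rw [mass, ← e]; gcongr
    _ = 1 := by rw [← Real.exp_add]; simp

lemma le_mass (c : WalkCase) {s : ℝ} (hs : 0 ≤ s) (x : ℤ) (m : ℕ) :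
    Real.exp (-s) * (stepWeight c m x * (s ^ m / m !)) ≤ mass c s x := by
  unfold mass
  gcongr
  exact (summable_stepWeight c s x).le_tsum m fun j _ =>
    mul_nonneg (stepWeight_nonneg c j x) (by positivity)

lemma le_mass_natCast (c : WalkCase) {s : ℝ} (hs : 0 ≤ s) (m : ℕ) :
    Real.exp (-s) * ((stepProb c * s) ^ m / m !) ≤ mass c s m := by
  refine le_trans ?_ (le_mass c hs m m)
  rw [mul_pow, mul_div_assoc]
  gcongr
  exact stepWeight_natCast_self c m

lemma le_mass_neg_natCast (c : WalkCase) {s : ℝ} (hs : 0 ≤ s) (m : ℕ) :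
    Real.exp (-s) * ((stepProb' c * s) ^ m / m !) ≤ mass c s (-m) := by
  refine le_trans ?_ (le_mass c hs (-m) m)
  rw [mul_pow, mul_div_assoc]
  gcongr
  exact stepWeight_neg_natCast_self c m

lemma mass_natCast_pos (c : WalkCase) {s : ℝ} (hs : 0 < s) (m : ℕ) : 0 < mass c s m := by
  refine lt_of_lt_of_le ?_ (le_mass_natCast c hs.le m)
  have := stepProb_pos c
  positivity

lemma mass_natCast_succ_le (c : WalkCase) {s : ℝ} (hs : 0 ≤ s) (m : ℕ) :
    (m + 1) * mass c s (m + 1) ≤ stepProb c * s * mass c s m := by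
  have h := mul_mass c s (m + 1)
  push_cast at h
  rw [h, add_sub_cancel_right]
  nlinarith [mul_nonneg hs (mul_nonneg (stepProb'_nonneg c) (mass_nonneg c hs (m + 1 + 1)))]

lemma mass_neg_natCast_succ_le (c : WalkCase) {s : ℝ} (hs : 0 ≤ s) (m : ℕ) :
    (m + 1) * mass c s (-(m + 1)) ≤ stepProb' c * s * mass c s (-m) := by
  have h := mul_mass c s (-(m + 1))
  push_cast at h
  have e : (-((m : ℤ) + 1) + 1) = -m := by ring
  rw [e] at h
  nlinarith [mul_nonneg hs (mul_nonneg (stepProb_pos c).le (mass_nonneg c hs (-(m + 1) - 1)))]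

/-- Dropping the negative term of `mul_mass` leaves a one-step inequality moving away from 0, which
is iterated on either half-line. The resulting bound is monotone in s, so that it serves as a
dominating sequence. -/
lemma mass_le (c : WalkCase) {s : ℝ} (hs : 0 ≤ s) (x : ℤ) :
    mass c s x ≤ s ^ x.natAbs / (x.natAbs)! := by
  have h1 := stepProb_add c
  have h2 := stepProb_pos c
  have h3 := stepProb'_nonneg c
  have aux : ∀ (u : ℕ → ℝ), (∀ m, 0 ≤ u m) → u 0 ≤ 1 → (∀ m : ℕ, (m + 1) * u (m + 1) ≤ s * u m) →
      ∀ m : ℕ, u m ≤ s ^ m / m ! := by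
    intro u hu h0 hstep m
    induction m with
    | zero => simpa using h0
    | succ m ih =>
      have hm := hstep m
      rw [Nat.factorial_succ]; push_cast
      rw [pow_succ', mul_div_mul_comm]
      have : u (m + 1) ≤ s / (m + 1) * u m := by
        rw [div_mul_eq_mul_div, le_div_iff₀ (by positivity)]; linarith
      exact this.trans (by gcongr)
  obtain ⟨m, rfl | rfl⟩ := x.eq_nat_or_neg
  · rw [Int.natAbs_natCast]
    refine aux (fun m => mass c s m) (fun m => mass_nonneg c hs _) (mass_le_one c hs _) ?_ m
    intro m
    have := mass_natCast_succ_le c hs m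
    push_cast
    refine this.trans ?_
    have := mass_nonneg c hs m
    gcongr
    nlinarith
  · rw [Int.natAbs_neg, Int.natAbs_natCast]
    refine aux (fun m => mass c s (-m)) (fun m => mass_nonneg c hs _) (mass_le_one c hs _) ?_ m
    intro m
    have := mass_neg_natCast_succ_le c hs m
    push_cast
    refine this.trans ?_
    have := mass_nonneg c hs (-m)
    gcongr
    nlinarith

/-! ### Comparison with the laws of the processes -/

lemma stepWeight_directed (m : ℕ) (x : ℤ) :
    stepWeight .directed m x = if x = m then 1 else 0 := by
  induction m generalizing x with
  | zero => simp [stepWeight]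
  | succ m ih =>
    simp only [stepWeight, stepProb, stepProb', ih, one_mul, zero_mul, add_zero]
    congr 1
    simp [sub_eq_iff_eq_add]

lemma srwLaw_singleton (m : ℕ) (x : ℤ) :
    IsProbabilityMeasure (srwLaw m) ∧
      srwLaw m {x} = ENNReal.ofReal (stepWeight .undirected m x) := by
  have hstep : IsProbabilityMeasure srwStepLaw := by
    constructor
    rw [srwStepLaw]
    simp only [Measure.smul_apply, Measure.add_apply, measure_univ, smul_eq_mul]
    rw [one_add_one_eq_two, ENNReal.inv_mul_cancel] <;> simp
  induction m generalizing x with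
  | zero =>
    refine ⟨by rw [srwLaw]; infer_instance, ?_⟩
    simp only [srwLaw, stepWeight]
    by_cases h : x = 0
    · simp [h]
    · simp [h, Ne.symm h]
  | succ m ih =>
    have hm : IsProbabilityMeasure (srwLaw m) := (ih 0).1
    refine ⟨by rw [srwLaw]; infer_instance, ?_⟩
    have e : srwLaw (m + 1) = (2⁻¹ : ℝ≥0∞) • ((srwLaw m).map (fun y => y + 1) +
        (srwLaw m).map (fun y => y + -1)) := by
      rw [srwLaw, srwStepLaw, Measure.conv_smul_right, Measure.conv_add, Measure.conv_dirac,
        Measure.conv_dirac]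
    rw [e, Measure.smul_apply, Measure.add_apply, Measure.map_apply .of_discrete (.singleton x),
      Measure.map_apply .of_discrete (.singleton x)]
    have e1 : (fun y : ℤ => y + 1) ⁻¹' {x} = {x - 1} := by ext y; simp; omega
    have e2 : (fun y : ℤ => y + -1) ⁻¹' {x} = {x + 1} := by ext y; simp
    rw [e1, e2, (ih _).2, (ih _).2, ← ENNReal.ofReal_add (stepWeight_nonneg _ _ _)
      (stepWeight_nonneg _ _ _), smul_eq_mul]
    have : (2⁻¹ : ℝ≥0∞) = ENNReal.ofReal (2⁻¹) := by
      rw [ENNReal.ofReal_inv_of_pos two_pos]; norm_num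
    rw [this, ← ENNReal.ofReal_mul (by norm_num)]
    congr 1
    simp only [stepWeight, stepProb, stepProb']
    ring

instance (m : ℕ) : IsProbabilityMeasure (srwLaw m) := (srwLaw_singleton m 0).1

instance (c : WalkCase) (s : ℝ≥0) : IsProbabilityMeasure (rateOneLaw c s) := by
  cases c with
  | directed => exact Measure.isProbabilityMeasure_map .of_discrete
  | undirected =>
    constructor
    rw [rateOneLaw, Measure.bind_apply .univ (Measurable.of_discrete.aemeasurable)]
    simp

lemma rateOneLaw_real_singleton (c : WalkCase) {s : ℝ} (hs : 0 ≤ s) (x : ℤ) :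
    (rateOneLaw c s.toNNReal).real {x} = mass c s x := by
  have hc : (s.toNNReal : ℝ) = s := Real.coe_toNNReal s hs
  cases c with
  | directed =>
    rw [rateOneLaw, Measure.real, Measure.map_apply .of_discrete (.singleton x)]
    simp only [mass, stepWeight_directed]
    by_cases hx : ∃ m : ℕ, x = m
    · obtain ⟨m, rfl⟩ := hx
      have : (fun m : ℕ => (m : ℤ)) ⁻¹' {(m : ℤ)} = {m} := by ext y; simp
      rw [this, tsum_eq_single m (by intro j hj; simp [Ne.symm hj]), poissonMeasure_singleton,
        ENNReal.toReal_ofReal (by positivity), hc]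
      simp [mul_div_assoc]
    · push Not at hx
      have : (fun m : ℕ => (m : ℤ)) ⁻¹' {x} = ∅ := by
        ext y; simpa using (hx y).symm
      rw [this]
      simp [hx]
  | undirected =>
    rw [rateOneLaw, Measure.real, Measure.bind_apply (.singleton x)
      (Measurable.of_discrete.aemeasurable), lintegral_countable']
    simp only [poissonMeasure_singleton, (srwLaw_singleton _ x).2]
    simp_rw [← ENNReal.ofReal_mul (stepWeight_nonneg _ _ _)]
    rw [← ENNReal.ofReal_tsum_of_nonneg]
    · rw [ENNReal.toReal_ofReal]
      · rw [mass, ← tsum_mul_left, hc]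
        congr 1; ext m; ring
      · exact tsum_nonneg fun m => mul_nonneg (stepWeight_nonneg _ _ _) (by positivity)
    · exact fun m => mul_nonneg (stepWeight_nonneg _ _ _) (by positivity)
    · rw [hc]
      convert! (summable_stepWeight .undirected s x).mul_left (Real.exp (-s)) using 2 with m
      ring

/-- No integrability is required: if `f` is not integrable, the integral and the sum are both 0 by
convention. -/
lemma integral_rateOneLaw (c : WalkCase) {s : ℝ} (hs : 0 ≤ s) (f : ℤ → ℝ) :
    ∫ x, f x ∂(rateOneLaw c s.toNNReal) = ∑' x, mass c s x * f x := by
  conv_lhs => rw [← Measure.sum_smul_dirac (rateOneLaw c s.toNNReal)]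
  rw [integral_sum_dirac (by simp)]
  congr 1; ext x
  rw [← rateOneLaw_real_singleton c hs, smul_eq_mul, Measure.real]

lemma tsum_mass (c : WalkCase) {s : ℝ} (hs : 0 ≤ s) : ∑' x, mass c s x = 1 := by
  have h := integral_rateOneLaw c hs (fun _ => 1)
  simp only [mul_one] at h
  rw [← h]; simp

/-! ### Expectations of functions of polynomial growth -/

/-- Functions on the integers of at most polynomial growth. -/
@[fun_prop]
def PolyGrowth (f : ℤ → ℝ) : Prop :=
  ∃ (C : ℝ) (k : ℕ), ∀ x, |f x| ≤ C * (1 + |(x : ℝ)|) ^ k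

namespace PolyGrowth

variable {f g : ℤ → ℝ}

lemma exists_nonneg (hf : PolyGrowth f) :
    ∃ (C : ℝ) (k : ℕ), 0 ≤ C ∧ ∀ x, |f x| ≤ C * (1 + |(x : ℝ)|) ^ k := by
  obtain ⟨C, k, h⟩ := hf
  refine ⟨C, k, ?_, h⟩
  have := (abs_nonneg _).trans (h 0)
  simpa using this

@[fun_prop]
lemma const (a : ℝ) : PolyGrowth fun _ => a := ⟨|a|, 0, by simp⟩

@[fun_prop]
lemma cast : PolyGrowth fun x => (x : ℝ) :=
  ⟨1, 1, fun x => by simp⟩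

lemma mono (hg : PolyGrowth g) (h : ∀ x, |f x| ≤ |g x|) : PolyGrowth f := by
  obtain ⟨C, k, hC⟩ := hg
  exact ⟨C, k, fun x => (h x).trans (hC x)⟩

@[fun_prop]
lemma abs (hf : PolyGrowth f) : PolyGrowth fun x => |f x| := hf.mono fun x => by simp

@[fun_prop]
lemma neg (hf : PolyGrowth f) : PolyGrowth fun x => -f x := hf.mono fun x => by simp

@[fun_prop]
lemma add (hf : PolyGrowth f) (hg : PolyGrowth g) : PolyGrowth fun x => f x + g x := by
  obtain ⟨C, k, hC0, hC⟩ := hf.exists_nonneg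
  obtain ⟨B, l, hB0, hB⟩ := hg.exists_nonneg
  refine ⟨C + B, k + l, fun x => (abs_add_le _ _).trans ?_⟩
  have h1 : (1 : ℝ) ≤ 1 + |(x : ℝ)| := by linarith [abs_nonneg (x : ℝ)]
  have h2 : (1 + |(x : ℝ)|) ^ k ≤ (1 + |(x : ℝ)|) ^ (k + l) := pow_le_pow_right₀ h1 (by omega)
  have h3 : (1 + |(x : ℝ)|) ^ l ≤ (1 + |(x : ℝ)|) ^ (k + l) := pow_le_pow_right₀ h1 (by omega)
  have := hC x
  have := hB x
  nlinarith [mul_le_mul_of_nonneg_left h2 hC0, mul_le_mul_of_nonneg_left h3 hB0]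

@[fun_prop]
lemma sub (hf : PolyGrowth f) (hg : PolyGrowth g) : PolyGrowth fun x => f x - g x := by
  simpa only [sub_eq_add_neg] using hf.add hg.neg

@[fun_prop]
lemma mul (hf : PolyGrowth f) (hg : PolyGrowth g) : PolyGrowth fun x => f x * g x := by
  obtain ⟨C, k, hC0, hC⟩ := hf.exists_nonneg
  obtain ⟨B, l, hB0, hB⟩ := hg.exists_nonneg
  refine ⟨C * B, k + l, fun x => ?_⟩
  rw [abs_mul, pow_add, mul_mul_mul_comm]
  exact mul_le_mul (hC x) (hB x) (abs_nonneg _) ((abs_nonneg _).trans (hC x))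

@[fun_prop]
lemma pow (hf : PolyGrowth f) (n : ℕ) : PolyGrowth fun x => f x ^ n := by
  induction n with
  | zero => simpa using const 1
  | succ n ih => simpa only [pow_succ] using ih.mul hf

@[fun_prop]
lemma div_const (hf : PolyGrowth f) (a : ℝ) : PolyGrowth fun x => f x / a := by
  simpa only [div_eq_mul_inv] using hf.mul (const a⁻¹)

lemma comp_shift (hf : PolyGrowth f) {σ : ℤ → ℤ} (h : ∀ x : ℤ, |σ x| ≤ |x| + 1) :
    PolyGrowth fun x => f (σ x) := by
  obtain ⟨C, k, hC0, hC⟩ := hf.exists_nonneg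
  refine ⟨C * 2 ^ k, k, fun x => (hC _).trans ?_⟩
  rw [mul_assoc, ← mul_pow]
  have h1 : |(σ x : ℝ)| ≤ |(x : ℝ)| + 1 := by exact_mod_cast h x
  have := abs_nonneg (x : ℝ)
  gcongr
  linarith

lemma comp_add_one (hf : PolyGrowth f) : PolyGrowth fun x => f (x + 1) :=
  hf.comp_shift (σ := fun x => x + 1) fun x => (abs_add_le _ _).trans (by simp)

lemma comp_sub_one (hf : PolyGrowth f) : PolyGrowth fun x => f (x - 1) :=
  hf.comp_shift (σ := fun x => x - 1) fun x => (abs_sub _ _).trans (by simp)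

end PolyGrowth

/-- A summable majorant of the point masses, uniform for times up to `R`. -/
def massBound (R : ℝ) (x : ℤ) : ℝ := R ^ x.natAbs / (x.natAbs)!

lemma massBound_nonneg {R : ℝ} (hR : 0 ≤ R) (x : ℤ) : 0 ≤ massBound R x := by
  unfold massBound; positivity

lemma mass_le_massBound (c : WalkCase) {s R : ℝ} (hs : 0 ≤ s) (hR : s ≤ R) (x : ℤ) :
    mass c s x ≤ massBound R x :=
  (mass_le c hs x).trans (by unfold massBound; gcongr)

lemma PolyGrowth.summable_massBound_mul {f : ℤ → ℝ} (hf : PolyGrowth f) {R : ℝ} (hR : 0 ≤ R) :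
    Summable fun x => massBound R x * |f x| := by
  obtain ⟨C, k, hC0, hC⟩ := hf.exists_nonneg
  have key : Summable fun n : ℕ => R ^ n / n ! * (C * (1 + (n : ℝ)) ^ k) := by
    refine Summable.of_nonneg_of_le (fun n => by positivity) (fun n => ?_)
      ((Real.summable_pow_div_factorial (R * Real.exp 1)).mul_left (C * k ! * Real.exp 1))
    -- This is y ^ k / k! ≤ exp y at y = 1 + n. It replaces the polynomial by a geometric factor,
    -- absorbed by changing R to R e.
    have h : (1 + (n : ℝ)) ^ k ≤ k ! * (Real.exp 1 * Real.exp 1 ^ n) := by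
      have := Real.pow_div_factorial_le_exp (x := 1 + (n : ℝ)) (by positivity) k
      rw [div_le_iff₀ (by positivity), Real.exp_add, ← Real.exp_one_pow n] at this
      linarith
    calc R ^ n / n ! * (C * (1 + (n : ℝ)) ^ k)
        ≤ R ^ n / n ! * (C * (k ! * (Real.exp 1 * Real.exp 1 ^ n))) := by gcongr
      _ = _ := by rw [mul_pow]; ring
  have hle : ∀ x : ℤ, massBound R x * |f x| ≤ massBound R x * (C * (1 + |(x : ℝ)|) ^ k) :=
    fun x => mul_le_mul_of_nonneg_left (hC x) (massBound_nonneg hR x)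
  refine Summable.of_nonneg_of_le
    (fun x => mul_nonneg (massBound_nonneg hR x) (abs_nonneg _)) hle ?_
  refine Summable.of_nat_of_neg ?_ ?_
  · convert! key using 2 with n
    simp [massBound]
  · convert! key using 2 with n
    simp [massBound]

lemma PolyGrowth.summable_mass_mul {f : ℤ → ℝ} (hf : PolyGrowth f) (c : WalkCase) {s : ℝ}
    (hs : 0 ≤ s) : Summable fun x => mass c s x * f x := by
  refine Summable.of_norm_bounded (hf.summable_massBound_mul hs) fun x => ?_
  rw [norm_mul, Real.norm_eq_abs, Real.norm_eq_abs, abs_of_nonneg (mass_nonneg c hs x)]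
  gcongr
  exact mass_le_massBound c hs le_rfl x

/-- The expectation of a function of the coordinate process at time `s`. -/
def expect (c : WalkCase) (s : ℝ) (f : ℤ → ℝ) : ℝ := ∑' x, mass c s x * f x

section expect

variable (c : WalkCase) {s : ℝ} (hs : 0 ≤ s) {f g : ℤ → ℝ}
include hs

lemma expect_const (a : ℝ) : expect c s (fun _ => a) = a := by
  rw [expect, tsum_mul_right, tsum_mass c hs, one_mul]

lemma expect_add (hf : PolyGrowth f) (hg : PolyGrowth g) :
    expect c s (fun x => f x + g x) = expect c s f + expect c s g := by
  simp only [expect, mul_add]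
  exact (hf.summable_mass_mul c hs).tsum_add (hg.summable_mass_mul c hs)

lemma expect_sub (hf : PolyGrowth f) (hg : PolyGrowth g) :
    expect c s (fun x => f x - g x) = expect c s f - expect c s g := by
  simp only [expect, mul_sub]
  exact (hf.summable_mass_mul c hs).tsum_sub (hg.summable_mass_mul c hs)

omit hs in
lemma expect_const_mul (a : ℝ) : expect c s (fun x => a * f x) = a * expect c s f := by
  simp only [expect, ← tsum_mul_left]
  congr 1; ext x; ring

lemma expect_mono (hf : PolyGrowth f) (hg : PolyGrowth g) (h : ∀ x, f x ≤ g x) :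
    expect c s f ≤ expect c s g :=
  (hf.summable_mass_mul c hs).tsum_le_tsum
    (fun x => mul_le_mul_of_nonneg_left (h x) (mass_nonneg c hs x)) (hg.summable_mass_mul c hs)

lemma expect_nonneg (h : ∀ x, 0 ≤ f x) : 0 ≤ expect c s f :=
  tsum_nonneg fun x => mul_nonneg (mass_nonneg c hs x) (h x)

lemma abs_expect_le (hf : PolyGrowth f) : |expect c s f| ≤ expect c s (fun x => |f x|) := by
  have h1 := expect_mono c hs hf hf.abs fun x => le_abs_self _
  have h2 := expect_mono c hs hf.neg hf.abs fun x => neg_le_abs _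
  have h3 := expect_const_mul c (s := s) (f := f) (-1)
  simp only [neg_mul, one_mul] at h3
  rw [h3] at h2
  exact abs_le'.2 ⟨h1, h2⟩

/-- `mul_mass` tested against f, with the shifts of the masses moved onto f. -/
lemma expect_cast_mul (hf : PolyGrowth f) :
    expect c s (fun x => x * f x) =
      s * (stepProb c * expect c s (fun x => f (x + 1)) -
        stepProb' c * expect c s (fun x => f (x - 1))) := by
  have h1 : expect c s (fun x => f (x + 1)) = ∑' x, mass c s (x - 1) * f x := by
    rw [← (Equiv.addRight (1 : ℤ)).tsum_eq fun x => mass c s (x - 1) * f x]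
    simp [expect]
  have h2 : expect c s (fun x => f (x - 1)) = ∑' x, mass c s (x + 1) * f x := by
    rw [← (Equiv.subRight (1 : ℤ)).tsum_eq fun x => mass c s (x + 1) * f x]
    simp [expect]
  have s1 : Summable fun x => mass c s (x - 1) * f x := by
    rw [← (Equiv.addRight (1 : ℤ)).summable_iff]
    simpa [Function.comp_def] using hf.comp_add_one.summable_mass_mul c hs
  have s2 : Summable fun x => mass c s (x + 1) * f x := by
    rw [← (Equiv.subRight (1 : ℤ)).summable_iff]
    simpa [Function.comp_def] using hf.comp_sub_one.summable_mass_mul c hs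
  rw [h1, h2, ← tsum_mul_left, ← tsum_mul_left, ← (s1.mul_left _).tsum_sub (s2.mul_left _),
    ← tsum_mul_left, expect]
  congr 1; ext x
  linear_combination f x * mul_mass c s x

end expect

/-- Reaching distance n takes at least n jumps, and for s ≤ 1 the bound `mass_le` then yields a
factor s ^ n. -/
lemma expect_abs_le_of_eq_zero (c : WalkCase) {s : ℝ} (hs : 0 ≤ s) (hs1 : s ≤ 1) (n : ℕ)
    {f : ℤ → ℝ} (hf : PolyGrowth f) (h : ∀ x : ℤ, x.natAbs < n → f x = 0) :
    expect c s (fun x => |f x|) ≤ s ^ n * ∑' x, massBound 1 x * |f x| := by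
  rw [expect, ← tsum_mul_left]
  refine (hf.abs.summable_mass_mul c hs).tsum_le_tsum (fun x => ?_)
    ((hf.summable_massBound_mul zero_le_one).mul_left _)
  rcases lt_or_ge x.natAbs n with hx | hx
  · simp [h x hx]
  · rw [← mul_assoc]
    gcongr
    refine (mass_le c hs x).trans ?_
    rw [massBound, one_pow, mul_one_div]
    gcongr ?_ / _
    exact pow_le_pow_of_le_one hs hs1 hx

/-! ### Moments -/

/-- The drift of the coordinate process. -/
def drift (c : WalkCase) : ℝ := stepProb c - stepProb' c

/-- The centred Stein identity. Its right-hand side contains only differences of f, so on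
polynomials it lowers the degree. -/
lemma expect_sub_drift_mul (c : WalkCase) {s : ℝ} (hs : 0 ≤ s) {f : ℤ → ℝ} (hf : PolyGrowth f) :
    expect c s (fun x => (x - drift c * s) * f x) =
      s * expect c s (fun x => stepProb c * (f (x + 1) - f x) - stepProb' c * (f (x - 1) - f x)) := by
  rw [expect_sub c hs ((PolyGrowth.const _).mul (hf.comp_add_one.sub hf))
    ((PolyGrowth.const _).mul (hf.comp_sub_one.sub hf)), expect_const_mul, expect_const_mul,
    expect_sub c hs hf.comp_add_one hf, expect_sub c hs hf.comp_sub_one hf]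
  have : (fun x : ℤ => ((x : ℝ) - drift c * s) * f x) =
      fun x : ℤ => (x * f x) - drift c * s * f x := by ext x; ring
  rw [this, expect_sub c hs (by fun_prop) (by fun_prop), expect_cast_mul c hs hf, expect_const_mul,
    drift]
  ring

lemma drift_sq_le (c : WalkCase) : drift c ^ 2 ≤ 1 := by
  cases c <;> norm_num [drift, stepProb, stepProb']

lemma stepProb'_eq (c : WalkCase) : stepProb' c = 1 - stepProb c := by
  linarith [stepProb_add c]

/-- The centred moments of the coordinate process. -/
def centralMoment (c : WalkCase) (s : ℝ) (n : ℕ) : ℝ :=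
  expect c s fun x => (x - drift c * s) ^ n

section moments

variable (c : WalkCase) {s : ℝ} (hs : 0 ≤ s)
include hs

lemma expect_eval_five (a₀ a₁ a₂ a₃ a₄ : ℝ) :
    expect c s (fun x => a₀ + a₁ * (x - drift c * s) ^ 1 + a₂ * (x - drift c * s) ^ 2 +
        a₃ * (x - drift c * s) ^ 3 + a₄ * (x - drift c * s) ^ 4) =
      a₀ + a₁ * centralMoment c s 1 + a₂ * centralMoment c s 2 + a₃ * centralMoment c s 3 +
        a₄ * centralMoment c s 4 := by
  rw [expect_add c hs (by fun_prop) (by fun_prop), expect_add c hs (by fun_prop) (by fun_prop),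
    expect_add c hs (by fun_prop) (by fun_prop), expect_add c hs (by fun_prop) (by fun_prop),
    expect_const c hs, expect_const_mul, expect_const_mul, expect_const_mul, expect_const_mul]
  rfl

/-- The Stein identity with f a power of the centred variable. The difference of the n-th power has
degree less than n, so degree four suffices up to the sixth moment. -/
lemma centralMoment_succ (n : ℕ) (a₀ a₁ a₂ a₃ a₄ : ℝ)
    (h : ∀ y : ℝ, stepProb c * ((y + 1) ^ n - y ^ n) - stepProb' c * ((y - 1) ^ n - y ^ n) =
      a₀ + a₁ * y ^ 1 + a₂ * y ^ 2 + a₃ * y ^ 3 + a₄ * y ^ 4) :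
    centralMoment c s (n + 1) =
      s * (a₀ + a₁ * centralMoment c s 1 + a₂ * centralMoment c s 2 + a₃ * centralMoment c s 3 +
        a₄ * centralMoment c s 4) := by
  rw [← expect_eval_five c hs]
  have := expect_sub_drift_mul c hs (f := fun x => (x - drift c * s) ^ n) (by fun_prop)
  simp only [← pow_succ'] at this
  rw [centralMoment, this]
  congr 2; ext x
  rw [← h]
  push_cast
  ring

lemma centralMoment_one : centralMoment c s 1 = 0 := by
  rw [centralMoment_succ c hs 0 0 0 0 0 0 (by intro y; ring)]; ring

lemma centralMoment_two : centralMoment c s 2 = s := by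
  rw [centralMoment_succ c hs 1 1 0 0 0 0 (by intro y; rw [stepProb'_eq]; ring)]; ring

lemma centralMoment_three : centralMoment c s 3 = drift c * s := by
  rw [centralMoment_succ c hs 2 (drift c) 2 0 0 0
    (by intro y; rw [drift, stepProb'_eq]; ring), centralMoment_one c hs]; ring

lemma centralMoment_four : centralMoment c s 4 = 3 * s ^ 2 + s := by
  rw [centralMoment_succ c hs 3 1 (3 * drift c) 3 0 0
    (by intro y; rw [drift, stepProb'_eq]; ring), centralMoment_one c hs, centralMoment_two c hs]
  ring

/-- The exact value has the coefficient 15 + 10 drift² at s², and drift² ≤ 1. -/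
lemma centralMoment_six_le : centralMoment c s 6 ≤ 15 * s ^ 3 + 25 * s ^ 2 + s := by
  rw [centralMoment_succ c hs 5 1 (5 * drift c) 10 (10 * drift c) 5
    (by intro y; rw [drift, stepProb'_eq]; ring), centralMoment_one c hs, centralMoment_two c hs,
    centralMoment_three c hs, centralMoment_four c hs]
  nlinarith [mul_le_mul_of_nonneg_left (drift_sq_le c) (sq_nonneg s)]

end moments

/-! ### Entropy and variance as functions of time, and the derivative of the entropy -/

/-- The surprisal `-log ν(x)` of the rate-one coordinate process. -/
def surprisal (c : WalkCase) (s : ℝ) (x : ℤ) : ℝ := -Real.log (mass c s x)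

/-- The entropy of the rate-one coordinate process. -/
def entropyFn (c : WalkCase) (s : ℝ) : ℝ := expect c s (surprisal c s)

/-- The variance of the surprisal of the rate-one coordinate process. -/
def varFn (c : WalkCase) (s : ℝ) : ℝ :=
  expect c s fun x => (surprisal c s x - entropyFn c s) ^ 2

/-- The derivative of the entropy. -/
def entropyDeriv (c : WalkCase) (s : ℝ) : ℝ :=
  expect c s fun x => stepProb c * surprisal c s (x + 1) + stepProb' c * surprisal c s (x - 1) -
    surprisal c s x

lemma Q₁_eq (c : WalkCase) (k : ℕ) {t : ℝ} (ht : 0 ≤ t) (x : ℤ) :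
    Q₁ c k t x = surprisal c (t / k) x := by
  rw [Q₁, coordLaw, rateOneLaw_real_singleton c (by positivity), surprisal]

lemma meanQ_eq (c : WalkCase) (k : ℕ) {t : ℝ} (ht : 0 ≤ t) :
    meanQ c k t = entropyFn c (t / k) := by
  rw [meanQ, coordLaw, integral_rateOneLaw c (by positivity), entropyFn, expect]
  simp only [Q₁_eq c k ht]

lemma varQ_eq (c : WalkCase) (k : ℕ) {t : ℝ} (ht : 0 ≤ t) :
    varQ c k t = varFn c (t / k) := by
  have h := meanQ_eq c k ht
  rw [meanQ] at h
  rw [varQ, variance_eq_integral Measurable.of_discrete.aemeasurable, h, coordLaw,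
    integral_rateOneLaw c (by positivity), varFn, expect]
  simp only [Q₁_eq c k ht]

/-- The support does not depend on the positive time, so each surprisal is either a smooth function
of time or identically 0. -/
lemma mass_pos_or_eq_zero (c : WalkCase) (x : ℤ) :
    (∀ s, 0 < s → 0 < mass c s x) ∨ ∀ s, mass c s x = 0 := by
  obtain ⟨m, rfl | rfl⟩ := x.eq_nat_or_neg
  · exact .inl fun s hs => mass_natCast_pos c hs m
  · cases c with
    | directed =>
      rcases Nat.eq_zero_or_pos m with rfl | hm
      · exact .inl fun s hs => by simpa using mass_natCast_pos .directed hs 0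
      · refine .inr fun s => ?_
        have (j : ℕ) : (-(m : ℤ)) ≠ j := by omega
        simp [mass, stepWeight_directed, this]
    | undirected =>
      refine .inl fun s hs => lt_of_lt_of_le ?_ (le_mass_neg_natCast _ hs.le m)
      simp only [stepProb']
      positivity

lemma surprisal_nonneg (c : WalkCase) {s : ℝ} (hs : 0 ≤ s) (x : ℤ) : 0 ≤ surprisal c s x :=
  neg_nonneg.2 (Real.log_nonpos (mass_nonneg c hs x) (mass_le_one c hs x))

/-- Since log m! ≤ m (m - 1) and -log q ≤ 1, the loss of m from q is compensated by the term -m from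
the factorial. -/
lemma neg_log_le_of_poisson_le {q M s : ℝ} {m : ℕ} (hq : 1 / 2 ≤ q) (hs : 0 < s)
    (h : Real.exp (-s) * ((q * s) ^ m / m !) ≤ M) :
    -Real.log M ≤ s + (|Real.log s| + 1) * (m : ℝ) ^ 2 := by
  have hq0 : 0 < q := by linarith
  have h1 := Real.log_le_log (by positivity) h
  rw [Real.log_mul (by positivity) (by positivity), Real.log_exp, Real.log_div (by positivity)
    (by positivity), Real.log_pow, Real.log_mul hq0.ne' hs.ne'] at h1
  have hf : Real.log (m !) ≤ m * (m - 1) := by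
    rcases Nat.eq_zero_or_pos m with rfl | hm
    · simp
    · have hm' : (0 : ℝ) < m := by exact_mod_cast hm
      calc Real.log (m !) ≤ Real.log ((m : ℝ) ^ m) :=
            Real.log_le_log (by positivity) (by exact_mod_cast Nat.factorial_le_pow m)
        _ = m * Real.log m := Real.log_pow _ _
        _ ≤ _ := by gcongr; exact Real.log_le_sub_one_of_pos hm'
  have hlq : -1 ≤ Real.log q := by
    have h2 : Real.log (1 / 2) ≤ Real.log q := Real.log_le_log (by norm_num) hq
    have h3 : Real.log (1 / 2) = -Real.log 2 := by rw [one_div, Real.log_inv]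
    linarith [Real.log_two_lt_d9]
  have hm1 : (m : ℝ) ≤ (m : ℝ) ^ 2 := by exact_mod_cast Nat.le_self_pow two_ne_zero m
  have hm0 : (0 : ℝ) ≤ m := by positivity
  have hl : -|Real.log s| ≤ Real.log s := neg_abs_le _
  nlinarith [mul_le_mul_of_nonneg_left hm1 (abs_nonneg (Real.log s)),
    mul_le_mul_of_nonneg_left hl hm0, mul_le_mul_of_nonneg_left hlq hm0]

lemma surprisal_le (c : WalkCase) {s : ℝ} (hs : 0 < s) (x : ℤ) :
    surprisal c s x ≤ s + (|Real.log s| + 1) * (x : ℝ) ^ 2 := by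
  obtain ⟨m, rfl | rfl⟩ := x.eq_nat_or_neg
  · push_cast
    exact neg_log_le_of_poisson_le (half_le_stepProb c) hs (le_mass_natCast c hs.le m)
  · push_cast
    rw [neg_sq]
    rcases mass_pos_or_eq_zero c (-m) with h | h
    · rcases Nat.eq_zero_or_pos m with rfl | hm
      · exact neg_log_le_of_poisson_le (half_le_stepProb c) hs
          (by simpa using le_mass_natCast c hs.le 0)
      · refine neg_log_le_of_poisson_le (q := stepProb' c) ?_ hs (le_mass_neg_natCast c hs.le m)
        cases c with
        | directed =>
          have (j : ℕ) : (-(m : ℤ)) ≠ j := by omega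
          have h1 := h 1 one_pos
          simp [mass, stepWeight_directed, this] at h1
        | undirected => simp [stepProb']
    -- Points of zero mass have surprisal 0, because log 0 = 0.
    · rw [surprisal, h]
      simp only [Real.log_zero, neg_zero]
      positivity

/-- A majorant of the surprisal, uniform for times in `(R⁻¹, R)`. -/
def surprisalBound (R : ℝ) (x : ℤ) : ℝ := R + (R + 1) * (x : ℝ) ^ 2

@[fun_prop]
lemma polyGrowth_surprisalBound (R : ℝ) : PolyGrowth (surprisalBound R) := by
  unfold surprisalBound; fun_prop

lemma abs_log_le_of_mem {R s : ℝ} (hs : s ∈ Set.Ioo R⁻¹ R) (hR : 0 < R) : |Real.log s| ≤ R := by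
  have h0 : 0 < s := (inv_pos.2 hR).trans hs.1
  rw [abs_le]
  constructor
  · have := Real.one_sub_inv_le_log_of_pos h0
    have : s⁻¹ ≤ R := inv_le_of_inv_le₀ hR hs.1.le
    linarith
  · have := Real.log_le_sub_one_of_pos h0
    linarith [hs.2]

lemma abs_surprisal_le (c : WalkCase) {R s : ℝ} (hR : 0 < R) (hs : s ∈ Set.Ioo R⁻¹ R) (x : ℤ) :
    |surprisal c s x| ≤ surprisalBound R x := by
  have h0 : 0 < s := (inv_pos.2 hR).trans hs.1
  rw [abs_of_nonneg (surprisal_nonneg c h0.le x)]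
  refine (surprisal_le c h0 x).trans ?_
  unfold surprisalBound
  have := abs_log_le_of_mem hs hR
  gcongr
  exact hs.2.le

lemma exists_mem_Ioo_inv {s : ℝ} (hs : 0 < s) : ∃ R, 0 < R ∧ s ∈ Set.Ioo R⁻¹ R := by
  refine ⟨s + s⁻¹ + 1, by positivity, inv_lt_of_inv_lt₀ hs ?_, ?_⟩
  · linarith
  · have := inv_pos.2 hs; linarith

lemma polyGrowth_surprisal (c : WalkCase) {s : ℝ} (hs : 0 < s) : PolyGrowth (surprisal c s) := by
  obtain ⟨R, hR, hR'⟩ := exists_mem_Ioo_inv hs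
  exact (polyGrowth_surprisalBound R).mono fun x =>
    (abs_surprisal_le c hR hR' x).trans (le_abs_self _)

lemma continuousOn_mass (c : WalkCase) (x : ℤ) (u : Set ℝ) :
    ContinuousOn (fun s => mass c s x) u :=
  fun s _ => (hasDerivAt_mass c s x).continuousAt.continuousWithinAt

lemma continuousOn_surprisal (c : WalkCase) (x : ℤ) :
    ContinuousOn (fun s => surprisal c s x) (Set.Ioi 0) := by
  rcases mass_pos_or_eq_zero c x with h | h
  · exact ((continuousOn_mass c x _).log fun s hs => (h s hs).ne').neg
  · simp only [surprisal, h]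
    exact continuousOn_const

/-- On (R⁻¹, R) the series is dominated by the summable `massBound R` times the polynomially growing
bound. -/
lemma continuousOn_expect (c : WalkCase) {f : ℝ → ℤ → ℝ}
    (hf : ∀ x, ContinuousOn (fun s => f s x) (Set.Ioi 0))
    (hb : ∀ R, 0 < R → ∃ g, PolyGrowth g ∧ ∀ s ∈ Set.Ioo R⁻¹ R, ∀ x, |f s x| ≤ g x) :
    ContinuousOn (fun s => expect c s (f s)) (Set.Ioi 0) := by
  intro s hs
  obtain ⟨R, hR, hR'⟩ := exists_mem_Ioo_inv hs
  obtain ⟨g, hg, hgb⟩ := hb R hR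
  have hsub : Set.Ioo R⁻¹ R ⊆ Set.Ioi 0 := fun s h => (inv_pos.2 hR).trans h.1
  have key : ContinuousOn (fun s => expect c s (f s)) (Set.Ioo R⁻¹ R) := by
    refine continuousOn_tsum (fun x => (continuousOn_mass c x _).mul ((hf x).mono hsub))
      (hg.summable_massBound_mul hR.le) fun x s h => ?_
    have h0 : 0 ≤ s := (hsub h).le
    rw [norm_mul, Real.norm_eq_abs, Real.norm_eq_abs, abs_of_nonneg (mass_nonneg c h0 x)]
    exact mul_le_mul (mass_le_massBound c h0 h.2.le x) ((hgb s h x).trans (le_abs_self _))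
      (abs_nonneg _) (massBound_nonneg hR.le x)
  exact (key.continuousAt (isOpen_Ioo.mem_nhds hR')).continuousWithinAt

lemma continuousOn_entropyDeriv (c : WalkCase) : ContinuousOn (entropyDeriv c) (Set.Ioi 0) := by
  refine continuousOn_expect c (fun x => ?_) fun R hR => ?_
  · exact ((continuousOn_const.mul (continuousOn_surprisal c _)).add
      (continuousOn_const.mul (continuousOn_surprisal c _))).sub (continuousOn_surprisal c _)
  · refine ⟨fun x => surprisalBound R (x + 1) + surprisalBound R (x - 1) + surprisalBound R x,
      ((polyGrowth_surprisalBound R).comp_add_one.add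
        (polyGrowth_surprisalBound R).comp_sub_one).add (polyGrowth_surprisalBound R),
      fun s h x => ?_⟩
    have h1 := abs_le.1 (abs_surprisal_le c hR h (x + 1))
    have h2 := abs_le.1 (abs_surprisal_le c hR h (x - 1))
    have h3 := abs_le.1 (abs_surprisal_le c hR h x)
    have h0 : 0 < s := (inv_pos.2 hR).trans h.1
    have i1 := surprisal_nonneg c h0.le (x + 1)
    have i2 := surprisal_nonneg c h0.le (x - 1)
    have i3 := surprisal_nonneg c h0.le x
    have a := stepProb_pos c
    have b := stepProb'_nonneg c
    have e := stepProb_add c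
    rw [abs_le]
    constructor <;> nlinarith

lemma entropyFn_nonneg (c : WalkCase) {s : ℝ} (hs : 0 ≤ s) : 0 ≤ entropyFn c s :=
  expect_nonneg c hs fun x => surprisal_nonneg c hs x

lemma continuousOn_entropyFn_Ioi (c : WalkCase) : ContinuousOn (entropyFn c) (Set.Ioi 0) :=
  continuousOn_expect c (fun x => continuousOn_surprisal c x) fun R hR =>
    ⟨surprisalBound R, polyGrowth_surprisalBound R, fun _ h x => abs_surprisal_le c hR h x⟩

lemma varFn_eq (c : WalkCase) {s : ℝ} (hs : 0 < s) :
    varFn c s = expect c s (fun x => surprisal c s x ^ 2) - entropyFn c s ^ 2 := by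
  have h := polyGrowth_surprisal c hs
  have e : (fun x => (surprisal c s x - entropyFn c s) ^ 2) = fun x =>
      (surprisal c s x ^ 2 - 2 * entropyFn c s * surprisal c s x) + entropyFn c s ^ 2 := by
    ext x; ring
  rw [varFn, e, expect_add c hs.le (by fun_prop) (by fun_prop),
    expect_sub c hs.le (by fun_prop) (by fun_prop), expect_const_mul, expect_const c hs.le]
  rw [show expect c s (fun x => surprisal c s x) = entropyFn c s from rfl]
  ring

lemma continuousOn_varFn (c : WalkCase) : ContinuousOn (varFn c) (Set.Ioi 0) := by
  have : ContinuousOn (fun s => expect c s (fun x => surprisal c s x ^ 2) - entropyFn c s ^ 2)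
      (Set.Ioi 0) := by
    refine (continuousOn_expect c (fun x => (continuousOn_surprisal c x).pow 2) fun R hR =>
      ⟨fun x => surprisalBound R x ^ 2, by fun_prop, fun s h x => ?_⟩).sub
      ((continuousOn_entropyFn_Ioi c).pow 2)
    change |surprisal c s x ^ 2| ≤ surprisalBound R x ^ 2
    rw [abs_pow]
    gcongr
    exact abs_surprisal_le c hR h x
  exact this.congr fun s hs => varFn_eq c hs

lemma summable_mass_sub_one_mul (c : WalkCase) {s : ℝ} (hs : 0 ≤ s) {f : ℤ → ℝ}
    (hf : PolyGrowth f) : Summable fun x => mass c s (x - 1) * f x := by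
  rw [← (Equiv.addRight (1 : ℤ)).summable_iff]
  simpa [Function.comp_def] using hf.comp_add_one.summable_mass_mul c hs

lemma summable_mass_add_one_mul (c : WalkCase) {s : ℝ} (hs : 0 ≤ s) {f : ℤ → ℝ}
    (hf : PolyGrowth f) : Summable fun x => mass c s (x + 1) * f x := by
  rw [← (Equiv.subRight (1 : ℤ)).summable_iff]
  simpa [Function.comp_def] using hf.comp_sub_one.summable_mass_mul c hs

lemma tsum_mass_sub_one_mul (c : WalkCase) (s : ℝ) (f : ℤ → ℝ) :
    ∑' x, mass c s (x - 1) * f x = expect c s fun x => f (x + 1) := by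
  rw [← (Equiv.addRight (1 : ℤ)).tsum_eq fun x => mass c s (x - 1) * f x]
  simp [expect]

lemma tsum_mass_add_one_mul (c : WalkCase) (s : ℝ) (f : ℤ → ℝ) :
    ∑' x, mass c s (x + 1) * f x = expect c s fun x => f (x - 1) := by
  rw [← (Equiv.subRight (1 : ℤ)).tsum_eq fun x => mass c s (x + 1) * f x]
  simp [expect]

/-- Summation by parts: the forward operator acting on the masses becomes the generator acting on f.
-/
lemma tsum_massDeriv_mul (c : WalkCase) {s : ℝ} (hs : 0 ≤ s) {f : ℤ → ℝ} (hf : PolyGrowth f) :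
    ∑' x, massDeriv c s x * f x =
      expect c s fun x => stepProb c * f (x + 1) + stepProb' c * f (x - 1) - f x := by
  have e : (fun x => massDeriv c s x * f x) = fun x =>
      stepProb c * (mass c s (x - 1) * f x) + stepProb' c * (mass c s (x + 1) * f x) -
        mass c s x * f x := by
    ext x; unfold massDeriv; ring
  have a1 := summable_mass_sub_one_mul c hs hf
  have a2 := summable_mass_add_one_mul c hs hf
  have a3 := hf.summable_mass_mul c hs
  rw [e, ((a1.mul_left _).add (a2.mul_left _)).tsum_sub a3, (a1.mul_left _).tsum_add
    (a2.mul_left _), tsum_mul_left, tsum_mul_left, tsum_mass_sub_one_mul, tsum_mass_add_one_mul,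
    expect_sub c hs (((PolyGrowth.const _).mul hf.comp_add_one).add
      ((PolyGrowth.const _).mul hf.comp_sub_one)) hf,
    expect_add c hs ((PolyGrowth.const _).mul hf.comp_add_one)
      ((PolyGrowth.const _).mul hf.comp_sub_one), expect_const_mul, expect_const_mul]
  rfl

lemma hasDerivAt_mass_mul_surprisal (c : WalkCase) {s : ℝ} (hs : 0 < s) (x : ℤ) :
    HasDerivAt (fun s => mass c s x * surprisal c s x)
      (massDeriv c s x * (surprisal c s x - 1)) s := by
  rcases mass_pos_or_eq_zero c x with h | h
  · have h1 := hasDerivAt_mass c s x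
    have h2 := h1.mul (h1.log (h s hs).ne').neg
    convert! h2 using 1
    have := (h s hs).ne'
    simp only [surprisal, Pi.neg_apply]
    field_simp
    ring
  · have h1 := hasDerivAt_mass c s x
    simp only [h] at h1 ⊢
    rw [h1.unique (hasDerivAt_const s (0 : ℝ))]
    simp only [zero_mul]
    exact hasDerivAt_const s _

/-- The termwise derivative of -ν log ν is ν' (Q - 1), where Q is the surprisal. The total mass is
conserved, so the -1 drops out, and summation by parts moves the generator onto Q. -/
lemma hasDerivAt_entropyFn (c : WalkCase) {s : ℝ} (hs : 0 < s) :
    HasDerivAt (entropyFn c) (entropyDeriv c s) s := by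
  obtain ⟨R, hR, hR'⟩ := exists_mem_Ioo_inv hs
  have hsub : Set.Ioo R⁻¹ R ⊆ Set.Ioi 0 := fun s h => (inv_pos.2 hR).trans h.1
  set B : ℤ → ℝ := fun x => |surprisalBound R x| + 1 with hB
  have hBp : PolyGrowth B := by fun_prop
  have hp := polyGrowth_surprisal c hs
  have hsum : Summable fun x => (massBound R (x - 1) + massBound R (x + 1) + massBound R x) *
      |B x| := by
    have s1 : Summable fun x => massBound R (x - 1) * |B x| := by
      rw [← (Equiv.addRight (1 : ℤ)).summable_iff]
      simpa [Function.comp_def] using hBp.comp_add_one.summable_massBound_mul hR.le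
    have s2 : Summable fun x => massBound R (x + 1) * |B x| := by
      rw [← (Equiv.subRight (1 : ℤ)).summable_iff]
      simpa [Function.comp_def] using hBp.comp_sub_one.summable_massBound_mul hR.le
    simpa only [add_mul] using (s1.add s2).add (hBp.summable_massBound_mul hR.le)
  have key := hasDerivAt_tsum_of_isPreconnected (𝕜 := ℝ)
    (g := fun (x : ℤ) (s : ℝ) => mass c s x * surprisal c s x)
    (g' := fun (x : ℤ) (s : ℝ) => massDeriv c s x * (surprisal c s x - 1)) (y₀ := s) (y := s)
    hsum (isOpen_Ioo (a := R⁻¹) (b := R)) isPreconnected_Ioo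
    (fun x y hy => hasDerivAt_mass_mul_surprisal c (hsub hy) x) ?_ hR'
    (hp.summable_mass_mul c hs.le) hR'
  · convert! key using 1
    rw [tsum_massDeriv_mul c hs.le (by fun_prop), entropyDeriv]
    congr 1; ext x
    -- The generator annihilates the constant -1.
    linear_combination stepProb_add c
  · intro x y hy
    have hy0 : 0 ≤ y := (hsub hy).le
    rw [norm_mul, Real.norm_eq_abs, Real.norm_eq_abs]
    have m1 := mass_le_massBound c hy0 hy.2.le (x - 1)
    have m2 := mass_le_massBound c hy0 hy.2.le (x + 1)
    have m3 := mass_le_massBound c hy0 hy.2.le x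
    have n1 := mass_nonneg c hy0 (x - 1)
    have n2 := mass_nonneg c hy0 (x + 1)
    have n3 := mass_nonneg c hy0 x
    have a := stepProb_pos c
    have b := stepProb'_nonneg c
    have e := stepProb_add c
    have hB0 : |surprisal c y x - 1| ≤ |B x| := by
      refine ((abs_sub _ _).trans ?_).trans (le_abs_self _)
      simp only [hB, abs_one]
      exact add_le_add ((abs_surprisal_le c hR hy x).trans (le_abs_self _)) le_rfl
    refine mul_le_mul ?_ hB0 (abs_nonneg _) (by linarith)
    unfold massDeriv
    rw [abs_le]
    constructor <;> nlinarith

/-! ### Positivity of the derivative of the entropy and of the variance -/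

lemma summable_mass (c : WalkCase) {s : ℝ} (hs : 0 ≤ s) : Summable (mass c s) := by
  simpa using (PolyGrowth.const 1).summable_mass_mul c hs

/-- Otherwise the masses would be a positive constant on the natural numbers, contradicting
summability. -/
lemma exists_mass_succ_ne (c : WalkCase) {s : ℝ} (hs : 0 < s) :
    ∃ m : ℕ, mass c s (m + 1) ≠ mass c s m := by
  by_contra! h
  have h1 : ∀ m : ℕ, mass c s m = mass c s 0 := by
    intro m
    induction m with
    | zero => simp
    | succ m ih => rw [← ih, ← h m]; push_cast; rfl
  have h2 := ((summable_mass c hs.le).comp_injective Nat.cast_injective).tendsto_atTop_zero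
  simp only [Function.comp_def, h1] at h2
  have h3 := tendsto_nhds_unique h2 tendsto_const_nhds
  have h4 := mass_natCast_pos c hs 0
  simp only [Nat.cast_zero] at h4
  exact h4.ne h3

lemma varFn_pos (c : WalkCase) {s : ℝ} (hs : 0 < s) : 0 < varFn c s := by
  have hp := polyGrowth_surprisal c hs
  have hnn : ∀ x, 0 ≤ mass c s x * (surprisal c s x - entropyFn c s) ^ 2 :=
    fun x => mul_nonneg (mass_nonneg c hs.le x) (sq_nonneg _)
  have hsum : Summable fun x => mass c s x * (surprisal c s x - entropyFn c s) ^ 2 :=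
    PolyGrowth.summable_mass_mul (by fun_prop) c hs.le
  obtain ⟨m, hm⟩ := exists_mass_succ_ne c hs
  have p0 := mass_natCast_pos c hs m
  have p1 := mass_natCast_pos c hs (m + 1)
  push_cast at p1
  have hne : surprisal c s (m + 1) ≠ surprisal c s m := by
    intro h
    exact hm (Real.log_injOn_pos p1 p0 (neg_injective h))
  by_cases h : surprisal c s m = entropyFn c s
  · refine hsum.tsum_pos hnn (m + 1) (mul_pos p1 ?_)
    have : surprisal c s (m + 1) - entropyFn c s ≠ 0 := by rwa [← h, sub_ne_zero]
    positivity
  · refine hsum.tsum_pos hnn m (mul_pos p0 ?_)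
    have : surprisal c s m - entropyFn c s ≠ 0 := by rwa [sub_ne_zero]
    positivity

/-- The pointwise form of Gibbs' inequality, from log y ≤ y - 1 at y = v / u. -/
lemma sub_le_mul_log_sub {u v : ℝ} (hu : 0 < u) (hv : 0 < v) :
    u - v ≤ u * (-Real.log v - -Real.log u) := by
  have h := Real.log_le_sub_one_of_pos (div_pos hv hu)
  rw [Real.log_div hv.ne' hu.ne'] at h
  have h2 := mul_le_mul_of_nonneg_left h hu.le
  have e : u * (v / u - 1) = v - u := by field_simp
  linarith

lemma sub_lt_mul_log_sub {u v : ℝ} (hu : 0 < u) (hv : 0 < v) (huv : v ≠ u) :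
    u - v < u * (-Real.log v - -Real.log u) := by
  have h := Real.log_lt_sub_one_of_pos (div_pos hv hu) (by rwa [ne_eq, div_eq_one_iff_eq hu.ne'])
  rw [Real.log_div hv.ne' hu.ne'] at h
  have h2 := mul_lt_mul_of_pos_left h hu
  have e : u * (v / u - 1) = v - u := by field_simp
  linarith

lemma stepProb'_mul_sub_le (c : WalkCase) {s : ℝ} (hs : 0 < s) (x : ℤ) :
    stepProb' c * (mass c s x - mass c s (x - 1)) ≤
      stepProb' c * (mass c s x * (surprisal c s (x - 1) - surprisal c s x)) := by
  cases c with
  | directed => simp [stepProb']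
  | undirected =>
    have (y : ℤ) : 0 < mass .undirected s y := by
      obtain ⟨m, rfl | rfl⟩ := y.eq_nat_or_neg
      · exact mass_natCast_pos _ hs m
      · refine lt_of_lt_of_le ?_ (le_mass_neg_natCast _ hs.le m)
        simp only [stepProb']
        positivity
    exact mul_le_mul_of_nonneg_left (sub_le_mul_log_sub (this _) (this _)) (stepProb'_nonneg _)

/-- The derivative is a weighted sum of the relative entropies of ν with respect to its two
translates. Gibbs' inequality compares it with the sum of ν(x) - ν(x ± 1), which is 0, and it is
strict where two neighbouring masses differ. -/
lemma entropyDeriv_pos (c : WalkCase) {s : ℝ} (hs : 0 < s) : 0 < entropyDeriv c s := by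
  have hp := polyGrowth_surprisal c hs
  have hp1 := hp.comp_add_one
  have hp2 := hp.comp_sub_one
  have one := PolyGrowth.const 1
  have s0 := summable_mass c hs.le
  have s1 : Summable fun x => mass c s (x + 1) := by
    simpa using summable_mass_add_one_mul c hs.le one
  have s2 : Summable fun x => mass c s (x - 1) := by
    simpa using summable_mass_sub_one_mul c hs.le one
  have t0 := tsum_mass c hs.le
  have t1 : ∑' x, mass c s (x + 1) = 1 := by
    simpa [expect_const c hs.le] using tsum_mass_add_one_mul c s (fun _ => 1)
  have t2 : ∑' x, mass c s (x - 1) = 1 := by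
    simpa [expect_const c hs.le] using tsum_mass_sub_one_mul c s (fun _ => 1)
  have hzero : ∑' x, (stepProb c * (mass c s x - mass c s (x + 1)) +
      stepProb' c * (mass c s x - mass c s (x - 1))) = 0 := by
    rw [((s0.sub s1).mul_left _).tsum_add ((s0.sub s2).mul_left _), tsum_mul_left, tsum_mul_left,
      s0.tsum_sub s1, s0.tsum_sub s2, t0, t1, t2]
    ring
  have e : ∀ x, mass c s x * (stepProb c * surprisal c s (x + 1) +
      stepProb' c * surprisal c s (x - 1) - surprisal c s x) =
      stepProb c * (mass c s x * (surprisal c s (x + 1) - surprisal c s x)) +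
      stepProb' c * (mass c s x * (surprisal c s (x - 1) - surprisal c s x)) := by
    intro x
    linear_combination (mass c s x * surprisal c s x) * stepProb_add c
  rw [entropyDeriv, expect, ← hzero]
  obtain ⟨m, hm⟩ := exists_mass_succ_ne c hs
  have p0 := mass_natCast_pos c hs m
  have p1 := mass_natCast_pos c hs (m + 1)
  push_cast at p1
  refine Summable.tsum_lt_tsum (i := (m : ℤ)) (fun x => ?_) ?_
    (((s0.sub s1).mul_left _).add ((s0.sub s2).mul_left _))
    (PolyGrowth.summable_mass_mul ((((PolyGrowth.const _).mul hp1).add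
      ((PolyGrowth.const _).mul hp2)).sub hp) c hs.le)
  · rw [e]
    refine add_le_add (mul_le_mul_of_nonneg_left ?_ (stepProb_pos c).le)
      (stepProb'_mul_sub_le c hs x)
    rcases (mass_nonneg c hs.le x).eq_or_lt with h0 | h0
    · rw [← h0]
      simpa using mass_nonneg c hs.le (x + 1)
    · rcases (mass_nonneg c hs.le (x + 1)).eq_or_lt with h1 | h1
      -- With log 0 = 0 the pointwise inequality could fail if ν(x) > 0 = ν(x + 1). This does not
      -- occur: the support is closed under upward steps.
      · have := mul_mass c s (x + 1)
        exfalso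
        rw [← h1, add_sub_cancel_right] at this
        rcases mass_pos_or_eq_zero c (x + 1 + 1) with h2 | h2
        · obtain ⟨n, hn | hn⟩ := (x + 1).eq_nat_or_neg
          · rw [hn] at h1
            exact (mass_natCast_pos c hs n).ne h1
          · cases c with
            | directed =>
              have hx : mass .directed s x = 0 := by
                rcases Nat.eq_zero_or_pos n with rfl | hn0
                · rw [hn] at h1
                  have := mass_natCast_pos .directed hs 0
                  simp at h1 this
                  exact absurd h1 this.ne
                · have (j : ℕ) : x ≠ j := by omega
                  simp [mass, stepWeight_directed, this]
              exact h0.ne' hx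
            | undirected =>
              rw [hn] at h1
              refine absurd (le_mass_neg_natCast .undirected hs.le n) ?_
              rw [← h1, not_le]
              simp only [stepProb']
              positivity
        · rw [h2] at this
          have := mul_pos hs (mul_pos (stepProb_pos c) h0)
          nlinarith
      · exact sub_le_mul_log_sub h0 h1
  · rw [e]
    exact add_lt_add_of_lt_of_le (mul_lt_mul_of_pos_left (sub_lt_mul_log_sub p0 p1 hm)
      (stepProb_pos c)) (stepProb'_mul_sub_le c hs m)

/-! ### Behaviour at small times -/

/-- The entropy of a step. -/
def stepEntropy (c : WalkCase) : ℝ :=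
  -(stepProb c * Real.log (stepProb c)) - stepProb' c * Real.log (stepProb' c)

lemma expect_eq_add_expect_ite (c : WalkCase) {s : ℝ} (hs : 0 ≤ s) {f : ℤ → ℝ}
    (hf : PolyGrowth f) :
    expect c s f = mass c s 0 * f 0 + expect c s (fun x => if x = 0 then 0 else f x) := by
  rw [expect, (hf.summable_mass_mul c hs).tsum_eq_add_tsum_ite 0, expect]
  congr 2; ext x
  split_ifs <;> simp

lemma expect_eq_three_add_expect_ite (c : WalkCase) {s : ℝ} (hs : 0 ≤ s) {f : ℤ → ℝ}
    (hf : PolyGrowth f) :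
    expect c s f = mass c s 0 * f 0 + mass c s 1 * f 1 + mass c s (-1) * f (-1) +
      expect c s (fun x => if x.natAbs < 2 then 0 else f x) := by
  have h := (hf.summable_mass_mul c hs)
  have e : ∀ x, mass c s x * f x = (if x = 0 then mass c s 0 * f 0 else 0) +
      (if x = 1 then mass c s 1 * f 1 else 0) + (if x = -1 then mass c s (-1) * f (-1) else 0) +
      mass c s x * (if x.natAbs < 2 then 0 else f x) := by
    intro x
    by_cases h0 : x = 0
    · subst h0; simp
    by_cases h1 : x = 1
    · subst h1; simp
    by_cases h2 : x = -1
    · subst h2; simp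
    · have : ¬ x.natAbs < 2 := by omega
      simp [h0, h1, h2, this]
  have hs (a : ℤ) (b : ℝ) : Summable fun x : ℤ => if x = a then b else 0 :=
    (hasSum_ite_eq a b).summable
  have hr : PolyGrowth fun x => if x.natAbs < 2 then 0 else f x :=
    hf.mono fun x => by split_ifs <;> simp
  rw [expect, tsum_congr e, Summable.tsum_add (((hs _ _).add (hs _ _)).add (hs _ _))
    (hr.summable_mass_mul c ‹_›), Summable.tsum_add ((hs _ _).add (hs _ _)) (hs _ _),
    Summable.tsum_add (hs _ _) (hs _ _), tsum_ite_eq, tsum_ite_eq, tsum_ite_eq]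
  rfl

lemma exp_neg_le_mass_zero (c : WalkCase) {s : ℝ} (hs : 0 ≤ s) : Real.exp (-s) ≤ mass c s 0 := by
  simpa using le_mass_natCast c hs 0

lemma one_sub_le_mass_zero (c : WalkCase) {s : ℝ} (hs : 0 ≤ s) : 1 - s ≤ mass c s 0 := by
  linarith [exp_neg_le_mass_zero c hs, Real.add_one_le_exp (-s)]

lemma surprisal_zero_le (c : WalkCase) {s : ℝ} (hs : 0 < s) : surprisal c s 0 ≤ s := by
  simpa using surprisal_le c hs 0

/-- The lower bound is the contribution of exactly one jump; the upper bound is `mul_mass` at 1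
together with ν(0) ≤ 1. -/
lemma mass_one_bounds (c : WalkCase) {s : ℝ} (hs : 0 ≤ s) :
    Real.exp (-s) * (stepProb c * s) ≤ mass c s 1 ∧ mass c s 1 ≤ stepProb c * s := by
  constructor
  · simpa using le_mass_natCast c hs 1
  · have := mass_natCast_succ_le c hs 0
    simp only [Nat.cast_zero, zero_add, one_mul] at this
    exact this.trans (mul_le_of_le_one_right (mul_nonneg (stepProb_pos c).le hs)
      (mass_le_one c hs 0))

lemma mass_neg_one_bounds (c : WalkCase) {s : ℝ} (hs : 0 ≤ s) :
    Real.exp (-s) * (stepProb' c * s) ≤ mass c s (-1) ∧ mass c s (-1) ≤ stepProb' c * s := by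
  constructor
  · simpa using le_mass_neg_natCast c hs 1
  · have := mass_neg_natCast_succ_le c hs 0
    simp only [Nat.cast_zero, zero_add, one_mul, neg_zero] at this
    exact this.trans (mul_le_of_le_one_right (mul_nonneg (stepProb'_nonneg c) hs)
      (mass_le_one c hs 0))

lemma neg_log_bounds {s q M : ℝ} (hs : 0 < s) (hq : 0 < q)
    (h1 : Real.exp (-s) * (q * s) ≤ M) (h2 : M ≤ q * s) :
    -Real.log s - Real.log q ≤ -Real.log M ∧ -Real.log M ≤ -Real.log s - Real.log q + s := by
  have hM : 0 < M := lt_of_lt_of_le (by positivity) h1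
  have i1 := Real.log_le_log (by positivity) h1
  have i2 := Real.log_le_log hM h2
  rw [Real.log_mul (by positivity) (by positivity), Real.log_exp, Real.log_mul hq.ne' hs.ne'] at i1
  rw [Real.log_mul hq.ne' hs.ne'] at i2
  constructor <;> linarith

lemma abs_mul_neg_log_sub_le {s q M : ℝ} (hs : 0 < s) (hq : 0 ≤ q) (hq1 : q ≤ 1)
    (h1 : Real.exp (-s) * (q * s) ≤ M) (h2 : M ≤ q * s) :
    |q * -Real.log M - (q * -Real.log s - q * Real.log q)| ≤ s := by
  rcases hq.eq_or_lt with rfl | hq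
  · simpa using hs.le
  · obtain ⟨i1, i2⟩ := neg_log_bounds hs hq h1 h2
    rw [abs_le]
    constructor <;> nlinarith

/-- M differs from q s by a relative error s, and -log M from -log (q s) by at most s. The case q =
0 is the missing downward step of the directed walk. -/
lemma abs_mul_neg_log_sq_sub_le {s q M : ℝ} (hs : 0 < s) (hs1 : s ≤ 1) (hq : q = 0 ∨ 1 / 2 ≤ q)
    (hq1 : q ≤ 1) (h1 : Real.exp (-s) * (q * s) ≤ M) (h2 : M ≤ q * s) :
    |M * (-Real.log M) ^ 2 - s * (q * (-Real.log s - Real.log q) ^ 2)| ≤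
      s * (4 * s * (1 - Real.log s) ^ 2) := by
  have hL : Real.log s ≤ 0 := Real.log_nonpos hs.le hs1
  rcases hq with rfl | hq
  · have : M = 0 := le_antisymm (by simpa using h2) (by simpa using h1)
    simp only [this, zero_mul, mul_zero, sub_zero, abs_zero]
    positivity
  · have hq0 : 0 < q := by linarith
    obtain ⟨i1, i2⟩ := neg_log_bounds hs hq0 h1 h2
    have hlq : -1 ≤ Real.log q := by
      have h2 : Real.log (1 / 2) ≤ Real.log q := Real.log_le_log (by norm_num) hq
      have h3 : Real.log (1 / 2) = -Real.log 2 := by rw [one_div, Real.log_inv]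
      linarith [Real.log_two_lt_d9]
    have hlq1 : Real.log q ≤ 0 := Real.log_nonpos hq0.le hq1
    set l := -Real.log s - Real.log q with hl
    set Q := -Real.log M
    have hl0 : 0 ≤ l := by linarith
    have hl1 : l + 1 ≤ 2 * (1 - Real.log s) := by linarith
    have he : q * s * (1 - s) ≤ M := by
      refine le_trans ?_ h1
      have := Real.add_one_le_exp (-s)
      rw [mul_comm]
      gcongr
      linarith
    have hM : 0 ≤ M := le_trans (by positivity) h1
    have up : M * Q ^ 2 ≤ s * (q * l ^ 2) + s * (s * (l + 1) ^ 2) := by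
      calc M * Q ^ 2 ≤ q * s * (l + s) ^ 2 := by gcongr; linarith
        _ = s * (q * l ^ 2) + s * (q * (s * (2 * l + s))) := by ring
        _ ≤ s * (q * l ^ 2) + s * (1 * (s * (l + 1) ^ 2)) := by
          gcongr
          nlinarith
        _ = _ := by ring
    have lo : s * (q * l ^ 2) - s * (s * (l + 1) ^ 2) ≤ M * Q ^ 2 := by
      calc s * (q * l ^ 2) - s * (s * (l + 1) ^ 2) ≤ q * s * (1 - s) * l ^ 2 := by
            have : q * l ^ 2 ≤ 1 * (l + 1) ^ 2 := by gcongr; linarith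
            nlinarith [mul_le_mul_of_nonneg_left this (mul_nonneg hs.le hs.le)]
        _ ≤ M * Q ^ 2 := by
            have : l ^ 2 ≤ Q ^ 2 := by gcongr
            have h0 : 0 ≤ q * s * (1 - s) := mul_nonneg (by positivity) (by linarith)
            exact mul_le_mul he this (sq_nonneg _) hM
    have hfin : s * (l + 1) ^ 2 ≤ 4 * s * (1 - Real.log s) ^ 2 := by
      have : (l + 1) ^ 2 ≤ (2 * (1 - Real.log s)) ^ 2 := by gcongr
      nlinarith
    have := mul_le_mul_of_nonneg_left hfin hs.le
    rw [abs_le]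
    constructor <;> linarith

lemma surprisal_le_of_le_one (c : WalkCase) {s : ℝ} (hs : 0 < s) (hs1 : s ≤ 1) (x : ℤ) :
    surprisal c s x ≤ (1 - Real.log s) * (1 + (x : ℝ) ^ 2) := by
  refine (surprisal_le c hs x).trans ?_
  have hL : Real.log s ≤ 0 := Real.log_nonpos hs.le hs1
  rw [abs_of_nonpos hL]
  nlinarith [sq_nonneg (x : ℝ)]

/-- A bound for the contribution of `n ≤ |x|` to an expectation at small times. -/
lemma exists_abs_expect_ite_le (n : ℕ) {g : ℤ → ℝ} (hg : PolyGrowth g) :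
    ∃ K, 0 ≤ K ∧ ∀ (c : WalkCase) (s a : ℝ) (f : ℤ → ℝ), 0 ≤ s → s ≤ 1 → 0 ≤ a →
      (∀ x, |f x| ≤ a * g x) →
        |expect c s (fun x => if x.natAbs < n then 0 else f x)| ≤ K * s ^ n * a := by
  refine ⟨∑' x, massBound 1 x * |g x|,
    tsum_nonneg fun x => mul_nonneg (massBound_nonneg zero_le_one x) (abs_nonneg _), ?_⟩
  intro c s a f hs hs1 ha hf
  have hp : PolyGrowth fun x => if x.natAbs < n then 0 else g x :=
    hg.mono fun x => by split_ifs <;> simp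
  have hpf : PolyGrowth fun x => if x.natAbs < n then 0 else f x := by
    refine ((PolyGrowth.const a).mul hg).mono fun x => ?_
    split_ifs
    · rw [abs_zero]; exact abs_nonneg _
    · exact (hf x).trans (le_abs_self _)
  have h1 := expect_abs_le_of_eq_zero c hs hs1 n hp fun x hx => by simp [hx]
  have h2 : expect c s (fun x => |if x.natAbs < n then 0 else f x|) ≤
      expect c s (fun x => a * |if x.natAbs < n then 0 else g x|) := by
    refine expect_mono c hs hpf.abs ((PolyGrowth.const a).mul hp.abs) fun x => ?_
    split_ifs
    · simp
    · exact (hf x).trans (mul_le_mul_of_nonneg_left (le_abs_self _) ha)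
  rw [expect_const_mul] at h2
  have h3 : ∑' x, massBound 1 x * |if x.natAbs < n then 0 else g x| ≤
      ∑' x, massBound 1 x * |g x| :=
    (hp.summable_massBound_mul zero_le_one).tsum_le_tsum (fun x => by
      refine mul_le_mul_of_nonneg_left ?_ (massBound_nonneg zero_le_one x)
      split_ifs
      · rw [abs_zero]; exact abs_nonneg _
      · exact le_rfl) (hg.summable_massBound_mul zero_le_one)
  calc _ ≤ _ := abs_expect_le c hs hpf
    _ ≤ _ := h2
    _ ≤ a * (s ^ n * ∑' x, massBound 1 x * |g x|) := by
      refine mul_le_mul_of_nonneg_left (h1.trans ?_) ha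
      gcongr
    _ = _ := by ring

lemma exists_entropyFn_le (c : WalkCase) :
    ∃ K, 0 ≤ K ∧ ∀ s, 0 < s → s ≤ 1 → entropyFn c s ≤ K * (s * (1 - Real.log s)) := by
  obtain ⟨K, hK0, hK⟩ := exists_abs_expect_ite_le 1 (g := fun x => 1 + (x : ℝ) ^ 2) (by fun_prop)
  refine ⟨K + 1, by positivity, fun s hs hs1 => ?_⟩
  have hL : Real.log s ≤ 0 := Real.log_nonpos hs.le hs1
  have h := hK c s (1 - Real.log s) (surprisal c s) hs.le hs1 (by linarith) fun x => by
    rw [abs_of_nonneg (surprisal_nonneg c hs.le x)]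
    exact surprisal_le_of_le_one c hs hs1 x
  rw [entropyFn, expect_eq_add_expect_ite c hs.le (polyGrowth_surprisal c hs)]
  simp only [Nat.lt_one_iff, Int.natAbs_eq_zero] at h
  have h1 := (le_abs_self _).trans h
  have h2 : mass c s 0 * surprisal c s 0 ≤ s :=
    (mul_le_of_le_one_left (surprisal_nonneg c hs.le 0) (mass_le_one c hs.le 0)).trans
      (surprisal_zero_le c hs)
  nlinarith

/-- At x = 0 the generator applied to the surprisal is -log s + h + O(s), with h the step entropy,
by the bounds on ν(±1). All other x together contribute O(s (1 - log s)). -/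
lemma exists_entropyDeriv_sub_le (c : WalkCase) :
    ∃ K, 0 ≤ K ∧ ∀ s, 0 < s → s ≤ 1 →
      |entropyDeriv c s + Real.log s - stepEntropy c| ≤ K * (s * (1 - Real.log s)) := by
  obtain ⟨K, hK0, hK⟩ := exists_abs_expect_ite_le 1
    (g := fun x => 3 + 3 * ((x : ℝ) ^ 2 + 1)) (by fun_prop)
  refine ⟨K + 3 + 2 + |stepEntropy c|, by positivity, fun s hs hs1 => ?_⟩
  have hL : Real.log s ≤ 0 := Real.log_nonpos hs.le hs1
  have hp := polyGrowth_surprisal c hs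
  have a := stepProb_pos c
  have b := stepProb'_nonneg c
  have e := stepProb_add c
  set f : ℤ → ℝ := fun x => stepProb c * surprisal c s (x + 1) +
    stepProb' c * surprisal c s (x - 1) - surprisal c s x with hf
  have hfp : PolyGrowth f := (((PolyGrowth.const _).mul hp.comp_add_one).add
      ((PolyGrowth.const _).mul hp.comp_sub_one)).sub hp
  have h := hK c s (1 - Real.log s) f hs.le hs1 (by linarith) fun x => by
    have i1 := surprisal_le_of_le_one c hs hs1 (x + 1)
    have i2 := surprisal_le_of_le_one c hs hs1 (x - 1)
    have i3 := surprisal_le_of_le_one c hs hs1 x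
    have j1 := surprisal_nonneg c hs.le (x + 1)
    have j2 := surprisal_nonneg c hs.le (x - 1)
    have j3 := surprisal_nonneg c hs.le x
    push_cast at i1 i2
    have k1 : (1 - Real.log s) * (1 + ((x : ℝ) + 1) ^ 2) ≤
        (1 - Real.log s) * (3 + 3 * ((x : ℝ) ^ 2 + 1)) := by
      refine mul_le_mul_of_nonneg_left ?_ (by linarith)
      nlinarith [sq_nonneg ((x : ℝ) - 1)]
    have k2 : (1 - Real.log s) * (1 + ((x : ℝ) - 1) ^ 2) ≤
        (1 - Real.log s) * (3 + 3 * ((x : ℝ) ^ 2 + 1)) := by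
      refine mul_le_mul_of_nonneg_left ?_ (by linarith)
      nlinarith [sq_nonneg ((x : ℝ) + 1)]
    have k3 : (1 - Real.log s) * (1 + (x : ℝ) ^ 2) ≤
        (1 - Real.log s) * (3 + 3 * ((x : ℝ) ^ 2 + 1)) := by
      refine mul_le_mul_of_nonneg_left ?_ (by linarith)
      nlinarith
    rw [abs_le]
    constructor
    · simp only [hf]
      nlinarith
    · simp only [hf]
      have l1 := mul_le_mul_of_nonneg_left (i1.trans k1) a.le
      have l2 := mul_le_mul_of_nonneg_left (i2.trans k2) b
      have l3 : stepProb c * ((1 - Real.log s) * (3 + 3 * ((x : ℝ) ^ 2 + 1))) +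
        stepProb' c * ((1 - Real.log s) * (3 + 3 * ((x : ℝ) ^ 2 + 1))) =
        (1 - Real.log s) * (3 + 3 * ((x : ℝ) ^ 2 + 1)) := by rw [← add_mul, e, one_mul]
      linarith
  simp only [Nat.lt_one_iff, Int.natAbs_eq_zero, pow_one] at h
  rw [entropyDeriv, expect_eq_add_expect_ite c hs.le hfp]
  have u1 := mass_one_bounds c hs.le
  have u2 := mass_neg_one_bounds c hs.le
  have v1 := abs_mul_neg_log_sub_le hs a.le (by linarith) u1.1 u1.2
  have v2 := abs_mul_neg_log_sub_le hs b (by linarith) u2.1 u2.2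
  have v3 := surprisal_zero_le c hs
  have v4 := surprisal_nonneg c hs.le 0
  have m1 := mass_le_one c hs.le 0
  have m2 := one_sub_le_mass_zero c hs.le
  have m3 := mass_nonneg c hs.le 0
  have hf0 : |f 0 + Real.log s - stepEntropy c| ≤ 3 * s := by
    have : f 0 + Real.log s - stepEntropy c =
        (stepProb c * -Real.log (mass c s 1) -
          (stepProb c * -Real.log s - stepProb c * Real.log (stepProb c))) +
        (stepProb' c * -Real.log (mass c s (-1)) -
          (stepProb' c * -Real.log s - stepProb' c * Real.log (stepProb' c))) -
        surprisal c s 0 := by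
      simp only [hf, stepEntropy, surprisal, zero_add, zero_sub]
      linear_combination -Real.log s * e
    rw [this]
    rw [abs_le] at v1 v2 ⊢
    constructor <;> linarith [v1.1, v1.2, v2.1, v2.2]
  -- The main term appears with weight ν(0) instead of 1; the missing weight is at most s.
  have key : mass c s 0 * f 0 + expect c s (fun x => if x = 0 then 0 else f x) + Real.log s -
      stepEntropy c = mass c s 0 * (f 0 + Real.log s - stepEntropy c) +
      (1 - mass c s 0) * (Real.log s - stepEntropy c) +
      expect c s (fun x => if x = 0 then 0 else f x) := by ring
  rw [key]
  refine (abs_add_three _ _ _).trans ?_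
  have w1 : |mass c s 0 * (f 0 + Real.log s - stepEntropy c)| ≤ 3 * s := by
    rw [abs_mul, abs_of_nonneg m3]
    exact (mul_le_of_le_one_left (abs_nonneg _) m1).trans hf0
  have w2 : |(1 - mass c s 0) * (Real.log s - stepEntropy c)| ≤
      s * (1 - Real.log s + |stepEntropy c|) := by
    rw [abs_mul, abs_of_nonneg (by linarith)]
    refine mul_le_mul (by linarith) ?_ (abs_nonneg _) hs.le
    refine (abs_sub _ _).trans ?_
    rw [abs_of_nonpos hL]
    linarith
  have w3 : s * |stepEntropy c| ≤ s * (1 - Real.log s) * |stepEntropy c| := by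
    gcongr
    nlinarith
  nlinarith

/-- The step is uniform on its support, so its surprisal is constant and equal to its entropy. -/
lemma stepEntropy_sq (c : WalkCase) (l : ℝ) :
    stepProb c * (l - Real.log (stepProb c)) ^ 2 + stepProb' c * (l - Real.log (stepProb' c)) ^ 2 =
      (l + stepEntropy c) ^ 2 := by
  cases c <;> simp only [stepEntropy, stepProb, stepProb', Real.log_one, Real.log_zero] <;> ring

/-- To leading order the second moment of the surprisal comes from x = ±1. The points |x| ≥ 2 and
the squared mean contribute O(s² (1 - log s)²), and x = 0 at most s². -/
lemma exists_varFn_div_sub_le (c : WalkCase) :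
    ∃ K, 0 ≤ K ∧ ∀ s, 0 < s → s ≤ 1 →
      |varFn c s / s - (-Real.log s + stepEntropy c) ^ 2| ≤ K * (s * (1 - Real.log s) ^ 2) := by
  obtain ⟨K, hK0, hK⟩ := exists_abs_expect_ite_le 2
    (g := fun x => (1 + (x : ℝ) ^ 2) ^ 2) (by fun_prop)
  obtain ⟨B, hB0, hB⟩ := exists_entropyFn_le c
  refine ⟨K + B ^ 2 + 9, by positivity, fun s hs hs1 => ?_⟩
  have hL : Real.log s ≤ 0 := Real.log_nonpos hs.le hs1
  have hp := polyGrowth_surprisal c hs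
  have a := stepProb_pos c
  have b := stepProb'_nonneg c
  have e := stepProb_add c
  have h := hK c s ((1 - Real.log s) ^ 2) (fun x => surprisal c s x ^ 2) hs.le hs1 (by positivity)
    fun x => by
      rw [abs_of_nonneg (sq_nonneg _), ← mul_pow]
      have := surprisal_nonneg c hs.le x
      gcongr
      exact surprisal_le_of_le_one c hs hs1 x
  have u1 := mass_one_bounds c hs.le
  have u2 := mass_neg_one_bounds c hs.le
  have v1 := abs_mul_neg_log_sq_sub_le hs hs1 (.inr (half_le_stepProb c)) (by linarith) u1.1 u1.2
  have v2 := abs_mul_neg_log_sq_sub_le hs hs1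
    (by cases c <;> simp [stepProb']) (by linarith) u2.1 u2.2
  have v3 := surprisal_zero_le c hs
  have v4 := surprisal_nonneg c hs.le 0
  have m1 := mass_le_one c hs.le 0
  have m3 := mass_nonneg c hs.le 0
  have w0 : mass c s 0 * surprisal c s 0 ^ 2 ≤ s ^ 2 :=
    (mul_le_of_le_one_left (by positivity) m1).trans (by gcongr)
  have w0' : 0 ≤ mass c s 0 * surprisal c s 0 ^ 2 := by positivity
  have wH : entropyFn c s ^ 2 ≤ (B * (s * (1 - Real.log s))) ^ 2 := by
    have := entropyFn_nonneg c hs.le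
    gcongr
    exact hB s hs hs1
  have wH' : 0 ≤ entropyFn c s ^ 2 := sq_nonneg _
  have main : |varFn c s - s * (-Real.log s + stepEntropy c) ^ 2| ≤
      s * ((K + B ^ 2 + 9) * (s * (1 - Real.log s) ^ 2)) := by
    rw [varFn_eq c hs, expect_eq_three_add_expect_ite c hs.le (by fun_prop), ← stepEntropy_sq]
    rw [abs_le] at h v1 v2 ⊢
    have hs2 : s ^ 2 ≤ s ^ 2 * (1 - Real.log s) ^ 2 :=
      le_mul_of_one_le_right (by positivity) (by nlinarith)
    simp only [surprisal] at *
    constructor <;> nlinarith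
  have e2 : varFn c s / s - (-Real.log s + stepEntropy c) ^ 2 =
      (varFn c s - s * (-Real.log s + stepEntropy c) ^ 2) / s := by field_simp
  rw [e2, abs_div, abs_of_pos hs, div_le_iff₀ hs]
  linarith

lemma tendsto_mul_one_sub_log_pow (n : ℕ) :
    Tendsto (fun s : ℝ => s * (1 - Real.log s) ^ n) (𝓝[>] 0) (𝓝 0) := by
  have h : Tendsto (fun u : ℝ => Real.exp (-u) * (1 + u) ^ n) atTop (𝓝 0) := by
    have h1 := (Real.tendsto_pow_mul_exp_neg_atTop_nhds_zero n).comp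
      (tendsto_atTop_add_const_left atTop (1 : ℝ) tendsto_id)
    have h2 := h1.mul_const (Real.exp 1)
    rw [zero_mul] at h2
    refine h2.congr fun u => ?_
    simp only [Function.comp_apply, id]
    rw [mul_assoc, ← Real.exp_add, mul_comm]
    congr 2; ring
  have h3 := h.comp (tendsto_neg_atBot_atTop.comp Real.tendsto_log_nhdsGT_zero)
  refine h3.congr' ?_
  filter_upwards [self_mem_nhdsWithin] with s hs
  simp only [Function.comp_apply, neg_neg, Real.exp_log hs]
  ring

lemma eventually_small : ∀ᶠ s : ℝ in 𝓝[>] 0, 0 < s ∧ s ≤ 1 ∧ 1 ≤ -Real.log s := by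
  have h1 := (tendsto_neg_atBot_atTop.comp Real.tendsto_log_nhdsGT_zero).eventually_ge_atTop 1
  filter_upwards [h1, self_mem_nhdsWithin,
    mem_nhdsWithin_of_mem_nhds (Iic_mem_nhds (zero_lt_one' ℝ))] with s h1 h2 h3
  exact ⟨h2, h3, h1⟩

lemma tendsto_entropyDeriv_add_log (c : WalkCase) :
    Tendsto (fun s => entropyDeriv c s + Real.log s) (𝓝[>] 0) (𝓝 (stepEntropy c)) := by
  obtain ⟨K, -, hK⟩ := exists_entropyDeriv_sub_le c
  rw [tendsto_iff_norm_sub_tendsto_zero]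
  have h := (tendsto_mul_one_sub_log_pow 1).const_mul K
  rw [mul_zero] at h
  refine squeeze_zero' (.of_forall fun s => norm_nonneg _) ?_ h
  filter_upwards [eventually_small] with s hs
  simpa using hK s hs.1 hs.2.1

lemma stepEntropy_nonneg (c : WalkCase) : 0 ≤ stepEntropy c := by
  cases c
  · simp [stepEntropy, stepProb, stepProb']
  · simp only [stepEntropy, stepProb, stepProb']
    have : Real.log (1 / 2) = -Real.log 2 := by rw [one_div, Real.log_inv]
    have := Real.log_pos one_lt_two
    linarith

/-- Passing from V/s to its square root costs nothing: |√A - B| ≤ |A - B²| once √A + B ≥ 1, and here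
B ≥ -log s ≥ 1. -/
lemma tendsto_sqrt_varFn_div_add_log (c : WalkCase) :
    Tendsto (fun s => √(varFn c s / s) + Real.log s) (𝓝[>] 0) (𝓝 (stepEntropy c)) := by
  obtain ⟨K, -, hK⟩ := exists_varFn_div_sub_le c
  rw [tendsto_iff_norm_sub_tendsto_zero]
  have h := (tendsto_mul_one_sub_log_pow 2).const_mul K
  rw [mul_zero] at h
  refine squeeze_zero' (.of_forall fun s => norm_nonneg _) ?_ h
  filter_upwards [eventually_small] with s hs
  obtain ⟨hs0, hs1, hs2⟩ := hs
  refine le_trans ?_ (hK s hs0 hs1)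
  have hc := stepEntropy_nonneg c
  set B := -Real.log s + stepEntropy c with hB
  set A := varFn c s / s with hA
  have hA0 : 0 ≤ A := div_nonneg (varFn_pos c hs0).le hs0.le
  have e : √A + Real.log s - stepEntropy c = √A - B := by rw [hB]; ring
  have e2 : A - B ^ 2 = (√A - B) * (√A + B) := by
    nth_rewrite 1 [← Real.sq_sqrt hA0]; ring
  rw [e, e2, Real.norm_eq_abs, abs_mul]
  refine le_mul_of_one_le_right (abs_nonneg _) ?_
  have := Real.sqrt_nonneg A
  rw [abs_of_nonneg (by linarith)]
  linarith

lemma entropyFn_zero (c : WalkCase) : entropyFn c 0 = 0 := by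
  rw [entropyFn, expect, tsum_eq_single 0 fun x hx => by simp [mass_zero, hx]]
  simp [surprisal, mass_zero]

lemma continuousOn_entropyFn (c : WalkCase) : ContinuousOn (entropyFn c) (Set.Ici 0) := by
  intro s hs
  rcases (show (0 : ℝ) ≤ s from hs).eq_or_lt with rfl | hs
  · rw [← Set.Ioi_insert, continuousWithinAt_insert_self, ContinuousWithinAt, entropyFn_zero]
    obtain ⟨K, -, hK⟩ := exists_entropyFn_le c
    have h := (tendsto_mul_one_sub_log_pow 1).const_mul K
    rw [mul_zero] at h
    refine squeeze_zero' ?_ ?_ h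
    · filter_upwards [self_mem_nhdsWithin] with s hs
      exact entropyFn_nonneg c (le_of_lt hs)
    · filter_upwards [eventually_small] with s hs
      simpa using hK s hs.1 hs.2.1
  · exact (hasDerivAt_entropyFn c hs).continuousAt.continuousWithinAt

/-! ### Behaviour at large times: reduction to a quadratic approximation of the surprisal -/

/-- Cauchy–Schwarz, through the discriminant of the nonnegative quadratic t ↦ E (t f + g)². -/
lemma sq_expect_mul_le (c : WalkCase) {s : ℝ} (hs : 0 ≤ s) {f g : ℤ → ℝ} (hf : PolyGrowth f)
    (hg : PolyGrowth g) :
    expect c s (fun x => f x * g x) ^ 2 ≤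
      expect c s (fun x => f x ^ 2) * expect c s (fun x => g x ^ 2) := by
  have h : ∀ t : ℝ, 0 ≤ expect c s (fun x => f x ^ 2) * (t * t) +
      (2 * expect c s (fun x => f x * g x)) * t + expect c s (fun x => g x ^ 2) := by
    intro t
    have h1 : 0 ≤ expect c s fun x => (t * f x + g x) ^ 2 :=
      expect_nonneg c hs fun x => sq_nonneg _
    have e : (fun x => (t * f x + g x) ^ 2) = fun x =>
        t * t * f x ^ 2 + 2 * t * (f x * g x) + g x ^ 2 := by ext x; ring
    rw [e, expect_add c hs (by fun_prop) (by fun_prop), expect_add c hs (by fun_prop) (by fun_prop),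
      expect_const_mul, expect_const_mul] at h1
    linarith
  have := discrim_le_zero h
  rw [discrim] at this
  linarith

lemma sq_expect_le (c : WalkCase) {s : ℝ} (hs : 0 ≤ s) {f : ℤ → ℝ} (hf : PolyGrowth f) :
    expect c s f ^ 2 ≤ expect c s (fun x => f x ^ 2) := by
  have h := sq_expect_mul_le c hs hf (.const 1)
  simpa [expect_const c hs] using h

/-- The error of the quadratic approximation of the surprisal. -/
def surprisalError (c : WalkCase) (s : ℝ) (x : ℤ) : ℝ :=
  surprisal c s x - Real.log (2 * Real.pi * s) / 2 - (x - drift c * s) ^ 2 / (2 * s)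

lemma polyGrowth_surprisalError (c : WalkCase) {s : ℝ} (hs : 0 < s) :
    PolyGrowth (surprisalError c s) := by
  have := polyGrowth_surprisal c hs
  unfold surprisalError
  fun_prop

lemma entropyFn_sub_eq (c : WalkCase) {s : ℝ} (hs : 0 < s) :
    entropyFn c s - Real.log (2 * Real.pi * s) / 2 =
      1 / 2 + expect c s (surprisalError c s) := by
  have hp := polyGrowth_surprisal c hs
  have h2 : expect c s (fun x => (x - drift c * s) ^ 2 / (2 * s)) = 1 / 2 := by
    have := expect_const_mul c (s := s) (f := fun x => (x - drift c * s) ^ 2) (1 / (2 * s))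
    have h := centralMoment_two c hs.le
    rw [centralMoment] at h
    rw [h] at this
    simp only [one_div_mul_eq_div] at this
    rw [this]
    field_simp
  have e : expect c s (surprisalError c s) = entropyFn c s - Real.log (2 * Real.pi * s) / 2 -
      1 / 2 := by
    unfold surprisalError
    rw [expect_sub c hs.le (by fun_prop) (by fun_prop), expect_sub c hs.le hp (by fun_prop),
      expect_const c hs.le, h2]
    rfl
  rw [e]; ring

/-- The Gaussian part y² / (2s) has second moment (3s² + s) / (4s²) and mean 1/2. Once the error
vanishes in L², what remains is 3/4 - 1/4 = 1/2. -/
lemma varFn_eq_of_error (c : WalkCase) {s : ℝ} (hs : 0 < s) :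
    varFn c s = (3 + 1 / s) / 4 +
      2 * expect c s (fun x => (x - drift c * s) ^ 2 / (2 * s) * surprisalError c s x) +
      expect c s (fun x => surprisalError c s x ^ 2) -
      (1 / 2 + expect c s (surprisalError c s)) ^ 2 := by
  have hp := polyGrowth_surprisal c hs
  have he := polyGrowth_surprisalError c hs
  set a := Real.log (2 * Real.pi * s) / 2 with ha
  have h1 : entropyFn c s = a + (1 / 2 + expect c s (surprisalError c s)) := by
    rw [← entropyFn_sub_eq c hs]; ring
  have h4 : expect c s (fun x => ((x - drift c * s) ^ 2 / (2 * s)) ^ 2) = (3 + 1 / s) / 4 := by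
    have := expect_const_mul c (s := s) (f := fun x => (x - drift c * s) ^ 4) (1 / (2 * s) ^ 2)
    have h := centralMoment_four c hs.le
    rw [centralMoment] at h
    rw [h] at this
    have e : (fun x : ℤ => (((x : ℝ) - drift c * s) ^ 2 / (2 * s)) ^ 2) =
        fun x : ℤ => 1 / (2 * s) ^ 2 * (x - drift c * s) ^ 4 := by
      ext x; rw [div_pow]; ring
    rw [e, this]
    field_simp
    ring
  have e : (fun x => (surprisal c s x - entropyFn c s) ^ 2) = fun x =>
      ((x - drift c * s) ^ 2 / (2 * s)) ^ 2 +
      2 * ((x - drift c * s) ^ 2 / (2 * s) * surprisalError c s x) +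
      surprisalError c s x ^ 2 -
      (2 * (1 / 2 + expect c s (surprisalError c s)) * (surprisal c s x - entropyFn c s) +
        (1 / 2 + expect c s (surprisalError c s)) ^ 2) := by
    ext x
    have hx : surprisal c s x = a + (x - drift c * s) ^ 2 / (2 * s) + surprisalError c s x := by
      rw [surprisalError, ← ha]; ring
    rw [h1, hx]
    ring
  have h0 : expect c s (fun x => surprisal c s x - entropyFn c s) = 0 := by
    rw [expect_sub c hs.le hp (by fun_prop), expect_const c hs.le]
    exact sub_self _
  rw [varFn, e, expect_sub c hs.le (by fun_prop) (by fun_prop),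
    expect_add c hs.le (by fun_prop) (by fun_prop), expect_add c hs.le (by fun_prop) (by fun_prop),
    expect_add c hs.le (by fun_prop) (by fun_prop), expect_const_mul, expect_const_mul, h0,
    expect_const c hs.le, h4]
  ring

section approx

variable {c : WalkCase}
  (h : Tendsto (fun s => expect c s (fun x => surprisalError c s x ^ 2)) atTop (𝓝 0))
include h

lemma tendsto_expect_surprisalError :
    Tendsto (fun s => expect c s (surprisalError c s)) atTop (𝓝 0) := by
  have h1 := h.sqrt
  rw [Real.sqrt_zero] at h1
  refine squeeze_zero_norm' ?_ h1
  filter_upwards [eventually_gt_atTop 0] with s hs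
  rw [Real.norm_eq_abs]
  exact Real.abs_le_sqrt (sq_expect_le c hs.le (polyGrowth_surprisalError c hs))

lemma tendsto_entropyFn_sub_log_of_error :
    Tendsto (fun s => entropyFn c s - Real.log (2 * Real.pi * Real.exp 1 * s) / 2) atTop
      (𝓝 0) := by
  refine (tendsto_expect_surprisalError h).congr' ?_
  filter_upwards [eventually_gt_atTop 0] with s hs
  have e := entropyFn_sub_eq c hs
  have e2 : Real.log (2 * Real.pi * Real.exp 1 * s) = Real.log (2 * Real.pi * s) + 1 := by
    rw [show 2 * Real.pi * Real.exp 1 * s = 2 * Real.pi * s * Real.exp 1 by ring,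
      Real.log_mul (by positivity) (Real.exp_pos 1).ne', Real.log_exp]
  rw [e2]
  linarith

lemma tendsto_varFn_of_error : Tendsto (varFn c) atTop (𝓝 (1 / 2)) := by
  have i1 : Tendsto (fun s : ℝ => (3 + 1 / s) / 4) atTop (𝓝 ((3 + 0) / 4)) :=
    (tendsto_const_nhds.add (tendsto_const_nhds.div_atTop tendsto_id)).div_const _
  have i2 : Tendsto (fun s => expect c s
      (fun x => (x - drift c * s) ^ 2 / (2 * s) * surprisalError c s x)) atTop (𝓝 0) := by
    have h1 := (i1.mul h).sqrt
    rw [mul_zero, Real.sqrt_zero] at h1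
    refine squeeze_zero_norm' ?_ h1
    filter_upwards [eventually_gt_atTop 0] with s hs
    rw [Real.norm_eq_abs]
    refine Real.abs_le_sqrt ((sq_expect_mul_le c hs.le (by fun_prop)
      (polyGrowth_surprisalError c hs)).trans_eq ?_)
    congr 1
    have := expect_const_mul c (s := s) (f := fun x => (x - drift c * s) ^ 4) (1 / (2 * s) ^ 2)
    have h := centralMoment_four c hs.le
    rw [centralMoment] at h
    rw [h] at this
    have e : (fun x : ℤ => (((x : ℝ) - drift c * s) ^ 2 / (2 * s)) ^ 2) =
        fun x : ℤ => 1 / (2 * s) ^ 2 * (x - drift c * s) ^ 4 := by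
      ext x; rw [div_pow]; ring
    rw [e, this]
    field_simp
    ring
  have i3 := (tendsto_const_nhds (x := (1 / 2 : ℝ))).add (tendsto_expect_surprisalError h)
  have key := ((i1.add (i2.const_mul 2)).add h).sub (i3.pow 2)
  norm_num at key
  refine key.congr' ?_
  filter_upwards [eventually_gt_atTop 0] with s hs
  rw [varFn_eq_of_error c hs]
  norm_num

end approx

/-! ### Behaviour at large times: the Poisson process -/

/-- Taylor expansion at 1 with a cubic error that remains valid down to x = 0. Below 1/2 the left
side is at most 1/2 = 4 (1/2)³. Above 1/2 the mean value inequality applies, since the derivative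
log y - (y - 1) is at most 2 (y - 1)² in absolute value. -/
lemma abs_mul_log_sub_le {x : ℝ} (hx : 0 ≤ x) :
    |x * Real.log x - x + 1 - (x - 1) ^ 2 / 2| ≤ 4 * |x - 1| ^ 3 := by
  rcases lt_or_ge x (1 / 2) with h | h
  · have h1 : x * Real.log x ≤ 0 :=
      mul_nonpos_of_nonneg_of_nonpos hx (Real.log_nonpos hx (by linarith))
    have h2 : x - 1 ≤ x * Real.log x := by
      rcases hx.eq_or_lt with rfl | hx
      · simp
      · have := mul_le_mul_of_nonneg_left (Real.one_sub_inv_le_log_of_pos hx) hx.le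
        have e : x * (1 - x⁻¹) = x - 1 := by field_simp
        linarith
    have h3 : (1 / 2 : ℝ) ^ 3 ≤ |x - 1| ^ 3 := by
      gcongr
      rw [abs_of_neg (by linarith)]; linarith
    have h4 : |x * Real.log x - x + 1 - (x - 1) ^ 2 / 2| ≤ 1 / 2 := by
      rw [abs_le]; constructor <;> nlinarith
    linarith
  · have hd : ∀ y : ℝ, 1 / 2 ≤ y → HasDerivAt
        (fun x => x * Real.log x - x + 1 - (x - 1) ^ 2 / 2) (Real.log y - (y - 1)) y := by
      intro y hy
      have := (((Real.hasDerivAt_mul_log (x := y) (by linarith)).sub (hasDerivAt_id y)).add_const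
        1).sub ((((hasDerivAt_id y).sub_const 1).pow 2).div_const 2)
      convert! this using 1
      simp
    have hsub : ∀ y ∈ segment ℝ 1 x, 1 / 2 ≤ y ∧ |y - 1| ≤ |x - 1| := by
      intro y hy
      rw [segment_eq_uIcc] at hy
      refine ⟨le_trans (le_min (by norm_num) h) hy.1, ?_⟩
      have := Set.abs_sub_left_of_mem_uIcc hy
      simpa using this
    have key := Convex.norm_image_sub_le_of_norm_hasDerivWithin_le (𝕜 := ℝ)
      (f := fun x => x * Real.log x - x + 1 - (x - 1) ^ 2 / 2)
      (f' := fun y => Real.log y - (y - 1)) (C := 2 * |x - 1| ^ 2) (s := segment ℝ 1 x)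
      (x := 1) (y := x) (fun y hy => (hd y (hsub y hy).1).hasDerivWithinAt) ?_
      (convex_segment _ _) (left_mem_segment _ _ _) (right_mem_segment _ _ _)
    · simp only [Real.log_one, mul_zero, Real.norm_eq_abs] at key
      norm_num at key
      refine key.trans ?_
      have : 0 ≤ |x - 1| ^ 3 := by positivity
      calc 2 * (x - 1) ^ 2 * |x - 1| = 2 * |x - 1| ^ 3 := by rw [← sq_abs]; ring
        _ ≤ _ := by linarith
    · intro y hy
      obtain ⟨h1, h2⟩ := hsub y hy
      have hy0 : 0 < y := by linarith
      have l1 := Real.log_le_sub_one_of_pos hy0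
      have l2 := Real.one_sub_inv_le_log_of_pos hy0
      have hinv : y⁻¹ ≤ 2 := by
        rw [inv_le_comm₀ hy0 two_pos]; linarith
      have e : (y - 1) - (1 - y⁻¹) = (y - 1) ^ 2 * y⁻¹ := by field_simp
      have h3 : (y - 1) ^ 2 * y⁻¹ ≤ (y - 1) ^ 2 * 2 := by gcongr
      have h4 : |y - 1| ^ 2 ≤ |x - 1| ^ 2 := by gcongr
      rw [sq_abs] at h4
      rw [Real.norm_eq_abs, abs_le]
      constructor <;> linarith [abs_nonneg (x - 1)]

lemma abs_mul_log_div_sub_le {x s : ℝ} (hx : 0 ≤ x) (hs : 0 < s) :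
    |x * Real.log (x / s) - x + s - (x - s) ^ 2 / (2 * s)| ≤ 4 * |x - s| ^ 3 / s ^ 2 := by
  have h := mul_le_mul_of_nonneg_left (abs_mul_log_sub_le (div_nonneg hx hs.le)) hs.le
  have e1 : s * |x / s * Real.log (x / s) - x / s + 1 - (x / s - 1) ^ 2 / 2| =
      |x * Real.log (x / s) - x + s - (x - s) ^ 2 / (2 * s)| := by
    nth_rewrite 1 [← abs_of_pos hs]
    rw [← abs_mul]
    congr 1
    field_simp
  have e2 : s * (4 * |x / s - 1| ^ 3) = 4 * |x - s| ^ 3 / s ^ 2 := by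
    have : x / s - 1 = (x - s) / s := by field_simp
    rw [this, abs_div, abs_of_pos hs]
    field_simp
  rwa [e1, e2] at h

lemma mass_directed_natCast (s : ℝ) (m : ℕ) :
    mass .directed s m = Real.exp (-s) * (s ^ m / m !) := by
  rw [mass, tsum_eq_single m (by intro j hj; simp [stepWeight_directed, hj.symm])]
  simp [stepWeight_directed]

lemma mass_directed_of_neg (s : ℝ) {x : ℤ} (hx : x < 0) : mass .directed s x = 0 := by
  have (j : ℕ) : x ≠ j := by omega
  simp [mass, stepWeight_directed, this]

lemma expect_directed_mono {s : ℝ} (hs : 0 ≤ s) {f g : ℤ → ℝ} (hf : PolyGrowth f)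
    (hg : PolyGrowth g) (h : ∀ m : ℕ, f m ≤ g m) : expect .directed s f ≤ expect .directed s g := by
  refine (hf.summable_mass_mul _ hs).tsum_le_tsum (fun x => ?_) (hg.summable_mass_mul _ hs)
  rcases lt_or_ge x 0 with hx | hx
  · simp [mass_directed_of_neg s hx]
  · lift x to ℕ using hx
    exact mul_le_mul_of_nonneg_left (h x) (mass_nonneg _ hs _)

lemma expect_directed_congr {s : ℝ} {f g : ℤ → ℝ} (h : ∀ m : ℕ, f m = g m) :
    expect .directed s f = expect .directed s g := by
  unfold expect
  congr 1; ext x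
  rcases lt_or_ge x 0 with hx | hx
  · simp [mass_directed_of_neg s hx]
  · lift x to ℕ using hx
    rw [h]

lemma drift_directed : drift .directed = 1 := by norm_num [drift, stepProb, stepProb']

lemma surprisal_directed_natCast {s : ℝ} (hs : 0 < s) (m : ℕ) :
    surprisal .directed s m = s - m * Real.log s + Real.log (m !) := by
  rw [surprisal, mass_directed_natCast, Real.log_mul (by positivity) (by positivity), Real.log_exp,
    Real.log_div (by positivity) (by positivity), Real.log_pow]
  ring

/-- The error in Stirling's formula, in a form that is also valid at `0`. -/
def stirlingError (m : ℕ) : ℝ :=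
  Real.log (m !) - (m * Real.log m - m + Real.log (2 * Real.pi * (m + 1)) / 2)

lemma tendsto_stirlingError : Tendsto stirlingError atTop (𝓝 0) := by
  have h1 := (Stirling.tendsto_stirlingSeq_sqrt_pi.log (by positivity)).sub_const
    (Real.log √Real.pi)
  rw [sub_self] at h1
  have h2 : Tendsto (fun m : ℕ => Real.log ((m : ℝ) / (m + 1)) / 2) atTop (𝓝 0) := by
    have := ((tendsto_natCast_div_add_atTop (1 : ℝ)).log one_ne_zero).div_const 2
    simpa using this
  have h3 := h1.add h2
  rw [add_zero] at h3
  refine h3.congr' ?_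
  filter_upwards [eventually_gt_atTop 0] with m hm
  have hm' : (0 : ℝ) < m := by exact_mod_cast hm
  rw [Stirling.log_stirlingSeq_formula, stirlingError, Real.log_sqrt Real.pi_pos.le,
    Real.log_div hm'.ne' (Real.exp_pos 1).ne', Real.log_exp,
    Real.log_div hm'.ne' (show (m : ℝ) + 1 ≠ 0 by positivity), Real.log_mul two_ne_zero hm'.ne',
    Real.log_mul (by positivity) (show (m : ℝ) + 1 ≠ 0 by positivity),
    Real.log_mul two_ne_zero Real.pi_pos.ne']
  ring

lemma exists_abs_stirlingError_le : ∃ B, ∀ m, |stirlingError m| ≤ B := by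
  obtain ⟨B, hB⟩ := (Metric.isBounded_range_of_tendsto _ tendsto_stirlingError).exists_norm_le
  exact ⟨B, fun m => hB _ ⟨m, rfl⟩⟩

/-- Inserting Stirling's formula splits the error into a Taylor remainder, a logarithm of the ratio
(m + 1) / s, and the Stirling error; each is estimated in mean square. -/
lemma surprisalError_directed_natCast {s : ℝ} (hs : 0 < s) (m : ℕ) :
    surprisalError .directed s m =
      (m * Real.log (m / s) - m + s - (m - s) ^ 2 / (2 * s)) + Real.log ((m + 1) / s) / 2 +
        stirlingError m := by
  have h : (m : ℝ) * Real.log (m / s) = m * Real.log m - m * Real.log s := by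
    rcases Nat.eq_zero_or_pos m with rfl | hm
    · simp
    · have hm' : (0 : ℝ) < m := by exact_mod_cast hm
      rw [Real.log_div hm'.ne' hs.ne']; ring
  rw [surprisalError, surprisal_directed_natCast hs, h, stirlingError, drift_directed, one_mul,
    Real.log_div (by positivity) hs.ne', Real.log_mul (by positivity) hs.ne',
    Real.log_mul (by positivity) (show (m : ℝ) + 1 ≠ 0 by positivity), Int.cast_natCast]
  ring

/-- For u = (m + 1) / s at least 1/2, |log u| ≤ 2 |u - 1|. Otherwise |log u| ≤ s and 2 (s - m) / s ≥
1. The sixth power is chosen because the sixth moment, of order s³, beats the factor s² / s⁶,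
whereas the fourth would not. -/
lemma log_div_sq_le {s : ℝ} (hs : 1 ≤ s) (m : ℕ) :
    Real.log ((m + 1) / s) ^ 2 ≤ 4 * ((m - s + 1) / s) ^ 2 + s ^ 2 * (2 * (m - s) / s) ^ 6 := by
  have hs0 : 0 < s := by linarith
  have hu : 0 < ((m : ℝ) + 1) / s := by positivity
  have l1 := Real.log_le_sub_one_of_pos hu
  have e1 : ((m : ℝ) + 1) / s - 1 = (m - s + 1) / s := by field_simp; ring
  rw [e1] at l1
  rcases le_or_gt (s / 2) (m + 1) with h | h
  · have l2 := Real.one_sub_inv_le_log_of_pos hu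
    have e2 : 1 - (((m : ℝ) + 1) / s)⁻¹ = (m - s + 1) / s * (s / (m + 1)) := by field_simp; ring
    rw [e2] at l2
    have h2 : s / (m + 1) ≤ 2 := by rw [div_le_iff₀ (by positivity)]; linarith
    have h20 : 0 ≤ s / ((m : ℝ) + 1) := by positivity
    have h3 : 0 ≤ s ^ 2 * (2 * (m - s) / s) ^ 6 := by positivity
    set t := ((m : ℝ) - s + 1) / s
    set w := s / ((m : ℝ) + 1)
    have h4 : |Real.log ((m + 1) / s)| ≤ 2 * |t| := by
      have a1 := le_abs_self t
      have a2 := neg_abs_le t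
      rw [abs_le]
      constructor <;> nlinarith [abs_nonneg t]
    have h5 : |Real.log ((m + 1) / s)| ^ 2 ≤ (2 * |t|) ^ 2 := by gcongr
    rw [mul_pow, sq_abs, sq_abs] at h5
    linarith
  · have hm : (0 : ℝ) ≤ m := by positivity
    have h1 : |Real.log ((m + 1) / s)| ≤ s := by
      have a1 : Real.log ((m + 1) / s) ≤ 0 :=
        Real.log_nonpos hu.le (by rw [div_le_one hs0]; linarith)
      have a2 : Real.log s ≤ s := (Real.log_le_sub_one_of_pos hs0).trans (by linarith)
      have a3 : 0 ≤ Real.log ((m : ℝ) + 1) := Real.log_nonneg (by linarith)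
      rw [abs_of_nonpos a1, Real.log_div (by positivity) hs0.ne']
      linarith
    have h2 : |Real.log ((m + 1) / s)| ^ 2 ≤ s ^ 2 := by gcongr
    rw [sq_abs] at h2
    have h3 : 1 ≤ (2 * (m - s) / s) ^ 6 := by
      have e : (2 * ((m : ℝ) - s) / s) ^ 6 = (2 * (s - m) / s) ^ 6 := by ring
      rw [e]
      refine one_le_pow₀ ?_
      rw [le_div_iff₀ hs0]; linarith
    have h4 : 0 ≤ 4 * (((m : ℝ) - s + 1) / s) ^ 2 := by positivity
    nlinarith [sq_nonneg s]

lemma tendsto_surprisalError_directed :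
    Tendsto (fun s => expect .directed s (fun x => surprisalError .directed s x ^ 2)) atTop
      (𝓝 0) := by
  obtain ⟨B, hB⟩ := exists_abs_stirlingError_le
  rw [Metric.tendsto_nhds]
  intro ε hε
  obtain ⟨M, hM⟩ := eventually_atTop.1
    (((tendsto_stirlingError.abs.pow 2).const_mul 3).eventually_lt_const
      (show 3 * |(0 : ℝ)| ^ 2 < ε / 2 by simpa using half_pos hε))
  have hlim : Tendsto (fun s : ℝ => 2000 * (s⁻¹ + s⁻¹ ^ 2 + s⁻¹ ^ 3) + 12 * B ^ 2 * s⁻¹) atTop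
      (𝓝 0) := by
    have h := tendsto_inv_atTop_zero (𝕜 := ℝ)
    have := (((h.add (h.pow 2)).add (h.pow 3)).const_mul 2000).add (h.const_mul (12 * B ^ 2))
    simpa using this
  filter_upwards [eventually_ge_atTop 1, eventually_ge_atTop (2 * (M : ℝ)),
    hlim.eventually_lt_const (half_pos hε)] with s hs1 hsM hlim
  have hs : 0 < s := by linarith
  have hp := polyGrowth_surprisalError .directed hs
  rw [Real.dist_eq, sub_zero, abs_of_nonneg (expect_nonneg _ hs.le fun x => sq_nonneg _)]
  set y : ℤ → ℝ := fun x => x - drift .directed * s with hy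
  have hyp : PolyGrowth y := by fun_prop
  have hle : expect .directed s (fun x => surprisalError .directed s x ^ 2) ≤
      expect .directed s (fun x => (ε / 2 + 3 / 2 * s⁻¹ ^ 2 * 4) +
        (3 / 2 * s⁻¹ ^ 2 * 4 + 12 * B ^ 2 * s⁻¹ ^ 2) * y x ^ 2 +
        (48 * s⁻¹ ^ 4 + 48 * s⁻¹ ^ 4) * y x ^ 6) := by
    refine expect_directed_mono hs.le (by fun_prop) (by fun_prop) fun m => ?_
    rw [surprisalError_directed_natCast hs]
    have hym : y m = m - s := by simp [hy, drift_directed]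
    rw [hym]
    set z := (m : ℝ) - s
    have b1 := abs_mul_log_div_sub_le (x := m) (by positivity) hs
    set A := (m : ℝ) * Real.log (m / s) - m + s - (m - s) ^ 2 / (2 * s)
    have b1' : A ^ 2 ≤ 16 * (s⁻¹ ^ 4 * z ^ 6) := by
      have : |A| ^ 2 ≤ (4 * |z| ^ 3 / s ^ 2) ^ 2 := by gcongr
      rw [sq_abs] at this
      refine this.trans_eq ?_
      rw [div_pow, mul_pow, ← pow_mul, show 3 * 2 = 6 by norm_num, Even.pow_abs (by decide)]
      field_simp
      ring
    have b2 := log_div_sq_le hs1 m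
    set ℓ := Real.log (((m : ℝ) + 1) / s)
    have b2' : ℓ ^ 2 ≤ 8 * (s⁻¹ ^ 2 * z ^ 2) + 8 * s⁻¹ ^ 2 + 64 * (s⁻¹ ^ 4 * z ^ 6) := by
      refine b2.trans ?_
      have e1 : s ^ 2 * (2 * z / s) ^ 6 = 64 * (s⁻¹ ^ 4 * z ^ 6) := by
        field_simp; ring
      have e2 : ((z + 1) / s) ^ 2 = s⁻¹ ^ 2 * (z + 1) ^ 2 := by field_simp
      rw [e1, e2]
      have : (z + 1) ^ 2 ≤ 2 * z ^ 2 + 2 := by nlinarith [sq_nonneg (z - 1)]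
      have := mul_le_mul_of_nonneg_left this (sq_nonneg s⁻¹)
      linarith
    have b3 : 3 * stirlingError m ^ 2 ≤ ε / 2 + 12 * B ^ 2 * (s⁻¹ ^ 2 * z ^ 2) := by
      rcases le_or_gt M m with h | h
      · have := hM m h
        rw [sq_abs] at this
        have h2 : 0 ≤ 12 * B ^ 2 * (s⁻¹ ^ 2 * z ^ 2) := by positivity
        linarith
      -- For m < M the Stirling error is only bounded, but such m lie at distance at least s / 2
      -- from the mean, so the second moment pays for them as in Chebyshev's inequality.
      · have h1 : |stirlingError m| ^ 2 ≤ B ^ 2 := by gcongr; exact hB m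
        rw [sq_abs] at h1
        have hmM : (m : ℝ) ≤ M := by exact_mod_cast h.le
        have h2 : 1 / 2 ≤ s⁻¹ * -z := by
          rw [inv_mul_eq_div, le_div_iff₀ hs]; linarith
        have h3 : (1 / 2) ^ 2 ≤ (s⁻¹ * -z) ^ 2 := by gcongr
        have h4 : (s⁻¹ * -z) ^ 2 = s⁻¹ ^ 2 * z ^ 2 := by ring
        rw [h4] at h3
        nlinarith [sq_nonneg B]
    have b4 : (A + ℓ / 2 + stirlingError m) ^ 2 ≤
        3 * A ^ 2 + 3 / 4 * ℓ ^ 2 + 3 * stirlingError m ^ 2 := by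
      nlinarith [sq_nonneg (A - ℓ / 2), sq_nonneg (A - stirlingError m),
        sq_nonneg (ℓ / 2 - stirlingError m)]
    linarith
  rw [expect_add _ hs.le (by fun_prop) (by fun_prop), expect_add _ hs.le (by fun_prop)
    (by fun_prop), expect_const _ hs.le, expect_const_mul, expect_const_mul] at hle
  have m2 : expect .directed s (fun x => y x ^ 2) = s := centralMoment_two _ hs.le
  have m6 : expect .directed s (fun x => y x ^ 6) ≤ 15 * s ^ 3 + 25 * s ^ 2 + s :=
    centralMoment_six_le _ hs.le
  rw [m2] at hle
  have hinv : s⁻¹ * s = 1 := inv_mul_cancel₀ hs.ne'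
  have hi0 : 0 < s⁻¹ := by positivity
  have f1 : (48 * s⁻¹ ^ 4 + 48 * s⁻¹ ^ 4) * expect .directed s (fun x => y x ^ 6) ≤
      96 * (15 * s⁻¹ + 25 * s⁻¹ ^ 2 + s⁻¹ ^ 3) := by
    calc _ ≤ (48 * s⁻¹ ^ 4 + 48 * s⁻¹ ^ 4) * (15 * s ^ 3 + 25 * s ^ 2 + s) := by gcongr
      _ = _ := by field_simp; ring
  have f2 : (3 / 2 * s⁻¹ ^ 2 * 4 + 12 * B ^ 2 * s⁻¹ ^ 2) * s = 6 * s⁻¹ + 12 * B ^ 2 * s⁻¹ := by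
    field_simp; ring
  rw [f2] at hle
  nlinarith [pow_pos hi0 2, pow_pos hi0 3]

/-- Here H' = E log((X + 1) / s), and the Chen–Stein identity turns s H' into E[X log(X / s)]. The
expansion of x log(x / s) around s gives E(X - s) + E(X - s)² / (2s) = 1/2 in the limit. -/
lemma tendsto_mul_entropyDeriv_directed :
    Tendsto (fun s => s * entropyDeriv .directed s) atTop (𝓝 (1 / 2)) := by
  rw [tendsto_iff_norm_sub_tendsto_zero]
  have hlim : Tendsto (fun s : ℝ => 2 * (4 * (√s)⁻¹ + (√s)⁻¹ ^ 3)) atTop (𝓝 0) := by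
    have h := tendsto_inv_atTop_zero.comp Real.tendsto_sqrt_atTop
    have := ((h.const_mul 4).add (h.pow 3)).const_mul 2
    simpa using this
  refine squeeze_zero' (.of_forall fun s => norm_nonneg _) ?_ hlim
  filter_upwards [eventually_ge_atTop 1] with s hs1
  have hs : 0 < s := by linarith
  have hlp : PolyGrowth fun x : ℤ => Real.log (x / s) := by
    refine PolyGrowth.mono (g := fun x => |(x : ℝ)| + |Real.log s|) (by fun_prop) fun x => ?_
    rw [abs_of_nonneg (a := |(x : ℝ)| + |Real.log s|) (by positivity)]
    by_cases hx : x = 0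
    · subst hx; simp
    · have hx1 : (1 : ℝ) ≤ |(x : ℝ)| := by exact_mod_cast Int.one_le_abs hx
      have hx' : (x : ℝ) ≠ 0 := by exact_mod_cast hx
      rw [Real.log_div hx' hs.ne', ← Real.log_abs (x : ℝ)]
      refine (abs_sub _ _).trans (add_le_add ?_ le_rfl)
      rw [abs_of_nonneg (Real.log_nonneg hx1)]
      linarith [Real.log_le_sub_one_of_pos (show 0 < |(x : ℝ)| by linarith)]
  have e1 : s * entropyDeriv .directed s = expect .directed s (fun x => x * Real.log (x / s)) := by
    rw [expect_cast_mul _ hs.le hlp]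
    simp only [stepProb, stepProb', one_mul, zero_mul, sub_zero]
    congr 1
    refine expect_directed_congr fun m => ?_
    have h1 := surprisal_directed_natCast hs (m + 1)
    push_cast at h1
    simp only [stepProb, stepProb', one_mul, zero_mul, add_zero]
    rw [h1, surprisal_directed_natCast hs, Nat.factorial_succ]
    push_cast
    rw [Real.log_mul (by positivity) (by positivity), Real.log_div (by positivity) hs.ne']
    ring
  set y : ℤ → ℝ := fun x => x - drift .directed * s with hy
  have hyp : PolyGrowth y := by fun_prop
  have m1 : expect .directed s y = 0 := by
    have := centralMoment_one .directed hs.le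
    simpa only [centralMoment, pow_one] using this
  have m2 : expect .directed s (fun x => y x ^ 2) = s := centralMoment_two _ hs.le
  have m4 : expect .directed s (fun x => y x ^ 4) = 3 * s ^ 2 + s := centralMoment_four _ hs.le
  have e2 : s * entropyDeriv .directed s - 1 / 2 = expect .directed s
      (fun x => (x * Real.log (x / s) - y x) - 1 / (2 * s) * y x ^ 2) := by
    rw [expect_sub _ hs.le (by fun_prop) (by fun_prop), expect_sub _ hs.le (by fun_prop) hyp,
      expect_const_mul, m1, m2, e1, sub_zero]
    field_simp
  rw [e2, Real.norm_eq_abs]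
  refine (abs_expect_le _ hs.le (by fun_prop)).trans ?_
  have hle : expect .directed s
      (fun x => |(x * Real.log (x / s) - y x) - 1 / (2 * s) * y x ^ 2|) ≤
      expect .directed s (fun x => 2 * (√s / s ^ 2) * y x ^ 2 + 2 * ((√s)⁻¹ / s ^ 2) * y x ^ 4) := by
    refine expect_directed_mono hs.le (by fun_prop) (by fun_prop) fun m => ?_
    have hym : y m = m - s := by simp [hy, drift_directed]
    rw [hym]
    have b := abs_mul_log_div_sub_le (x := m) (by positivity) hs
    push_cast
    have e : (m : ℝ) * Real.log (m / s) - (m - s) - 1 / (2 * s) * (m - s) ^ 2 =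
        m * Real.log (m / s) - m + s - (m - s) ^ 2 / (2 * s) := by ring
    rw [e]
    refine b.trans ?_
    set z := (m : ℝ) - s
    have hsq : 0 < √s := Real.sqrt_pos.2 hs
    -- The arithmetic-geometric mean inequality replaces the third absolute moment by the second and
    -- fourth, with weights balanced at |z| of order √s.
    have h3 : 2 * |z| ^ 3 ≤ √s * z ^ 2 + (√s)⁻¹ * z ^ 4 := by
      have h := sq_nonneg (√s - |z|)
      have h' : 2 * |z| ≤ √s + (√s)⁻¹ * z ^ 2 := by
        rw [← sub_nonneg]
        have : √s + (√s)⁻¹ * z ^ 2 - 2 * |z| = (√s)⁻¹ * (√s - |z|) ^ 2 := by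
          rw [← sq_abs z]; field_simp; ring
        rw [this]; positivity
      calc 2 * |z| ^ 3 = 2 * |z| * z ^ 2 := by rw [← sq_abs z]; ring
        _ ≤ (√s + (√s)⁻¹ * z ^ 2) * z ^ 2 := by gcongr
        _ = _ := by ring
    calc 4 * |z| ^ 3 / s ^ 2 = 2 * (2 * |z| ^ 3) / s ^ 2 := by ring
      _ ≤ 2 * (√s * z ^ 2 + (√s)⁻¹ * z ^ 4) / s ^ 2 := by gcongr
      _ = _ := by ring
  refine hle.trans_eq ?_
  rw [expect_add _ hs.le (by fun_prop) (by fun_prop), expect_const_mul, expect_const_mul, m2, m4]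
  have hsq : 0 < √s := Real.sqrt_pos.2 hs
  have hss : s = √s ^ 2 := (Real.sq_sqrt hs.le).symm
  set r := √s
  rw [hss]
  field_simp
  ring

/-! ### Behaviour at large times: the simple random walk, return probability -/

lemma integral_cos_int_mul (x : ℤ) :
    ∫ θ in -Real.pi..Real.pi, Real.cos (x * θ) = if x = 0 then 2 * Real.pi else 0 := by
  split_ifs with h
  · subst h; simp; ring
  · have h' : (x : ℝ) ≠ 0 := by exact_mod_cast h
    rw [intervalIntegral.integral_comp_mul_left (fun θ => Real.cos θ) h', integral_cos]
    simp [Real.sin_int_mul_pi]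

/-- Fourier inversion: cos θ is the characteristic function of one step, and multiplication by it is
the recursion of the weights. -/
lemma integral_cos_pow_mul_cos (m : ℕ) (x : ℤ) :
    ∫ θ in -Real.pi..Real.pi, Real.cos θ ^ m * Real.cos (x * θ) =
      2 * Real.pi * stepWeight .undirected m x := by
  induction m generalizing x with
  | zero =>
    simp only [pow_zero, one_mul, integral_cos_int_mul, stepWeight]
    split_ifs <;> simp
  | succ m ih =>
    have e : ∀ θ : ℝ, Real.cos θ ^ (m + 1) * Real.cos (x * θ) =
        1 / 2 * (Real.cos θ ^ m * Real.cos ((x - 1 : ℤ) * θ)) +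
          1 / 2 * (Real.cos θ ^ m * Real.cos ((x + 1 : ℤ) * θ)) := by
      intro θ
      push_cast
      rw [sub_mul, add_mul, one_mul, Real.cos_sub, Real.cos_add]
      ring
    simp only [e]
    rw [intervalIntegral.integral_add (by apply Continuous.intervalIntegrable; fun_prop)
      (by apply Continuous.intervalIntegrable; fun_prop), intervalIntegral.integral_const_mul,
      intervalIntegral.integral_const_mul, ih, ih]
    simp only [stepWeight, stepProb, stepProb']
    ring

lemma mass_undirected_zero {s : ℝ} (hs : 0 ≤ s) :
    2 * Real.pi * mass .undirected s 0 =
      ∫ θ in -Real.pi..Real.pi, Real.exp (-(s * (1 - Real.cos θ))) := by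
  have hexp (y : ℝ) : HasSum (fun m : ℕ => y ^ m / m !) (Real.exp y) := by
    rw [Real.exp_eq_exp_ℝ]; exact NormedSpace.expSeries_div_hasSum_exp y
  have key : HasSum (fun m : ℕ => ∫ θ in -Real.pi..Real.pi,
      Real.exp (-s) * ((s * Real.cos θ) ^ m / m !))
      (∫ θ in -Real.pi..Real.pi, Real.exp (-s) * Real.exp (s * Real.cos θ)) := by
    refine intervalIntegral.hasSum_integral_of_dominated_convergence
      (fun m _ => Real.exp (-s) * (s ^ m / m !)) (fun m => ?_) (fun m => .of_forall fun θ _ => ?_)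
      (.of_forall fun θ _ => (hexp s).summable.mul_left _) ?_
      (.of_forall fun θ _ => (hexp _).mul_left _)
    · exact Continuous.aestronglyMeasurable (by fun_prop)
    · rw [norm_mul, Real.norm_eq_abs, Real.abs_exp, norm_div, norm_pow, Real.norm_natCast,
        norm_mul, Real.norm_of_nonneg hs]
      gcongr
      exact mul_le_of_le_one_right hs (Real.abs_cos_le_one θ)
    · exact intervalIntegrable_const
  have e1 : (fun θ : ℝ => Real.exp (-s) * Real.exp (s * Real.cos θ)) =
      fun θ => Real.exp (-(s * (1 - Real.cos θ))) := by
    ext θ; rw [← Real.exp_add]; congr 1; ring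
  rw [e1] at key
  rw [← key.tsum_eq, mass, ← tsum_mul_left, ← tsum_mul_left]
  congr 1; ext m
  have e2 : (fun θ : ℝ => Real.exp (-s) * ((s * Real.cos θ) ^ m / m !)) =
      fun θ => Real.exp (-s) * (s ^ m / m !) * (Real.cos θ ^ m * Real.cos ((0 : ℤ) * θ)) := by
    ext θ; simp; ring
  rw [e2, intervalIntegral.integral_const_mul, integral_cos_pow_mul_cos]
  ring

lemma tendsto_sq_mul_one_sub_cos (u : ℝ) :
    Tendsto (fun r : ℝ => r ^ 2 * (1 - Real.cos (u / r))) atTop (𝓝 (u ^ 2 / 2)) := by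
  rw [tendsto_iff_norm_sub_tendsto_zero]
  have hlim : Tendsto (fun r : ℝ => |u| ^ 4 * (r⁻¹ ^ 2 * (5 / 96))) atTop (𝓝 0) := by
    have := (((tendsto_inv_atTop_zero (𝕜 := ℝ)).pow 2).mul_const (5 / 96)).const_mul (|u| ^ 4)
    simpa using this
  refine squeeze_zero' (.of_forall fun r => norm_nonneg _) ?_ hlim
  filter_upwards [eventually_gt_atTop 0, eventually_ge_atTop |u|] with r hr hur
  have h1 : |u / r| ≤ 1 := by rw [abs_div, abs_of_pos hr, div_le_one hr]; exact hur
  have h2 := mul_le_mul_of_nonneg_left (Real.cos_bound h1) (sq_nonneg r)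
  have e1 : r ^ 2 * |Real.cos (u / r) - (1 - (u / r) ^ 2 / 2)| =
      |r ^ 2 * (1 - Real.cos (u / r)) - u ^ 2 / 2| := by
    nth_rewrite 1 [← abs_of_nonneg (sq_nonneg r)]
    rw [← abs_mul, ← abs_neg]
    congr 1
    field_simp
    ring
  have e2 : r ^ 2 * (|u / r| ^ 4 * (5 / 96)) = |u| ^ 4 * (r⁻¹ ^ 2 * (5 / 96)) := by
    rw [abs_div, abs_of_pos hr]; field_simp
  rw [e1, e2] at h2
  exact h2

/-- Laplace's method: substituting θ = u / √s in the Fourier integral, the integrand converges to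
exp (-u² / 2), and dominated convergence gives a Gaussian integral. -/
lemma tendsto_sqrt_mul_mass_undirected_zero :
    Tendsto (fun s => √s * mass .undirected s 0) atTop (𝓝 ((√(2 * Real.pi))⁻¹)) := by
  have hpi := Real.pi_pos
  set F : ℝ → ℝ → ℝ := fun r u => (Set.Ioc (-Real.pi * r) (Real.pi * r)).indicator
    (fun u => Real.exp (-(r ^ 2 * (1 - Real.cos (u / r))))) u with hF
  have hDCT : Tendsto (fun r => ∫ u, F r u) atTop (𝓝 (∫ u : ℝ, Real.exp (-(1 / 2) * u ^ 2))) := by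
    refine tendsto_integral_filter_of_dominated_convergence
      (fun u => Real.exp (-(2 / Real.pi ^ 2) * u ^ 2)) (.of_forall fun r => ?_) ?_
      (integrable_exp_neg_mul_sq (by positivity)) (.of_forall fun u => ?_)
    · refine (Measurable.indicator ?_ measurableSet_Ioc).aestronglyMeasurable
      fun_prop
    · filter_upwards [eventually_gt_atTop 0] with r hr
      refine .of_forall fun u => ?_
      simp only [hF, Set.indicator]
      split_ifs with hu
      · rw [Real.norm_eq_abs, Real.abs_exp]
        gcongr
        have h1 : |u / r| ≤ Real.pi := by
          rw [abs_div, abs_of_pos hr, div_le_iff₀ hr, abs_le]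
          exact ⟨by linarith [hu.1], hu.2⟩
        -- On [-π, π] one has cos θ ≤ 1 - 2θ² / π², which supplies the Gaussian majorant.
        have h2 := mul_le_mul_of_nonneg_left (Real.cos_le_one_sub_mul_cos_sq h1) (sq_nonneg r)
        have e : r ^ 2 * (1 - 2 / Real.pi ^ 2 * (u / r) ^ 2) = r ^ 2 - 2 / Real.pi ^ 2 * u ^ 2 := by
          field_simp
        rw [e] at h2
        linarith
      · rw [norm_zero]; exact (Real.exp_pos _).le
    · have h1 := ((tendsto_sq_mul_one_sub_cos u).neg.rexp)
      have e : Real.exp (-(u ^ 2 / 2)) = Real.exp (-(1 / 2) * u ^ 2) := by congr 1; ring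
      rw [e] at h1
      refine h1.congr' ?_
      filter_upwards [eventually_gt_atTop 0, eventually_gt_atTop (|u| / Real.pi)] with r hr hur
      rw [div_lt_iff₀ hpi, mul_comm] at hur
      have := abs_lt.1 hur
      simp only [hF]
      rw [Set.indicator_of_mem]
      exact ⟨by linarith [this.1], this.2.le⟩
  rw [integral_gaussian] at hDCT
  have h2 := (hDCT.comp Real.tendsto_sqrt_atTop).const_mul (2 * Real.pi)⁻¹
  have e : (2 * Real.pi)⁻¹ * √(Real.pi / (1 / 2)) = (√(2 * Real.pi))⁻¹ := by
    have h0 : 0 < √(2 * Real.pi) := Real.sqrt_pos.2 (by positivity)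
    rw [show Real.pi / (1 / 2) = 2 * Real.pi by ring]
    nth_rewrite 1 [← Real.sq_sqrt (show 0 ≤ 2 * Real.pi by positivity)]
    field_simp
  rw [e] at h2
  refine h2.congr' ?_
  filter_upwards [eventually_gt_atTop 0] with s hs
  have hr : 0 < √s := Real.sqrt_pos.2 hs
  have e3 : ∫ u, F (√s) u = √s * ∫ θ in -Real.pi..Real.pi, Real.exp (-(s * (1 - Real.cos θ))) := by
    have h := intervalIntegral.integral_comp_div
      (f := fun θ => Real.exp (-(√s ^ 2 * (1 - Real.cos θ)))) (a := -Real.pi * √s)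
      (b := Real.pi * √s) hr.ne'
    rw [mul_div_cancel_right₀ _ hr.ne', mul_div_cancel_right₀ _ hr.ne', smul_eq_mul] at h
    rw [Real.sq_sqrt hs.le] at h
    rw [← h, intervalIntegral.integral_of_le (by nlinarith), ← integral_indicator measurableSet_Ioc]
    simp only [hF, Real.sq_sqrt hs.le]
  simp only [Function.comp_apply]
  rw [e3, ← mass_undirected_zero hs.le]
  field_simp

lemma tendsto_surprisal_undirected_zero_sub :
    Tendsto (fun s => surprisal .undirected s 0 - Real.log (2 * Real.pi * s) / 2) atTop (𝓝 0) := by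
  have hpi := Real.pi_pos
  have h0 : 0 < √(2 * Real.pi) := Real.sqrt_pos.2 (by positivity)
  have h := ((tendsto_sqrt_mul_mass_undirected_zero.log (by positivity)).neg).sub_const
    (Real.log √(2 * Real.pi))
  rw [Real.log_inv, neg_neg, sub_self] at h
  refine h.congr' ?_
  filter_upwards [eventually_gt_atTop 0] with s hs
  have hm : 0 < mass .undirected s 0 := by simpa using mass_natCast_pos .undirected hs 0
  rw [Real.log_mul (Real.sqrt_pos.2 hs).ne' hm.ne', Real.log_sqrt hs.le, Real.log_sqrt
    (by positivity), Real.log_mul (x := 2 * Real.pi) (by positivity) hs.ne', surprisal]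
  ring

/-! ### Behaviour at large times: the simple random walk, ratios of point masses -/

/-- A positive solution of the three-term recursion of the ratios of Bessel functions is
antitone. -/
lemma antitone_of_ratio_rec {u : ℕ → ℝ} {s : ℝ} (hs : 0 < s) (hpos : ∀ n, 0 < u n)
    (hrec : ∀ n : ℕ, u n * (2 * n / s + u (n + 1)) = 1) (hlt : ∀ n, u (n + 1) * u (n + 2) < 1)
    (n : ℕ) : u (n + 1) ≤ u n := by
  -- An increase of u means that 1 / u decreases; by the recursion the term 2n / s, which grows by 2
  -- / s, must then be overcompensated by a drop of the next value.
  have gap : ∀ n, u n < u (n + 1) → 2 / s < u (n + 1) - u (n + 2) := by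
    intro n h
    have h1 := hrec n
    have h2 := hrec (n + 1)
    push_cast at h2
    have hA : 0 < 2 * n / s + u (n + 1) := by have := hpos (n + 1); positivity
    have h3 : 2 * (n + 1) / s + u (n + 2) < 2 * n / s + u (n + 1) := by
      by_contra! h3
      have := mul_lt_mul_of_pos_right h hA
      have := mul_le_mul_of_nonneg_left h3 (hpos (n + 1)).le
      linarith
    have e : 2 * ((n : ℝ) + 1) / s = 2 * n / s + 2 / s := by ring
    linarith
  -- Subtracting consecutive recursions turns the drop into a rise two places later. The product
  -- bound `hlt` keeps the contribution of 2 / s below the drop.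
  have step : ∀ n, u n < u (n + 1) → u (n + 2) < u (n + 3) := by
    intro n h
    have hg := gap n h
    have h2 := hrec (n + 1)
    have h3 := hrec (n + 2)
    push_cast at h2 h3
    set a := u (n + 1)
    set b := u (n + 2)
    set d := u (n + 3)
    have ha : 0 < a := hpos _
    have hb : 0 < b := hpos _
    have e : 2 * ((n : ℝ) + 2) / s = 2 * ((n : ℝ) + 1) / s + 2 / s := by ring
    have h4 : a * b * (d - b) = (a - b) - a * b * (2 / s) := by
      rw [e] at h3
      change b * (2 * (↑n + 1) / s + 2 / s + d) = 1 at h3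
      change a * (2 * (↑n + 1) / s + b) = 1 at h2
      linear_combination a * h3 - b * h2
    have h5 : 0 < a * b * (d - b) := by
      rw [h4]
      have h6 : a * b * (2 / s) ≤ 1 * (2 / s) := by
        have := (hlt n).le
        gcongr
      linarith
    have := pos_of_mul_pos_right h5 (mul_pos ha hb).le
    linarith
  by_contra! h
  have all : ∀ j, u (n + 2 * j) < u (n + 2 * j + 1) := by
    intro j
    induction j with
    | zero => simpa using h
    | succ j ih => exact step _ ih
  -- A violation would thus recur forever, with values above 2 / s, while the recursion forces u n ≤
  -- s / (2n).
  obtain ⟨j, hj⟩ := exists_nat_gt (s ^ 2)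
  have hg := gap _ (all j)
  have hr := hrec (n + 2 * j + 1)
  have p1 := hpos (n + 2 * j + 1)
  have p2 : 0 < u (n + 2 * j + 2) := hpos (n + 2 * j + 2)
  have h1 : 2 / s * (2 * ((n + 2 * j + 1 : ℕ) : ℝ) / s) < 1 := by
    have hq : 0 < 2 * ((n + 2 * j + 1 : ℕ) : ℝ) / s := by positivity
    calc 2 / s * (2 * ((n + 2 * j + 1 : ℕ) : ℝ) / s)
        < u (n + 2 * j + 1) * (2 * ((n + 2 * j + 1 : ℕ) : ℝ) / s) := by
          gcongr
          linarith
      _ ≤ u (n + 2 * j + 1) * (2 * ((n + 2 * j + 1 : ℕ) : ℝ) / s + u (n + 2 * j + 2)) := by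
          gcongr
          linarith
      _ = 1 := hr
  have h2 : 2 / s * (2 * ((n + 2 * j + 1 : ℕ) : ℝ) / s) =
      4 * ((n + 2 * j + 1 : ℕ) : ℝ) / s ^ 2 := by field_simp; ring
  rw [h2, div_lt_one (by positivity)] at h1
  push_cast at h1
  have : (0 : ℝ) ≤ n := by positivity
  have : (0 : ℝ) ≤ j := by positivity
  linarith

lemma stepWeight_undirected_neg (m : ℕ) (x : ℤ) :
    stepWeight .undirected m (-x) = stepWeight .undirected m x := by
  induction m generalizing x with
  | zero => simp [stepWeight]
  | succ m ih =>
    have e1 : -x - 1 = -(x + 1) := by ring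
    have e2 : -x + 1 = -(x - 1) := by ring
    simp only [stepWeight, e1, e2, ih, stepProb, stepProb']
    ring

lemma mass_undirected_neg (s : ℝ) (x : ℤ) : mass .undirected s (-x) = mass .undirected s x := by
  simp only [mass, stepWeight_undirected_neg]

lemma surprisal_undirected_neg (s : ℝ) (x : ℤ) :
    surprisal .undirected s (-x) = surprisal .undirected s x := by
  simp only [surprisal, mass_undirected_neg]

lemma mass_undirected_pos {s : ℝ} (hs : 0 < s) (x : ℤ) : 0 < mass .undirected s x := by
  obtain ⟨m, rfl | rfl⟩ := x.eq_nat_or_neg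
  · exact mass_natCast_pos _ hs m
  · rw [mass_undirected_neg]; exact mass_natCast_pos _ hs m

/-- The increments of the surprisal. -/
def surprisalIncr (s : ℝ) (x : ℤ) : ℝ :=
  surprisal .undirected s (x + 1) - surprisal .undirected s x

/-- The ratio u of consecutive masses is exp (-ρ), with ρ the increment. Monotonicity of the ratios
makes the recursion say m / s ≤ sinh ρ ≤ (m + 1) / s, from which the explicit bounds follow. -/
lemma surprisalIncr_natCast_bounds {s : ℝ} (hs : 0 < s) (m : ℕ) :
    0 ≤ surprisalIncr s m ∧ m / s - m ^ 2 / (2 * s ^ 2) ≤ surprisalIncr s m ∧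
      surprisalIncr s m ≤ (m + 1) / s := by
  set u : ℕ → ℝ := fun n => mass .undirected s n / mass .undirected s (n - 1) with hu
  have hq := mass_undirected_pos hs
  have hpos : ∀ n, 0 < u n := fun n => div_pos (hq _) (hq _)
  have hrec : ∀ n : ℕ, u n * (2 * n / s + u (n + 1)) = 1 := by
    intro n
    have h := mul_mass .undirected s n
    simp only [stepProb, stepProb', Int.cast_natCast] at h
    have e : ((n + 1 : ℕ) : ℤ) - 1 = n := by push_cast; ring
    simp only [hu, e]
    have h1 := (hq n).ne'
    have h2 := (hq (n - 1)).ne'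
    push_cast
    field_simp
    field_simp at h
    linear_combination h
  -- The product telescopes to ν(n + 2) / ν(n), and `mul_mass` at n + 1 shows ν(n) > ν(n + 2).
  have hlt : ∀ n, u (n + 1) * u (n + 2) < 1 := by
    intro n
    have h := mul_mass .undirected s (n + 1)
    simp only [stepProb, stepProb'] at h
    have e1 : ((n + 1 : ℕ) : ℤ) - 1 = n := by push_cast; ring
    have e2 : ((n + 2 : ℕ) : ℤ) - 1 = (n + 1 : ℕ) := by push_cast; ring
    have e3 : (n + 1 : ℤ) + 1 = (n + 2 : ℕ) := by push_cast; ring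
    simp only [hu, e1, e2]
    rw [e3, add_sub_cancel_right] at h
    push_cast at h
    have h1 := hq (n + 1 : ℕ)
    have h2 := hq n
    have h3 := hq (n + 2 : ℕ)
    rw [div_mul_div_cancel₀' h1.ne', div_lt_one h2]
    push_cast at h1 h3 ⊢
    have h4 : 0 < ((n : ℝ) + 1) * mass .undirected s (n + 1) := by positivity
    rw [h, ← mul_sub] at h4
    have h5 := pos_of_mul_pos_right h4 hs.le
    linarith
  have hanti := antitone_of_ratio_rec hs hpos hrec hlt
  have hincr : surprisalIncr s m = -Real.log (u (m + 1)) := by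
    have e : ((m + 1 : ℕ) : ℤ) - 1 = m := by push_cast; ring
    simp only [hu, e]
    rw [Real.log_div (hq _).ne' (hq _).ne', surprisalIncr, surprisal, surprisal]
    push_cast
    ring
  have hp := hpos (m + 1)
  have hm : (0 : ℝ) ≤ m := by positivity
  set y := (m : ℝ) / s with hy
  have hy0 : 0 ≤ y := by positivity
  have h1 : u (m + 1) * (2 * y + u (m + 1)) ≤ 1 := by
    have h := hrec m
    have : 0 < 2 * (m : ℝ) / s + u (m + 1) := by positivity
    have h2 := mul_le_mul_of_nonneg_right (hanti m) this.le
    rw [hy, ← mul_div_assoc]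
    linarith
  rw [hincr]
  refine ⟨?_, ?_, ?_⟩
  · have h2 : u (m + 1) ≤ 1 := by nlinarith [mul_nonneg hp.le hy0]
    linarith [Real.log_nonpos hp.le h2]
  -- Hence ρ ≥ log(1 + y) ≥ 2y / (y + 2) ≥ y - y² / 2.
  · have h2 : u (m + 1) ≤ (1 + y)⁻¹ := by
      by_contra! h3
      have e1 : (1 + y)⁻¹ * (1 + y) = 1 := inv_mul_cancel₀ (by positivity)
      have h4 : 1 < u (m + 1) * (1 + y) := by
        have := mul_lt_mul_of_pos_right h3 (show 0 < 1 + y by positivity)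
        rwa [e1] at this
      have h5 : y * (1 + y) ≤ y * (1 + y) * (u (m + 1) * (1 + y)) :=
        le_mul_of_one_le_right (by positivity) h4.le
      have h6 : 1 < (u (m + 1) * (1 + y)) ^ 2 := one_lt_pow₀ h4 two_ne_zero
      have h7 := mul_le_mul_of_nonneg_right h1 (sq_nonneg (1 + y))
      nlinarith
    have h3 := Real.log_le_log hp h2
    rw [Real.log_inv] at h3
    have h4 := Real.le_log_one_add_of_nonneg hy0
    have h5 : y - y ^ 2 / 2 ≤ 2 * y / (y + 2) := by
      rw [le_div_iff₀ (by positivity)]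
      nlinarith [pow_nonneg hy0 3]
    have h6 : (m : ℝ) ^ 2 / (2 * s ^ 2) = y ^ 2 / 2 := by rw [hy]; field_simp
    rw [h6]
    linarith
  · set y := ((m : ℝ) + 1) / s with hy
    have h1 : 1 ≤ u (m + 1) * (2 * y + u (m + 1)) := by
      have h := hrec (m + 1)
      have h2 := mul_le_mul_of_nonneg_left (hanti (m + 1)) hp.le
      push_cast at h
      rw [hy, ← mul_div_assoc]
      linarith
    by_contra! h2
    have hy0 : 0 < y := by positivity
    set ρ := -Real.log (u (m + 1)) with hρ
    have hu1 : u (m + 1) = Real.exp (-ρ) := by rw [hρ, neg_neg, Real.exp_log hp]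
    rw [hu1] at h1
    have h3 : ρ ≤ Real.sinh ρ := Real.self_le_sinh_iff.2 (by linarith)
    rw [Real.sinh_eq] at h3
    have h4 := mul_le_mul_of_nonneg_left h1 (Real.exp_pos ρ).le
    have h5 : Real.exp ρ * Real.exp (-ρ) = 1 := by rw [← Real.exp_add]; simp
    have h6 : Real.exp ρ ≤ 2 * y + Real.exp (-ρ) := by
      calc Real.exp ρ = Real.exp ρ * 1 := (mul_one _).symm
        _ ≤ _ := h4
        _ = 2 * y + Real.exp (-ρ) := by linear_combination (2 * y + Real.exp (-ρ)) * h5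
    linarith

lemma abs_surprisal_natCast_sub_le {s : ℝ} (hs : 0 < s) (m : ℕ) :
    |surprisal .undirected s m - surprisal .undirected s 0 - (m : ℝ) ^ 2 / (2 * s)| ≤
      m / (2 * s) + (m : ℝ) ^ 3 / (2 * s ^ 2) := by
  induction m with
  | zero => simp
  | succ m ih =>
    obtain ⟨h0, h1, h2⟩ := surprisalIncr_natCast_bounds hs m
    have e : surprisal .undirected s ((m + 1 : ℕ) : ℤ) =
        surprisal .undirected s m + surprisalIncr s m := by
      rw [surprisalIncr]; push_cast; ring
    rw [e]
    have hm : (0 : ℝ) ≤ m := by positivity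
    push_cast
    rw [abs_le] at ih ⊢
    have e1 : ((m : ℝ) + 1) ^ 2 / (2 * s) = (m : ℝ) ^ 2 / (2 * s) + m / s + 1 / (2 * s) := by
      field_simp; ring
    have e2 : ((m : ℝ) + 1) / (2 * s) = m / (2 * s) + 1 / (2 * s) := by ring
    have e3 : ((m : ℝ) + 1) ^ 3 / (2 * s ^ 2) =
        (m : ℝ) ^ 3 / (2 * s ^ 2) + m ^ 2 / (2 * s ^ 2) + (2 * m ^ 2 + 3 * m + 1) / (2 * s ^ 2) := by
      field_simp; ring
    have e4 : ((m : ℝ) + 1) / s = m / s + 1 / (2 * s) + 1 / (2 * s) := by field_simp; ring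
    have p1 : 0 ≤ (2 * (m : ℝ) ^ 2 + 3 * m + 1) / (2 * s ^ 2) := by positivity
    have p2 : 0 ≤ (m : ℝ) ^ 2 / (2 * s ^ 2) := by positivity
    rw [e1, e2, e3]
    rw [e4] at h2
    constructor <;> linarith

lemma abs_surprisal_undirected_sub_le {s : ℝ} (hs : 0 < s) (x : ℤ) :
    |surprisal .undirected s x - surprisal .undirected s 0 - (x : ℝ) ^ 2 / (2 * s)| ≤
      |(x : ℝ)| / (2 * s) + |(x : ℝ)| ^ 3 / (2 * s ^ 2) := by
  obtain ⟨m, rfl | rfl⟩ := x.eq_nat_or_neg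
  · simpa using abs_surprisal_natCast_sub_le hs m
  · rw [surprisal_undirected_neg]
    simpa using abs_surprisal_natCast_sub_le hs m

lemma drift_undirected : drift .undirected = 0 := by norm_num [drift, stepProb, stepProb']

/-- The value at 0 is given by the return probability and the rest by summing the increments; the
second and sixth moments control the summed error. -/
lemma tendsto_surprisalError_undirected :
    Tendsto (fun s => expect .undirected s (fun x => surprisalError .undirected s x ^ 2)) atTop
      (𝓝 0) := by
  have hlim : Tendsto (fun s => 3 * (surprisal .undirected s 0 -
      Real.log (2 * Real.pi * s) / 2) ^ 2 + (s⁻¹ + (15 * s⁻¹ + 25 * s⁻¹ ^ 2 + s⁻¹ ^ 3))) atTop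
      (𝓝 0) := by
    have h := tendsto_inv_atTop_zero (𝕜 := ℝ)
    have := ((tendsto_surprisal_undirected_zero_sub.pow 2).const_mul 3).add
      (h.add (((h.const_mul 15).add ((h.pow 2).const_mul 25)).add (h.pow 3)))
    simpa using this
  refine squeeze_zero' ?_ ?_ hlim
  · filter_upwards [eventually_gt_atTop 0] with s hs
    exact expect_nonneg _ hs.le fun x => sq_nonneg _
  filter_upwards [eventually_gt_atTop 0] with s hs
  have hp := polyGrowth_surprisalError .undirected hs
  set δ := surprisal .undirected s 0 - Real.log (2 * Real.pi * s) / 2 with hδ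
  set y : ℤ → ℝ := fun x => x - drift .undirected * s with hy
  have hyp : PolyGrowth y := by fun_prop
  have m2 : expect .undirected s (fun x => y x ^ 2) = s := centralMoment_two _ hs.le
  have m6 : expect .undirected s (fun x => y x ^ 6) ≤ 15 * s ^ 3 + 25 * s ^ 2 + s :=
    centralMoment_six_le _ hs.le
  have hle : expect .undirected s (fun x => surprisalError .undirected s x ^ 2) ≤
      expect .undirected s (fun x => 3 * δ ^ 2 + s⁻¹ ^ 2 * y x ^ 2 + s⁻¹ ^ 4 * y x ^ 6) := by
    refine expect_mono _ hs.le (by fun_prop) (by fun_prop) fun x => ?_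
    have hyx : y x = x := by simp [hy, drift_undirected]
    rw [hyx]
    have h := abs_surprisal_undirected_sub_le hs x
    have e : surprisalError .undirected s x = δ +
        (surprisal .undirected s x - surprisal .undirected s 0 - (x : ℝ) ^ 2 / (2 * s)) := by
      rw [surprisalError, hδ, drift_undirected]; ring
    rw [e]
    set A := surprisal .undirected s x - surprisal .undirected s 0 - (x : ℝ) ^ 2 / (2 * s)
    have h1 : |A| ^ 2 ≤ (|(x : ℝ)| / (2 * s) + |(x : ℝ)| ^ 3 / (2 * s ^ 2)) ^ 2 := by gcongr
    rw [sq_abs] at h1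
    have e1 : (|(x : ℝ)| / (2 * s)) ^ 2 = s⁻¹ ^ 2 * (x : ℝ) ^ 2 / 4 := by
      rw [div_pow, sq_abs]; field_simp; norm_num
    have e2 : (|(x : ℝ)| ^ 3 / (2 * s ^ 2)) ^ 2 = s⁻¹ ^ 4 * (x : ℝ) ^ 6 / 4 := by
      rw [div_pow, ← pow_mul, show 3 * 2 = 6 by norm_num, Even.pow_abs (by decide)]
      field_simp; norm_num
    set P := |(x : ℝ)| / (2 * s)
    set R := |(x : ℝ)| ^ 3 / (2 * s ^ 2)
    nlinarith [sq_nonneg (P - R), sq_nonneg (2 * A - δ), sq_nonneg δ]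
  refine hle.trans ?_
  rw [expect_add _ hs.le (by fun_prop) (by fun_prop), expect_add _ hs.le (by fun_prop)
    (by fun_prop), expect_const _ hs.le, expect_const_mul, expect_const_mul, m2, add_assoc]
  gcongr
  · exact le_of_eq (by field_simp)
  · calc _ ≤ s⁻¹ ^ 4 * (15 * s ^ 3 + 25 * s ^ 2 + s) := by gcongr
      _ = _ := by field_simp

lemma surprisalIncr_neg (s : ℝ) (x : ℤ) : surprisalIncr s (-1 - x) = -surprisalIncr s x := by
  have e1 : -1 - x + 1 = -x := by ring
  have e2 : -1 - x = -(x + 1) := by ring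
  rw [surprisalIncr, surprisalIncr, e1, e2, surprisal_undirected_neg, surprisal_undirected_neg]
  ring

/-- The comparison term is the increment of x² / (2s). It is odd under x ↦ -1 - x, as is the
surprisal increment, so natural x suffice. -/
lemma abs_surprisalIncr_sub_le {s : ℝ} (hs : 0 < s) (x : ℤ) :
    |surprisalIncr s x - (x + 1 / 2) / s| ≤ 1 / (2 * s) + (x : ℝ) ^ 2 / (2 * s ^ 2) ∧
      |surprisalIncr s x| ≤ (|(x : ℝ)| + 1) / s := by
  have nat : ∀ m : ℕ, |surprisalIncr s m - (m + 1 / 2) / s| ≤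
      1 / (2 * s) + (m : ℝ) ^ 2 / (2 * s ^ 2) ∧ |surprisalIncr s m| ≤ (m + 1) / s := by
    intro m
    obtain ⟨h0, h1, h2⟩ := surprisalIncr_natCast_bounds hs m
    have e1 : ((m : ℝ) + 1 / 2) / s = m / s + 1 / (2 * s) := by field_simp
    have e2 : ((m : ℝ) + 1) / s = m / s + 1 / (2 * s) + 1 / (2 * s) := by field_simp; ring
    have p1 : 0 ≤ (m : ℝ) ^ 2 / (2 * s ^ 2) := by positivity
    have p2 : 0 ≤ (m : ℝ) / s := by positivity
    have p3 : 0 ≤ 1 / (2 * s) := by positivity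
    rw [abs_le, abs_of_nonneg h0]
    rw [e2] at h2
    refine ⟨⟨?_, ?_⟩, ?_⟩
    · rw [e1]; linarith
    · rw [e1]; linarith
    · rw [e2]; exact h2
  rcases le_or_gt 0 x with hx | hx
  · lift x to ℕ using hx
    simpa using nat x
  · obtain ⟨m, rfl⟩ : ∃ m : ℕ, x = -1 - m := ⟨(-1 - x).toNat, by omega⟩
    obtain ⟨h1, h2⟩ := nat m
    have hm : (0 : ℝ) ≤ m := by positivity
    rw [surprisalIncr_neg, abs_neg]
    push_cast
    have e1 : -surprisalIncr s m - (-1 - (m : ℝ) + 1 / 2) / s =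
        -(surprisalIncr s m - (m + 1 / 2) / s) := by ring
    have e2 : |-1 - (m : ℝ)| = m + 1 := by rw [abs_of_nonpos (by linarith)]; ring
    rw [e1, abs_neg, e2]
    refine ⟨h1.trans ?_, h2.trans ?_⟩
    · refine add_le_add le_rfl (div_le_div_of_nonneg_right ?_ (by positivity))
      nlinarith
    · gcongr
      linarith

lemma abs_mass_sub_le {s : ℝ} (hs : 0 < s) (x : ℤ) :
    |mass .undirected s x - mass .undirected s (x + 1)| ≤
      (mass .undirected s x + mass .undirected s (x + 1)) * |surprisalIncr s x| := by
  have p1 := mass_undirected_pos hs x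
  have p2 := mass_undirected_pos hs (x + 1)
  have h1 := sub_le_mul_log_sub p1 p2
  have h2 := sub_le_mul_log_sub p2 p1
  have i1 := le_abs_self (surprisalIncr s x)
  have i2 := neg_abs_le (surprisalIncr s x)
  have j1 := mul_le_mul_of_nonneg_left i1 p1.le
  have j2 := mul_le_mul_of_nonneg_left i2 p2.le
  have j3 := mul_nonneg p1.le (abs_nonneg (surprisalIncr s x))
  have j4 := mul_nonneg p2.le (abs_nonneg (surprisalIncr s x))
  have e1 : mass .undirected s x * (-Real.log (mass .undirected s (x + 1)) -
      -Real.log (mass .undirected s x)) = mass .undirected s x * surprisalIncr s x := rfl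
  have e2 : mass .undirected s (x + 1) * (-Real.log (mass .undirected s x) -
      -Real.log (mass .undirected s (x + 1))) =
      -(mass .undirected s (x + 1) * surprisalIncr s x) := by
    simp only [surprisalIncr, surprisal]; ring
  rw [abs_le]
  constructor <;> linarith

/-- H' is half the expected second difference of the surprisal, whose Gaussian part is 1 / s. The
error ε of a first difference is bounded only to order 1 / s, so it is not estimated directly.
Summation by parts puts the difference on the masses, which gains a factor of order s ^ (-1/2)
through `abs_mass_sub_le`. -/
lemma tendsto_mul_entropyDeriv_undirected :
    Tendsto (fun s => s * entropyDeriv .undirected s) atTop (𝓝 (1 / 2)) := by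
  rw [tendsto_iff_norm_sub_tendsto_zero]
  have hlim : Tendsto (fun s : ℝ => 26 * (√s)⁻¹) atTop (𝓝 0) := by
    have := (tendsto_inv_atTop_zero.comp Real.tendsto_sqrt_atTop).const_mul (26 : ℝ)
    simpa using this
  refine squeeze_zero' (.of_forall fun s => norm_nonneg _) ?_ hlim
  filter_upwards [eventually_ge_atTop 1] with s hs1
  have hs : 0 < s := by linarith
  have hp := polyGrowth_surprisal .undirected hs
  set ε : ℤ → ℝ := fun x => surprisalIncr s x - (x + 1 / 2) / s with hε
  have hεp : PolyGrowth ε := by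
    have : PolyGrowth fun x => surprisalIncr s x := hp.comp_add_one.sub hp
    fun_prop
  have hεp1 := hεp.comp_sub_one
  have e1 : entropyDeriv .undirected s - 1 / (2 * s) =
      1 / 2 * (expect .undirected s ε - expect .undirected s (fun x => ε (x - 1))) := by
    rw [← expect_sub _ hs.le hεp hεp1, ← expect_const_mul, ← expect_const .undirected hs.le
      (1 / (2 * s)), entropyDeriv, ← expect_sub _ hs.le (((PolyGrowth.const _).mul
        hp.comp_add_one |>.add ((PolyGrowth.const _).mul hp.comp_sub_one)).sub hp) (.const _)]
    congr 1; ext x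
    simp only [hε, surprisalIncr, stepProb, stepProb', sub_add_cancel]
    push_cast
    field_simp
    ring
  have s1 := hεp.summable_mass_mul .undirected hs.le
  have s2 := summable_mass_add_one_mul .undirected hs.le hεp
  have e2 : expect .undirected s ε - expect .undirected s (fun x => ε (x - 1)) =
      ∑' x, (mass .undirected s x - mass .undirected s (x + 1)) * ε x := by
    rw [← tsum_mass_add_one_mul, expect, ← s1.tsum_sub s2]
    congr 1; ext x; ring
  set G : ℤ → ℝ := fun x => (|(x : ℝ)| + 1) / s * (1 / (2 * s) + (x : ℝ) ^ 2 / (2 * s ^ 2)) with hG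
  have hGp : PolyGrowth G := by fun_prop
  have hGp1 := hGp.comp_sub_one
  have t1 := hGp.summable_mass_mul .undirected hs.le
  have t2 := summable_mass_add_one_mul .undirected hs.le hGp
  have e3 : |∑' x, (mass .undirected s x - mass .undirected s (x + 1)) * ε x| ≤
      expect .undirected s G + expect .undirected s (fun x => G (x - 1)) := by
    rw [← tsum_mass_add_one_mul, expect, ← t1.tsum_add t2, ← Real.norm_eq_abs]
    refine tsum_of_norm_bounded (t1.add t2).hasSum fun x => ?_
    rw [norm_mul, Real.norm_eq_abs, Real.norm_eq_abs, ← add_mul]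
    obtain ⟨b1, b2⟩ := abs_surprisalIncr_sub_le hs x
    have p1 := mass_undirected_pos hs x
    have p2 := mass_undirected_pos hs (x + 1)
    calc _ ≤ (mass .undirected s x + mass .undirected s (x + 1)) * |surprisalIncr s x| *
          (1 / (2 * s) + (x : ℝ) ^ 2 / (2 * s ^ 2)) := by
          gcongr
          exact abs_mass_sub_le hs x
      _ ≤ (mass .undirected s x + mass .undirected s (x + 1)) * ((|(x : ℝ)| + 1) / s) *
          (1 / (2 * s) + (x : ℝ) ^ 2 / (2 * s ^ 2)) := by gcongr
      _ = _ := by simp only [hG]; ring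
  have hr : 0 < √s := Real.sqrt_pos.2 hs
  have hss : √s ^ 2 = s := Real.sq_sqrt hs.le
  set r := √s
  have hr1 : 1 ≤ r := by
    by_contra! h
    nlinarith
  have bd : ∀ x : ℤ, G x + G (x - 1) ≤ 1 / s ^ 2 * (9 * r + (3 * r⁻¹ + 6 * r / s) * (x : ℝ) ^ 2 +
      2 * r⁻¹ / s * (x : ℝ) ^ 4) := by
    intro x
    have ha := abs_nonneg (x : ℝ)
    have h1 : |(x : ℝ)| + 2 ≤ r⁻¹ * (x : ℝ) ^ 2 + 3 * r := by
      have h := sq_nonneg (r - |(x : ℝ)|)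
      have : r⁻¹ * (x : ℝ) ^ 2 + 3 * r - (|(x : ℝ)| + 2) =
          r⁻¹ * ((r - |(x : ℝ)|) ^ 2) + |(x : ℝ)| + 2 * (r - 1) := by
        rw [← sq_abs]; field_simp; ring
      have h2 : 0 ≤ r⁻¹ * ((r - |(x : ℝ)|) ^ 2) := by positivity
      linarith
    have g1 : G x ≤ (|(x : ℝ)| + 2) / s * (1 / (2 * s) + (2 * (x : ℝ) ^ 2 + 2) / (2 * s ^ 2)) := by
      simp only [hG]
      gcongr
      · norm_num
      · nlinarith [sq_nonneg (x : ℝ)]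
    have g2 : G (x - 1) ≤
        (|(x : ℝ)| + 2) / s * (1 / (2 * s) + (2 * (x : ℝ) ^ 2 + 2) / (2 * s ^ 2)) := by
      simp only [hG]
      push_cast
      have : |(x : ℝ) - 1| ≤ |(x : ℝ)| + 1 := (abs_sub _ _).trans (by simp)
      have h2 : ((x : ℝ) - 1) ^ 2 ≤ 2 * (x : ℝ) ^ 2 + 2 := by nlinarith [sq_nonneg ((x : ℝ) + 1)]
      refine mul_le_mul (div_le_div_of_nonneg_right (by linarith) hs.le) (add_le_add le_rfl
        (div_le_div_of_nonneg_right h2 (by positivity))) (by positivity) (by positivity)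
    have g3 : 1 / (2 * s) + (2 * (x : ℝ) ^ 2 + 2) / (2 * s ^ 2) ≤
        (3 + 2 * (x : ℝ) ^ 2 / s) / (2 * s) := by
      have : 1 / s ≤ 1 := by rw [div_le_one hs]; exact hs1
      have e : 1 / (2 * s) + (2 * (x : ℝ) ^ 2 + 2) / (2 * s ^ 2) =
          (1 + 2 * (1 / s) + 2 * (x : ℝ) ^ 2 / s) / (2 * s) := by field_simp; ring
      rw [e]
      gcongr
      linarith
    calc G x + G (x - 1) ≤ 2 * ((|(x : ℝ)| + 2) / s *
          (1 / (2 * s) + (2 * (x : ℝ) ^ 2 + 2) / (2 * s ^ 2))) := by linarith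
      _ ≤ 2 * ((r⁻¹ * (x : ℝ) ^ 2 + 3 * r) / s * ((3 + 2 * (x : ℝ) ^ 2 / s) / (2 * s))) := by
        gcongr
      _ = _ := by field_simp; ring
  have m2 : expect .undirected s (fun x => (x : ℝ) ^ 2) = s := by
    have := centralMoment_two .undirected hs.le
    simpa [centralMoment, drift_undirected] using this
  have m4 : expect .undirected s (fun x => (x : ℝ) ^ 4) = 3 * s ^ 2 + s := by
    have := centralMoment_four .undirected hs.le
    simpa [centralMoment, drift_undirected] using this
  have e4 : expect .undirected s G + expect .undirected s (fun x => G (x - 1)) ≤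
      1 / s ^ 2 * (9 * r + (3 * r⁻¹ + 6 * r / s) * s + 2 * r⁻¹ / s * (3 * s ^ 2 + s)) := by
    rw [← expect_add _ hs.le hGp hGp1]
    refine (expect_mono _ hs.le (hGp.add hGp1) (by fun_prop) bd).trans_eq ?_
    rw [expect_const_mul, expect_add _ hs.le (by fun_prop) (by fun_prop),
      expect_add _ hs.le (by fun_prop) (by fun_prop), expect_const _ hs.le, expect_const_mul,
      expect_const_mul, m2, m4]
  have e5 : s * entropyDeriv .undirected s - 1 / 2 =
      s / 2 * ∑' x, (mass .undirected s x - mass .undirected s (x + 1)) * ε x := by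
    rw [← e2]
    have : s * (entropyDeriv .undirected s - 1 / (2 * s)) =
        s * entropyDeriv .undirected s - 1 / 2 := by field_simp
    rw [← this, e1]
    ring
  rw [e5, Real.norm_eq_abs, abs_mul, abs_of_pos (by positivity)]
  calc _ ≤ s / 2 * (1 / s ^ 2 * (9 * r + (3 * r⁻¹ + 6 * r / s) * s +
        2 * r⁻¹ / s * (3 * s ^ 2 + s))) := by
        gcongr
        exact e3.trans e4
    _ = 12 * r⁻¹ + r⁻¹ ^ 3 := by
        rw [← hss]; field_simp; ring
    _ ≤ 26 * r⁻¹ := by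
        have h1 : r⁻¹ ≤ 1 := inv_le_one_of_one_le₀ hr1
        have h2 : 0 < r⁻¹ := by positivity
        have h3 : r⁻¹ ^ 3 ≤ r⁻¹ := by
          calc r⁻¹ ^ 3 ≤ r⁻¹ ^ 1 := pow_le_pow_of_le_one h2.le h1 (by norm_num)
            _ = r⁻¹ := pow_one _
        linarith

/-! ### Behaviour at large times: summary -/

lemma tendsto_surprisalError (c : WalkCase) :
    Tendsto (fun s => expect c s (fun x => surprisalError c s x ^ 2)) atTop (𝓝 0) := by
  cases c
  · exact tendsto_surprisalError_directed
  · exact tendsto_surprisalError_undirected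

lemma tendsto_mul_entropyDeriv (c : WalkCase) :
    Tendsto (fun s => s * entropyDeriv c s) atTop (𝓝 (1 / 2)) := by
  cases c
  · exact tendsto_mul_entropyDeriv_directed
  · exact tendsto_mul_entropyDeriv_undirected

lemma tendsto_entropyFn_sub_log (c : WalkCase) :
    Tendsto (fun s => entropyFn c s - Real.log (2 * Real.pi * Real.exp 1 * s) / 2) atTop (𝓝 0) :=
  tendsto_entropyFn_sub_log_of_error (tendsto_surprisalError c)

lemma tendsto_varFn (c : WalkCase) : Tendsto (varFn c) atTop (𝓝 (1 / 2)) :=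
  tendsto_varFn_of_error (tendsto_surprisalError c)

/-! ### The inverse of the entropy -/

lemma strictMonoOn_entropyFn (c : WalkCase) : StrictMonoOn (entropyFn c) (Set.Ici 0) := by
  refine strictMonoOn_of_deriv_pos (convex_Ici 0) (continuousOn_entropyFn c) fun s hs => ?_
  rw [interior_Ici] at hs
  rw [(hasDerivAt_entropyFn c hs).deriv]
  exact entropyDeriv_pos c hs

lemma tendsto_entropyFn_atTop (c : WalkCase) : Tendsto (entropyFn c) atTop atTop := by
  have h1 : Tendsto (fun s : ℝ => Real.log (2 * Real.pi * Real.exp 1 * s) / 2) atTop atTop := by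
    refine (Real.tendsto_log_atTop.comp ?_).atTop_div_const two_pos
    exact tendsto_id.const_mul_atTop (by positivity)
  refine ((tendsto_entropyFn_sub_log c).add_atTop h1).congr fun s => ?_
  ring

lemma exists_entropyFn_eq (c : WalkCase) {h : ℝ} (hh : 0 ≤ h) :
    ∃ s ∈ Set.Ici (0 : ℝ), entropyFn c s = h := by
  obtain ⟨b, hb1, hb2⟩ := (((tendsto_entropyFn_atTop c).eventually_ge_atTop h).and
    (eventually_ge_atTop 0)).exists
  obtain ⟨s, hs, hs'⟩ := intermediate_value_Icc hb2
    ((continuousOn_entropyFn c).mono Set.Icc_subset_Ici_self)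
    (show h ∈ Set.Icc _ _ from ⟨by rwa [entropyFn_zero], hb1⟩)
  exact ⟨s, hs.1, hs'⟩

/-- The inverse of the entropy. -/
def entropyInv (c : WalkCase) (h : ℝ) : ℝ := Function.invFunOn (entropyFn c) (Set.Ici 0) h

lemma entropyInv_nonneg (c : WalkCase) {h : ℝ} (hh : 0 ≤ h) : 0 ≤ entropyInv c h :=
  Function.invFunOn_mem (exists_entropyFn_eq c hh)

lemma entropyFn_entropyInv (c : WalkCase) {h : ℝ} (hh : 0 ≤ h) :
    entropyFn c (entropyInv c h) = h :=
  Function.invFunOn_eq (exists_entropyFn_eq c hh)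

lemma eq_entropyInv_iff (c : WalkCase) {s h : ℝ} (hs : 0 ≤ s) (hh : 0 ≤ h) :
    s = entropyInv c h ↔ entropyFn c s = h := by
  refine ⟨fun e => e ▸ entropyFn_entropyInv c hh, fun e => ?_⟩
  exact (strictMonoOn_entropyFn c).injOn hs (entropyInv_nonneg c hh)
    (e.trans (entropyFn_entropyInv c hh).symm)

lemma entropyInv_entropyFn (c : WalkCase) {s : ℝ} (hs : 0 ≤ s) :
    entropyInv c (entropyFn c s) = s :=
  ((eq_entropyInv_iff c hs (entropyFn_nonneg c hs)).2 rfl).symm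

lemma entropyFn_pos (c : WalkCase) {s : ℝ} (hs : 0 < s) : 0 < entropyFn c s := by
  rw [← entropyFn_zero c]
  exact strictMonoOn_entropyFn c Set.self_mem_Ici hs.le hs

lemma entropyInv_lt_entropyInv (c : WalkCase) {a b : ℝ} (ha : 0 ≤ a) (hab : a < b) :
    entropyInv c a < entropyInv c b := by
  have hb : 0 ≤ b := ha.trans hab.le
  refine ((strictMonoOn_entropyFn c).lt_iff_lt (entropyInv_nonneg c ha)
    (entropyInv_nonneg c hb)).1 ?_
  rwa [entropyFn_entropyInv c ha, entropyFn_entropyInv c hb]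

lemma entropyInv_pos (c : WalkCase) {h : ℝ} (hh : 0 < h) : 0 < entropyInv c h :=
  (entropyInv_nonneg c le_rfl).trans_lt (entropyInv_lt_entropyInv c le_rfl hh)

lemma continuousAt_entropyInv (c : WalkCase) {h : ℝ} (hh : 0 < h) :
    ContinuousAt (entropyInv c) h := by
  have hm : StrictMonoOn (entropyInv c) (Set.Ioi 0) :=
    fun a ha b _ hab => entropyInv_lt_entropyInv c (le_of_lt ha) hab
  refine hm.continuousAt_of_image_mem_nhds (Ioi_mem_nhds hh) ?_
  refine mem_of_superset (Ioi_mem_nhds (entropyInv_pos c hh)) fun s hs => ?_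
  have hs : 0 < s := hs
  exact ⟨entropyFn c s, entropyFn_pos c hs, entropyInv_entropyFn c hs.le⟩

lemma tendsto_entropyInv_zero (c : WalkCase) : Tendsto (entropyInv c) (𝓝[>] 0) (𝓝[>] 0) := by
  refine tendsto_nhdsWithin_iff.2 ⟨?_, ?_⟩
  · refine tendsto_order.2 ⟨fun a ha => ?_, fun a ha => ?_⟩
    · filter_upwards [self_mem_nhdsWithin] with h hh
      exact ha.trans (entropyInv_pos c hh)
    · filter_upwards [Ioo_mem_nhdsGT (entropyFn_pos c ha)] with h hh
      have := entropyInv_lt_entropyInv c hh.1.le hh.2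
      rwa [entropyInv_entropyFn c ha.le] at this
  · filter_upwards [self_mem_nhdsWithin] with h hh
    exact entropyInv_pos c hh

lemma tendsto_entropyInv_atTop (c : WalkCase) : Tendsto (entropyInv c) atTop atTop := by
  refine tendsto_atTop.2 fun b => ?_
  have hb : 0 ≤ max b 0 := le_max_right _ _
  filter_upwards [eventually_gt_atTop (entropyFn c (max b 0))] with h hh
  have := entropyInv_lt_entropyInv c (entropyFn_nonneg c hb) hh
  rw [entropyInv_entropyFn c hb] at this
  exact (le_max_left _ _).trans this.le

/-! ### Asymptotics of the inverse of the entropy -/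

/-- L'Hôpital's rule for H + s log s over s; the derivative of s log s adds the extra 1. -/
lemma tendsto_entropyFn_div_add_log (c : WalkCase) :
    Tendsto (fun s => entropyFn c s / s + Real.log s) (𝓝[>] 0) (𝓝 (stepEntropy c + 1)) := by
  have h0 : Tendsto (fun s => entropyFn c s + s * Real.log s) (𝓝[>] 0) (𝓝 0) := by
    have h1 : Tendsto (entropyFn c) (𝓝[>] 0) (𝓝 0) := by
      have := (continuousOn_entropyFn c 0 Set.self_mem_Ici).mono Set.Ioi_subset_Ici_self
      rwa [ContinuousWithinAt, entropyFn_zero] at this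
    have h2 : Tendsto (fun s : ℝ => s * Real.log s) (𝓝[>] 0) (𝓝 0) := by
      have := Real.continuous_mul_log.continuousAt (x := 0)
      rw [ContinuousAt, zero_mul] at this
      exact this.mono_left nhdsWithin_le_nhds
    simpa using h1.add h2
  have hd : Tendsto (fun s => (entropyDeriv c s + (Real.log s + 1)) / 1) (𝓝[>] 0)
      (𝓝 (stepEntropy c + 1)) := by
    simp only [div_one, ← add_assoc]
    exact (tendsto_entropyDeriv_add_log c).add_const 1
  have key := HasDerivAt.lhopital_zero_nhdsGT (f := fun s => entropyFn c s + s * Real.log s)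
    (g := fun s => s) (f' := fun s => entropyDeriv c s + (Real.log s + 1)) (g' := fun _ => 1)
    ?_ ?_ (.of_forall fun _ => one_ne_zero) h0 (tendsto_id.mono_left nhdsWithin_le_nhds) hd
  · refine key.congr' ?_
    filter_upwards [self_mem_nhdsWithin] with s hs
    have : (s : ℝ) ≠ 0 := (show (0 : ℝ) < s from hs).ne'
    field_simp
  · filter_upwards [self_mem_nhdsWithin] with s hs
    exact (hasDerivAt_entropyFn c hs).add
      (Real.hasDerivAt_mul_log (show (0 : ℝ) < s from hs).ne')
  · exact .of_forall fun s => hasDerivAt_id s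

lemma tendsto_neg_log_zero : Tendsto (fun s : ℝ => -Real.log s) (𝓝[>] 0) atTop :=
  tendsto_neg_atBot_atTop.comp Real.tendsto_log_nhdsGT_zero

/-- If `f + log` converges at `0` then `f` is asymptotic to `-log`. -/
lemma tendsto_div_neg_log {f : ℝ → ℝ} {a : ℝ}
    (h : Tendsto (fun s => f s + Real.log s) (𝓝[>] 0) (𝓝 a)) :
    Tendsto (fun s => f s / -Real.log s) (𝓝[>] 0) (𝓝 1) := by
  have h1 := (h.div_atTop tendsto_neg_log_zero).add_const 1
  rw [zero_add] at h1
  refine h1.congr' ?_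
  filter_upwards [tendsto_neg_log_zero.eventually_gt_atTop 0] with s hs
  have : Real.log s ≠ 0 := (neg_pos.1 hs).ne
  field_simp
  ring

lemma tendsto_entropyFn_div_mul_neg_log (c : WalkCase) :
    Tendsto (fun s => entropyFn c s / (s * -Real.log s)) (𝓝[>] 0) (𝓝 1) := by
  refine (tendsto_div_neg_log (tendsto_entropyFn_div_add_log c)).congr fun s => ?_
  rw [div_div]

lemma tendsto_log_entropyFn_div_log (c : WalkCase) :
    Tendsto (fun s => -Real.log (entropyFn c s) / -Real.log s) (𝓝[>] 0) (𝓝 1) := by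
  have h1 := (tendsto_entropyFn_div_mul_neg_log c).log one_ne_zero
  rw [Real.log_one] at h1
  have h2 := h1.div_atTop tendsto_neg_log_zero
  have h3 : Tendsto (fun u : ℝ => Real.log u / u) atTop (𝓝 0) :=
    Real.isLittleO_log_id_atTop.tendsto_div_nhds_zero
  have h4 := (h3.comp tendsto_neg_log_zero)
  have h5 := ((tendsto_const_nhds (x := (1 : ℝ))).sub h4).sub h2
  norm_num at h5
  refine h5.congr' ?_
  filter_upwards [tendsto_neg_log_zero.eventually_gt_atTop 0, self_mem_nhdsWithin] with s hs hs0
  have hs0 : 0 < s := hs0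
  have hl : Real.log s < 0 := neg_pos.1 hs
  have hl' := hl.ne
  have hH := entropyFn_pos c hs0
  have e : -(s * Real.log s) = s * -Real.log s := by ring
  rw [← neg_div_neg_eq, neg_neg]
  rw [Real.log_div hH.ne' (neg_ne_zero.2 (mul_ne_zero hs0.ne' hl.ne)), e,
    Real.log_mul hs0.ne' hs.ne']
  simp only [Real.log_neg_eq_log]
  field_simp
  ring

/-- With η = H(s), η is asymptotic to s |log s| and log η to log s, so s is asymptotic to η / |log
η|. -/
lemma tendsto_entropyInv_mul_neg_log_div (c : WalkCase) :
    Tendsto (fun h => entropyInv c h * -Real.log h / h) (𝓝[>] 0) (𝓝 1) := by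
  have h1 : Tendsto (fun s => s * -Real.log (entropyFn c s) / entropyFn c s) (𝓝[>] 0) (𝓝 1) := by
    have := (tendsto_log_entropyFn_div_log c).div (tendsto_entropyFn_div_mul_neg_log c) one_ne_zero
    rw [div_one] at this
    refine this.congr' ?_
    filter_upwards [tendsto_neg_log_zero.eventually_gt_atTop 0, self_mem_nhdsWithin] with s hs hs0
    have hs0 : 0 < s := hs0
    have hl : Real.log s ≠ 0 := (neg_pos.1 hs).ne
    have hH := (entropyFn_pos c hs0).ne'
    simp only [Pi.div_apply]
    field_simp
  refine (h1.comp (tendsto_entropyInv_zero c)).congr' ?_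
  filter_upwards [self_mem_nhdsWithin] with h hh
  simp only [Function.comp_apply, entropyFn_entropyInv c (le_of_lt hh)]

/-- An o(1) error in H becomes a factor 1 + o(1) after exponentiating log(2πes) = 2H + o(1). -/
lemma tendsto_entropyInv_div_exp (c : WalkCase) :
    Tendsto (fun h => entropyInv c h / (Real.exp (2 * h) / (2 * Real.pi * Real.exp 1))) atTop
      (𝓝 1) := by
  have h1 := ((tendsto_entropyFn_sub_log c).const_mul (-2)).rexp
  rw [mul_zero, Real.exp_zero] at h1
  refine (h1.comp (tendsto_entropyInv_atTop c)).congr' ?_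
  filter_upwards [eventually_gt_atTop 0] with h hh
  have hs := entropyInv_pos c hh
  simp only [Function.comp_apply, entropyFn_entropyInv c hh.le]
  have e : -2 * (h - Real.log (2 * Real.pi * Real.exp 1 * entropyInv c h) / 2) =
      Real.log (2 * Real.pi * Real.exp 1 * entropyInv c h) - 2 * h := by ring
  rw [e, Real.exp_sub, Real.exp_log (by positivity)]
  field_simp

/-! ### Perturbations -/

/-- The normalized slope `√V / (s H')`. -/
def slopeFn (c : WalkCase) (s : ℝ) : ℝ := √(varFn c s) / (s * entropyDeriv c s)

lemma slopeFn_pos (c : WalkCase) {s : ℝ} (hs : 0 < s) : 0 < slopeFn c s :=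
  div_pos (Real.sqrt_pos.2 (varFn_pos c hs)) (mul_pos hs (entropyDeriv_pos c hs))

lemma continuousOn_slopeFn (c : WalkCase) : ContinuousOn (slopeFn c) (Set.Ioi 0) :=
  (continuousOn_varFn c).sqrt.div (continuousOn_id.mul (continuousOn_entropyDeriv c))
    fun _ hs => (mul_pos hs (entropyDeriv_pos c hs)).ne'

lemma exists_entropyFn_sub_eq (c : WalkCase) {s u : ℝ} (hs : 0 < s) (hu : 0 < u) :
    ∃ ξ, 0 < ξ ∧ |ξ - s| ≤ |u - s| ∧ entropyFn c u - entropyFn c s = entropyDeriv c ξ * (u - s) := by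
  rcases lt_trichotomy s u with h | rfl | h
  · obtain ⟨ξ, hξ, e⟩ := exists_hasDerivAt_eq_slope (entropyFn c) (entropyDeriv c) h
      ((continuousOn_entropyFn c).mono fun x hx => hs.le.trans hx.1)
      fun x hx => hasDerivAt_entropyFn c (hs.trans hx.1)
    refine ⟨ξ, hs.trans hξ.1, ?_, ?_⟩
    · rw [abs_of_pos (by linarith [hξ.1]), abs_of_pos (by linarith)]
      linarith [hξ.2]
    · rw [e, div_mul_cancel₀ _ (sub_ne_zero.2 h.ne')]
  · exact ⟨s, hs, by simp, by simp⟩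
  · obtain ⟨ξ, hξ, e⟩ := exists_hasDerivAt_eq_slope (entropyFn c) (entropyDeriv c) h
      ((continuousOn_entropyFn c).mono fun x hx => hu.le.trans hx.1)
      fun x hx => hasDerivAt_entropyFn c (hu.trans hx.1)
    refine ⟨ξ, hu.trans hξ.1, ?_, ?_⟩
    · rw [abs_of_neg (by linarith [hξ.2]), abs_of_neg (by linarith)]
      linarith [hξ.1]
    · have : s - u ≠ 0 := sub_ne_zero.2 h.ne'
      rw [e]
      field_simp
      ring

/-- The mean value point ξ lies no farther from s than u does, so ξ / s → 1, and `hslow` lets the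
derivative at ξ be replaced by the one at s. -/
lemma isEquivalent_sub_of_ratio (c : WalkCase) {l : Filter ℕ} {s u : ℕ → ℝ}
    (hs : ∀ᶠ N in l, 0 < s N) (hu : ∀ᶠ N in l, 0 < u N)
    (hratio : Tendsto (fun N => u N / s N) l (𝓝 1))
    (hslow : ∀ ξ : ℕ → ℝ, (∀ᶠ N in l, 0 < ξ N) → Tendsto (fun N => ξ N / s N) l (𝓝 1) →
      Tendsto (fun N => entropyDeriv c (ξ N) / entropyDeriv c (s N)) l (𝓝 1)) :
    (fun N => u N - s N) ~[l]
      fun N => (entropyFn c (u N) - entropyFn c (s N)) / entropyDeriv c (s N) := by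
  -- The positivity conditions sit inside the existential so that ξ can be chosen for every N.
  have hex : ∀ N, ∃ ξ, 0 < s N ∧ 0 < u N → 0 < ξ ∧ |ξ - s N| ≤ |u N - s N| ∧
      entropyFn c (u N) - entropyFn c (s N) = entropyDeriv c ξ * (u N - s N) := by
    intro N
    by_cases h : 0 < s N ∧ 0 < u N
    · obtain ⟨ξ, hξ⟩ := exists_entropyFn_sub_eq c h.1 h.2
      exact ⟨ξ, fun _ => hξ⟩
    · exact ⟨0, fun h' => absurd h' h⟩
  choose ξ hξ using hex
  have hξs : Tendsto (fun N => ξ N / s N) l (𝓝 1) := by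
    rw [tendsto_iff_norm_sub_tendsto_zero] at hratio ⊢
    refine squeeze_zero' (.of_forall fun _ => norm_nonneg _) ?_ hratio
    filter_upwards [hs, hu] with N h1 h2
    have e (a : ℝ) : a / s N - 1 = (a - s N) / s N := by field_simp
    rw [e, e, norm_div, norm_div]
    exact div_le_div_of_nonneg_right (hξ N ⟨h1, h2⟩).2.1 (norm_nonneg _)
  have hξ0 : ∀ᶠ N in l, 0 < ξ N := by
    filter_upwards [hs, hu] with N h1 h2
    exact (hξ N ⟨h1, h2⟩).1
  have key := (hslow ξ hξ0 hξs).inv₀ one_ne_zero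
  rw [inv_one] at key
  rw [isEquivalent_iff_exists_eq_mul]
  refine ⟨_, key, ?_⟩
  filter_upwards [hs, hu] with N h1 h2
  obtain ⟨a, -, b⟩ := hξ N ⟨h1, h2⟩
  have d1 := (entropyDeriv_pos c a).ne'
  have d2 := (entropyDeriv_pos c h1).ne'
  simp only [Pi.mul_apply, b]
  field_simp

lemma tendsto_log_div_log_of_zero {l : Filter ℕ} {s ξ : ℕ → ℝ} (hξ0 : ∀ᶠ N in l, 0 < ξ N)
    (hξ : Tendsto (fun N => ξ N / s N) l (𝓝 1)) (hs : Tendsto s l (𝓝[>] 0)) :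
    Tendsto (fun N => -Real.log (ξ N) / -Real.log (s N)) l (𝓝 1) := by
  have hs' := tendsto_nhdsWithin_iff.1 hs
  have h1 := hξ.log one_ne_zero
  rw [Real.log_one] at h1
  have h2 := (h1.div_atTop (tendsto_neg_log_zero.comp hs)).const_sub 1
  rw [sub_zero] at h2
  refine h2.congr' ?_
  filter_upwards [hs'.2, hξ0, (tendsto_neg_log_zero.comp hs).eventually_gt_atTop 0] with N a b d
  have a : 0 < s N := a
  have d' : Real.log (s N) ≠ 0 := (neg_pos.1 d).ne
  simp only [Function.comp_apply]
  rw [Real.log_div b.ne' a.ne']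
  field_simp
  ring

lemma tendsto_nhdsGT_zero_of_ratio {l : Filter ℕ} {s ξ : ℕ → ℝ} (hξ0 : ∀ᶠ N in l, 0 < ξ N)
    (hξ : Tendsto (fun N => ξ N / s N) l (𝓝 1)) (hs : Tendsto s l (𝓝[>] 0)) :
    Tendsto ξ l (𝓝[>] 0) := by
  have hs' := tendsto_nhdsWithin_iff.1 hs
  refine tendsto_nhdsWithin_iff.2 ⟨?_, hξ0⟩
  have := hξ.mul hs'.1
  rw [one_mul] at this
  refine this.congr' ?_
  filter_upwards [hs'.2] with N h
  exact div_mul_cancel₀ _ (show (0 : ℝ) < s N from h).ne'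

lemma tendsto_entropyDeriv_div_of_zero (c : WalkCase) {l : Filter ℕ} {s ξ : ℕ → ℝ}
    (hξ0 : ∀ᶠ N in l, 0 < ξ N) (hξ : Tendsto (fun N => ξ N / s N) l (𝓝 1))
    (hs : Tendsto s l (𝓝[>] 0)) :
    Tendsto (fun N => entropyDeriv c (ξ N) / entropyDeriv c (s N)) l (𝓝 1) := by
  have hs' := tendsto_nhdsWithin_iff.1 hs
  have hξz := tendsto_nhdsGT_zero_of_ratio hξ0 hξ hs
  have hD := tendsto_div_neg_log (tendsto_entropyDeriv_add_log c)
  have hlog := tendsto_log_div_log_of_zero hξ0 hξ hs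
  have key := ((hD.comp hξz).mul hlog).div (hD.comp hs) one_ne_zero
  norm_num at key
  refine key.congr' ?_
  filter_upwards [hs'.2, (tendsto_neg_log_zero.comp hs).eventually_gt_atTop 0,
    (tendsto_neg_log_zero.comp hξz).eventually_gt_atTop 0] with N a d1 d2
  have e1 : Real.log (s N) ≠ 0 := (neg_pos.1 d1).ne
  have e2 : Real.log (ξ N) ≠ 0 := (neg_pos.1 d2).ne
  have e3 := (entropyDeriv_pos c a).ne'
  simp only [Pi.div_apply, Function.comp_apply]
  field_simp

lemma tendsto_entropyDeriv_div_of_pos (c : WalkCase) {l : Filter ℕ} {s ξ : ℕ → ℝ}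
    (hξ : Tendsto (fun N => ξ N / s N) l (𝓝 1))
    {σ : ℝ} (hσ : 0 < σ) (hs : Tendsto s l (𝓝 σ)) :
    Tendsto (fun N => entropyDeriv c (ξ N) / entropyDeriv c (s N)) l (𝓝 1) := by
  have hξz : Tendsto ξ l (𝓝 σ) := by
    have := hξ.mul hs
    rw [one_mul] at this
    refine this.congr' ?_
    filter_upwards [hs.eventually_const_lt hσ] with N h
    exact div_mul_cancel₀ _ h.ne'
  have hc := (continuousOn_entropyDeriv c).continuousAt (Ioi_mem_nhds hσ)
  have hne := (entropyDeriv_pos c hσ).ne'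
  have := (hc.tendsto.comp hξz).div (hc.tendsto.comp hs) hne
  rwa [div_self hne] at this

lemma tendsto_entropyDeriv_div_of_atTop (c : WalkCase) {l : Filter ℕ} {s ξ : ℕ → ℝ}
    (hξ0 : ∀ᶠ N in l, 0 < ξ N) (hξ : Tendsto (fun N => ξ N / s N) l (𝓝 1))
    (hs : Tendsto s l atTop) :
    Tendsto (fun N => entropyDeriv c (ξ N) / entropyDeriv c (s N)) l (𝓝 1) := by
  have hξz : Tendsto ξ l atTop := by
    have := hξ.pos_mul_atTop one_pos hs
    refine this.congr' ?_
    filter_upwards [hs.eventually_gt_atTop 0] with N h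
    exact div_mul_cancel₀ _ h.ne'
  have hD := tendsto_mul_entropyDeriv c
  have := ((hD.comp hξz).div (hD.comp hs) (by norm_num)).div hξ one_ne_zero
  norm_num at this
  refine this.congr' ?_
  filter_upwards [hs.eventually_gt_atTop 0, hξ0] with N a b
  have e3 := (entropyDeriv_pos c a).ne'
  simp only [Pi.div_apply, Function.comp_apply]
  field_simp

lemma tendsto_entropyInv_ratio_of_zero (c : WalkCase) {l : Filter ℕ} {s ξ : ℕ → ℝ}
    (hξ0 : ∀ᶠ N in l, 0 < ξ N) (hξ : Tendsto (fun N => ξ N / s N) l (𝓝 1))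
    (hs : Tendsto s l (𝓝[>] 0)) :
    Tendsto (fun N => entropyInv c (ξ N) / entropyInv c (s N)) l (𝓝 1) := by
  have hξz := tendsto_nhdsGT_zero_of_ratio hξ0 hξ hs
  have hlog := tendsto_log_div_log_of_zero hξ0 hξ hs
  have hS := tendsto_entropyInv_mul_neg_log_div c
  have key := (((hS.comp hξz).div (hS.comp hs) one_ne_zero).mul hξ).div hlog one_ne_zero
  norm_num at key
  refine key.congr' ?_
  filter_upwards [(tendsto_nhdsWithin_iff.1 hs).2, hξ0,
    (tendsto_neg_log_zero.comp hs).eventually_gt_atTop 0,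
    (tendsto_neg_log_zero.comp hξz).eventually_gt_atTop 0] with N a b d1 d2
  have a : 0 < s N := a
  have e1 : Real.log (s N) ≠ 0 := (neg_pos.1 d1).ne
  have e2 : Real.log (ξ N) ≠ 0 := (neg_pos.1 d2).ne
  have e3 := (entropyInv_pos c a).ne'
  simp only [Pi.div_apply]
  field_simp

lemma tendsto_entropyInv_ratio_of_pos (c : WalkCase) {l : Filter ℕ} {h h' : ℕ → ℝ} {η : ℝ}
    (hη : 0 < η) (hh : Tendsto h l (𝓝 η)) (hh' : Tendsto h' l (𝓝 η)) :
    Tendsto (fun N => entropyInv c (h' N) / entropyInv c (h N)) l (𝓝 1) := by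
  have hc := (continuousAt_entropyInv c hη).tendsto
  have hne := (entropyInv_pos c hη).ne'
  have := (hc.comp hh').div (hc.comp hh) hne
  rwa [div_self hne] at this

/-- The inverse grows exponentially here, so the perturbation must tend to 0 absolutely; for
arguments tending to 0 relative smallness is enough. -/
lemma tendsto_entropyInv_ratio_of_atTop (c : WalkCase) {l : Filter ℕ} {h δ : ℕ → ℝ}
    (hh : Tendsto h l atTop) (hδ : Tendsto δ l (𝓝 0)) :
    Tendsto (fun N => entropyInv c (h N + δ N) / entropyInv c (h N)) l (𝓝 1) := by
  have hS := tendsto_entropyInv_div_exp c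
  have he := (hδ.const_mul 2).rexp
  rw [mul_zero, Real.exp_zero] at he
  have key := ((hS.comp (hh.atTop_add hδ)).div (hS.comp hh) one_ne_zero).mul he
  norm_num at key
  refine key.congr' ?_
  filter_upwards [hh.eventually_gt_atTop 0] with N a
  have e3 := (entropyInv_pos c a).ne'
  rw [mul_add, Real.exp_add]
  field_simp

/-! ### The rescaled entropic and cutoff times -/

/-- The entropic time divided by `k`. -/
def unitEntropicTime (c : WalkCase) (n k : ℕ) : ℝ := entropyInv c (Real.log n / k)

/-- The increment of the entropy between the entropic and the cutoff time. -/
def entropyShift (c : WalkCase) (n k : ℕ) (α : ℝ) : ℝ :=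
  α * √(varFn c (unitEntropicTime c n k) * k) / k

/-- The cutoff time divided by `k`. -/
def unitCutoffTime (c : WalkCase) (n k : ℕ) (α : ℝ) : ℝ :=
  entropyInv c (Real.log n / k + entropyShift c n k α)

/-- Each defining equation has a single solution, so the infima defining the entropic and cutoff
times are over singletons. -/
lemma meanQ_eq_iff (c : WalkCase) {k : ℕ} (hk : 0 < k) {h : ℝ} (hh : 0 ≤ h) (t : ℝ) :
    0 ≤ t ∧ meanQ c k t = h ↔ t = k * entropyInv c h := by
  have hk' : (0 : ℝ) < k := Nat.cast_pos.2 hk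
  constructor
  · rintro ⟨ht, e⟩
    rw [meanQ_eq c k ht, ← eq_entropyInv_iff c (by positivity) hh] at e
    rw [← e]
    field_simp
  · rintro rfl
    have h0 := entropyInv_nonneg c hh
    refine ⟨by positivity, ?_⟩
    rw [meanQ_eq c k (by positivity), mul_div_cancel_left₀ _ hk'.ne', entropyFn_entropyInv c hh]

lemma isEntropicTime_iff (c : WalkCase) (n : ℕ) {k : ℕ} (hk : 0 < k) (t : ℝ) :
    IsEntropicTime c n k t ↔ t = k * unitEntropicTime c n k :=
  meanQ_eq_iff c hk (div_nonneg (Real.log_natCast_nonneg n) k.cast_nonneg) t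

lemma entropicTime_eq (c : WalkCase) (n : ℕ) {k : ℕ} (hk : 0 < k) :
    entropicTime c n k = k * unitEntropicTime c n k := by
  simp only [entropicTime, isEntropicTime_iff c n hk, Set.ofPred_eq_eq_singleton, csInf_singleton]

lemma varQ_entropicTime (c : WalkCase) (n : ℕ) {k : ℕ} (hk : 0 < k) :
    varQ c k (entropicTime c n k) = varFn c (unitEntropicTime c n k) := by
  have hk' : (0 : ℝ) < k := Nat.cast_pos.2 hk
  have h0 : 0 ≤ unitEntropicTime c n k :=
    entropyInv_nonneg c (div_nonneg (Real.log_natCast_nonneg n) k.cast_nonneg)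
  rw [entropicTime_eq c n hk, varQ_eq c k (by positivity), mul_div_cancel_left₀ _ hk'.ne']

lemma isCutoffTime_iff (c : WalkCase) (n : ℕ) {k : ℕ} (hk : 0 < k) {α : ℝ}
    (h : 0 < Real.log n / k + entropyShift c n k α) (t : ℝ) :
    IsCutoffTime c n k α t ↔ t = k * unitCutoffTime c n k α := by
  rw [unitCutoffTime, ← meanQ_eq_iff c hk h.le, IsCutoffTime, varQ_entropicTime c n hk, add_div,
    entropyShift]

lemma cutoffTime_eq (c : WalkCase) (n : ℕ) {k : ℕ} (hk : 0 < k) {α : ℝ}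
    (h : 0 < Real.log n / k + entropyShift c n k α) :
    cutoffTime c n k α = k * unitCutoffTime c n k α := by
  simp only [cutoffTime, isCutoffTime_iff c n hk h, Set.ofPred_eq_eq_singleton, csInf_singleton]

lemma entropyShift_eq (c : WalkCase) (n k : ℕ) (α : ℝ) :
    entropyShift c n k α = α * √(varFn c (unitEntropicTime c n k)) / √k := by
  rcases k.eq_zero_or_pos with rfl | hk
  · simp [entropyShift]
  have hk' : (0 : ℝ) < k := Nat.cast_pos.2 hk
  rw [entropyShift, Real.sqrt_mul' _ hk'.le]
  have : (k : ℝ) = √k * √k := (Real.mul_self_sqrt hk'.le).symm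
  have h2 : √(k : ℝ) ≠ 0 := (Real.sqrt_pos.2 hk').ne'
  nth_rewrite 2 [this]
  field_simp

/-- The cutoff time is determined by its equation, is equivalent to the entropic time, and the
difference is given by the slope of the entropy, along the filter `l`. -/
structure HasCutoffExpansion (c : WalkCase) (n k : ℕ → ℕ) (α : ℝ) (l : Filter ℕ) : Prop where
  pos : ∀ᶠ N in l, 0 < Real.log (n N) / k N + entropyShift c (n N) (k N) α
  ratio : Tendsto (fun N => unitCutoffTime c (n N) (k N) α / unitEntropicTime c (n N) (k N)) l (𝓝 1)
  diff : (fun N => unitCutoffTime c (n N) (k N) α - unitEntropicTime c (n N) (k N)) ~[l]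
    fun N => α / √(k N) * unitEntropicTime c (n N) (k N) * slopeFn c (unitEntropicTime c (n N) (k N))

lemma HasCutoffExpansion.of_ratio {c : WalkCase} {n k : ℕ → ℕ} {α : ℝ} {l : Filter ℕ}
    (hh : ∀ᶠ N in l, 0 < Real.log (n N) / k N)
    (pos : ∀ᶠ N in l, 0 < Real.log (n N) / k N + entropyShift c (n N) (k N) α)
    (ratio : Tendsto (fun N => unitCutoffTime c (n N) (k N) α / unitEntropicTime c (n N) (k N)) l
      (𝓝 1))
    (hslow : ∀ ξ : ℕ → ℝ, (∀ᶠ N in l, 0 < ξ N) →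
      Tendsto (fun N => ξ N / unitEntropicTime c (n N) (k N)) l (𝓝 1) →
      Tendsto (fun N => entropyDeriv c (ξ N) / entropyDeriv c (unitEntropicTime c (n N) (k N))) l
        (𝓝 1)) :
    HasCutoffExpansion c n k α l := by
  refine ⟨pos, ratio, ?_⟩
  refine (isEquivalent_sub_of_ratio c ?_ ?_ ratio hslow).congr_right ?_
  · filter_upwards [hh] with N h using entropyInv_pos c h
  · filter_upwards [pos] with N h using entropyInv_pos c h
  · filter_upwards [hh, pos] with N h1 h2
    have h3 : 0 < unitEntropicTime c (n N) (k N) := entropyInv_pos c h1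
    have h4 := (entropyDeriv_pos c h3).ne'
    have e1 : entropyFn c (unitCutoffTime c (n N) (k N) α) =
      Real.log (n N) / k N + entropyShift c (n N) (k N) α := entropyFn_entropyInv c h2.le
    have e2 : entropyFn c (unitEntropicTime c (n N) (k N)) = Real.log (n N) / k N :=
      entropyFn_entropyInv c h1.le
    rw [e1, e2, add_sub_cancel_left, entropyShift_eq, slopeFn]
    field_simp

section

variable {c : WalkCase} {n k : ℕ → ℕ} {α : ℝ} {l : Filter ℕ}

lemma tendsto_entropyShift_of_tendsto_varFn {v : ℝ} (hk : Tendsto k l atTop)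
    (hv : Tendsto (fun N => varFn c (unitEntropicTime c (n N) (k N))) l (𝓝 v)) :
    Tendsto (fun N => entropyShift c (n N) (k N) α) l (𝓝 0) := by
  simp only [entropyShift_eq]
  exact (hv.sqrt.const_mul α).div_atTop
    (Real.tendsto_sqrt_atTop.comp (tendsto_natCast_atTop_atTop.comp hk))

lemma hasCutoffExpansion_of_atTop (hk : Tendsto k l atTop)
    (hh : Tendsto (fun N => Real.log (n N) / k N) l atTop) : HasCutoffExpansion c n k α l := by
  have hs : Tendsto (fun N => unitEntropicTime c (n N) (k N)) l atTop :=
    (tendsto_entropyInv_atTop c).comp hh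
  have hδ : Tendsto (fun N => entropyShift c (n N) (k N) α) l (𝓝 0) :=
    tendsto_entropyShift_of_tendsto_varFn hk ((tendsto_varFn c).comp hs)
  exact .of_ratio (hh.eventually_gt_atTop 0) ((hh.atTop_add hδ).eventually_gt_atTop 0)
    (tendsto_entropyInv_ratio_of_atTop c hh hδ)
    fun ξ h0 h1 => tendsto_entropyDeriv_div_of_atTop c h0 h1 hs

lemma hasCutoffExpansion_of_pos {η : ℝ} (hη : 0 < η) (hk : Tendsto k l atTop)
    (hh : Tendsto (fun N => Real.log (n N) / k N) l (𝓝 η)) : HasCutoffExpansion c n k α l := by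
  have hσ := entropyInv_pos c hη
  have hs : Tendsto (fun N => unitEntropicTime c (n N) (k N)) l (𝓝 (entropyInv c η)) :=
    (continuousAt_entropyInv c hη).tendsto.comp hh
  have hδ : Tendsto (fun N => entropyShift c (n N) (k N) α) l (𝓝 0) :=
    tendsto_entropyShift_of_tendsto_varFn hk
      (((continuousOn_varFn c).continuousAt (Ioi_mem_nhds hσ)).tendsto.comp hs)
  have hh' := hh.add hδ
  rw [add_zero] at hh'
  exact .of_ratio (hh.eventually_const_lt hη) (hh'.eventually_const_lt hη)
    (tendsto_entropyInv_ratio_of_pos c hη hh hh')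
    fun ξ _ h1 => tendsto_entropyDeriv_div_of_pos c h1 hσ hs

/-- With η = log n / k, the product k s₀ is asymptotic to log n / (-log η), and -log η = log k - log
log n ≤ log k. This is where log k ≪ log n is needed. -/
lemma tendsto_mul_unitEntropicTime (hk : Tendsto k l atTop) (hn : Tendsto n l atTop)
    (hlog : (fun N => Real.log (k N)) =o[l] fun N => Real.log (n N))
    (hh : Tendsto (fun N => Real.log (n N) / k N) l (𝓝[>] 0)) :
    Tendsto (fun N => k N * unitEntropicTime c (n N) (k N)) l atTop := by
  have hlk : Tendsto (fun N => Real.log (k N)) l atTop :=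
    Real.tendsto_log_atTop.comp (tendsto_natCast_atTop_atTop.comp hk)
  have hln : Tendsto (fun N => Real.log (n N)) l atTop :=
    Real.tendsto_log_atTop.comp (tendsto_natCast_atTop_atTop.comp hn)
  have h1 : Tendsto (fun N => Real.log (n N) / Real.log (k N)) l atTop := by
    have := hlog.tendsto_div_nhds_zero
    have h2 : Tendsto (fun N => Real.log (k N) / Real.log (n N)) l (𝓝[>] 0) := by
      refine tendsto_nhdsWithin_iff.2 ⟨this, ?_⟩
      filter_upwards [hlk.eventually_gt_atTop 0, hln.eventually_gt_atTop 0] with N a b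
      exact div_pos a b
    refine h2.inv_tendsto_nhdsGT_zero.congr fun N => ?_
    simp
  have hneg := tendsto_neg_log_zero.comp hh
  have h3 : Tendsto (fun N => Real.log (n N) / -Real.log (Real.log (n N) / k N)) l atTop := by
    refine tendsto_atTop_mono' _ ?_ h1
    filter_upwards [hln.eventually_ge_atTop 1, hk.eventually_gt_atTop 0,
      hneg.eventually_gt_atTop 0] with N a b d
    refine div_le_div_of_nonneg_left (by linarith) d ?_
    have b' : (0 : ℝ) < k N := Nat.cast_pos.2 b
    rw [Real.log_div (by linarith) b'.ne']
    linarith [Real.log_nonneg a]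
  have h4 := ((tendsto_entropyInv_mul_neg_log_div c).comp hh).pos_mul_atTop one_pos h3
  refine h4.congr' ?_
  filter_upwards [hln.eventually_ge_atTop 1, hk.eventually_gt_atTop 0,
    hneg.eventually_gt_atTop 0] with N a b d
  have b' : (k N : ℝ) ≠ 0 := (Nat.cast_pos.2 b).ne'
  have d' : Real.log (Real.log (n N) / k N) ≠ 0 := (neg_pos.1 d).ne
  have a' : Real.log (n N) ≠ 0 := by linarith
  simp only [Function.comp_apply, unitEntropicTime]
  set x := Real.log (Real.log (n N) / k N)
  field_simp

lemma hasCutoffExpansion_of_zero (hk : Tendsto k l atTop) (hn : Tendsto n l atTop)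
    (hlog : (fun N => Real.log (k N)) =o[l] fun N => Real.log (n N))
    (hh : Tendsto (fun N => Real.log (n N) / k N) l (𝓝[>] 0)) : HasCutoffExpansion c n k α l := by
  have hs : Tendsto (fun N => unitEntropicTime c (n N) (k N)) l (𝓝[>] 0) :=
    (tendsto_entropyInv_zero c).comp hh
  have hh0 := (tendsto_nhdsWithin_iff.1 hh).2
  -- The relative shift is α √V / (√k H), which is asymptotic to α / √(k s₀) because √V and H are
  -- asymptotic to √s₀ |log s₀| and s₀ |log s₀|.
  have hδ : Tendsto (fun N => entropyShift c (n N) (k N) α / (Real.log (n N) / k N)) l (𝓝 0) := by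
    have hA := (tendsto_div_neg_log (tendsto_sqrt_varFn_div_add_log c)).comp hs
    have hB := (tendsto_entropyFn_div_mul_neg_log c).comp hs
    have hC := (Real.tendsto_sqrt_atTop.comp
      (tendsto_mul_unitEntropicTime (c := c) hk hn hlog hh)).inv_tendsto_atTop
    have key := ((hA.div hB one_ne_zero).mul hC).const_mul α
    rw [mul_zero, mul_zero] at key
    refine key.congr' ?_
    filter_upwards [hh0, (tendsto_neg_log_zero.comp hs).eventually_gt_atTop 0,
      hk.eventually_gt_atTop 0] with N a d b
    have a : 0 < Real.log (n N) / k N := a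
    have b' : (0 : ℝ) < k N := Nat.cast_pos.2 b
    have s0 : 0 < unitEntropicTime c (n N) (k N) := entropyInv_pos c a
    have e2 : entropyFn c (unitEntropicTime c (n N) (k N)) = Real.log (n N) / k N :=
      entropyFn_entropyInv c a.le
    have d' : Real.log (unitEntropicTime c (n N) (k N)) ≠ 0 := (neg_pos.1 d).ne
    simp only [Pi.div_apply, Pi.inv_apply, Function.comp_apply]
    rw [e2, entropyShift_eq, Real.sqrt_div' _ s0.le, Real.sqrt_mul b'.le]
    have r1 := (Real.sqrt_pos.2 s0).ne'
    have r2 := (Real.sqrt_pos.2 b').ne'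
    have r3 := Real.sq_sqrt s0.le
    generalize Real.log (n N) / k N = h at *
    set s := unitEntropicTime c (n N) (k N)
    have := a.ne'
    field_simp
    rw [r3]
  have hr : Tendsto (fun N => (Real.log (n N) / k N + entropyShift c (n N) (k N) α) /
      (Real.log (n N) / k N)) l (𝓝 1) := by
    have := hδ.const_add 1
    rw [add_zero] at this
    refine this.congr' ?_
    filter_upwards [hh0] with N a
    have a : 0 < Real.log (n N) / k N := a
    rw [add_div, div_self a.ne']
  have hpos : ∀ᶠ N in l, 0 < Real.log (n N) / k N + entropyShift c (n N) (k N) α := by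
    filter_upwards [hh0, hr.eventually_const_lt one_pos] with N a b
    exact (div_pos_iff_of_pos_right a).1 b
  exact .of_ratio hh0 hpos (tendsto_entropyInv_ratio_of_zero c hpos hr hh)
    fun ξ h0 h1 => tendsto_entropyDeriv_div_of_zero c h0 h1 hs

end

/-! ### The slope in the three regimes -/

/-- Near 0 the slope is asymptotic to 1 / √s, because √(V/s) and H' are both asymptotic to -log s.
-/
lemma tendsto_slopeFn_entropyInv_zero (c : WalkCase) :
    Tendsto (fun h => slopeFn c (entropyInv c h) / √(-Real.log h / h)) (𝓝[>] 0) (𝓝 1) := by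
  have h1 : Tendsto (fun s => slopeFn c s * √s) (𝓝[>] 0) (𝓝 1) := by
    have := (tendsto_div_neg_log (tendsto_sqrt_varFn_div_add_log c)).div
      (tendsto_div_neg_log (tendsto_entropyDeriv_add_log c)) one_ne_zero
    rw [div_one] at this
    refine this.congr' ?_
    filter_upwards [self_mem_nhdsWithin, tendsto_neg_log_zero.eventually_gt_atTop 0] with s hs hl
    have hs : 0 < s := hs
    have hl' : Real.log s ≠ 0 := (neg_pos.1 hl).ne
    have r1 := (Real.sqrt_pos.2 hs).ne'
    have r3 := Real.sq_sqrt hs.le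
    have hD := (entropyDeriv_pos c hs).ne'
    simp only [Pi.div_apply, slopeFn]
    rw [Real.sqrt_div' _ hs.le]
    field_simp
    rw [r3]
  have h2 := (tendsto_entropyInv_mul_neg_log_div c).sqrt
  rw [Real.sqrt_one] at h2
  have key := (h1.comp (tendsto_entropyInv_zero c)).div h2 one_ne_zero
  rw [div_one] at key
  refine key.congr' ?_
  filter_upwards [self_mem_nhdsWithin, tendsto_neg_log_zero.eventually_gt_atTop 0] with h hh hl
  have hh : 0 < h := hh
  have hs := entropyInv_pos c hh
  have r1 := (Real.sqrt_pos.2 hs).ne'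
  simp only [Pi.div_apply, Function.comp_apply]
  rw [mul_div_assoc (entropyInv c h), Real.sqrt_mul hs.le]
  field_simp

lemma tendsto_slopeFn_atTop (c : WalkCase) : Tendsto (slopeFn c) atTop (𝓝 √2) := by
  have := (tendsto_varFn c).sqrt.div (tendsto_mul_entropyDeriv c) (by norm_num)
  have e : √(1 / 2) / (1 / 2) = √2 := by
    rw [one_div, Real.sqrt_inv, div_inv_eq_mul, inv_mul_eq_div, Real.div_sqrt]
  rwa [e] at this

/-! ### The two cases have different limits -/

/-- Equal inverses force equal entropies, and the step entropy is read off from their expansion at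
0. -/
lemma eq_stepEntropy_of_entropyInv_eq {c c' : WalkCase}
    (h : ∀ x, 0 < x → entropyInv c x = entropyInv c' x) : stepEntropy c = stepEntropy c' := by
  have h1 : ∀ s, 0 < s → entropyFn c s = entropyFn c' s := fun s hs => by
    have h2 := entropyFn_pos c hs
    have h3 := h _ h2
    rw [entropyInv_entropyFn c hs.le, eq_entropyInv_iff c' hs.le h2.le] at h3
    exact h3.symm
  have h2 := tendsto_nhds_unique ((tendsto_entropyFn_div_add_log c).congr' ?_)
    (tendsto_entropyFn_div_add_log c')
  · exact add_right_cancel h2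
  · filter_upwards [self_mem_nhdsWithin] with s hs
    rw [h1 s hs]

/-- `√(V / s) / H'` tends to `1` so fast at `0` that multiplying the difference by `log s` still
gives the limit `0`. -/
lemma tendsto_slopeFn_mul_sqrt (c : WalkCase) :
    Tendsto (fun s => ((slopeFn c s * √s) ^ 2 - 1) * Real.log s) (𝓝[>] 0) (𝓝 0) := by
  have hA := tendsto_sqrt_varFn_div_add_log c
  have hB := tendsto_entropyDeriv_add_log c
  have hA1 := tendsto_div_neg_log hA
  have hB1 := tendsto_div_neg_log hB
  have key := ((hA.sub hB).mul (hA1.add hB1)).div (hB1.pow 2) (by norm_num) |>.neg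
  norm_num at key
  refine key.congr' ?_
  filter_upwards [self_mem_nhdsWithin, tendsto_neg_log_zero.eventually_gt_atTop 0] with s hs hl
  have hs : 0 < s := hs
  have hl' : Real.log s ≠ 0 := (neg_pos.1 hl).ne
  have hD := (entropyDeriv_pos c hs).ne'
  have e : slopeFn c s * √s = √(varFn c s / s) / entropyDeriv c s := by
    have r1 := (Real.sqrt_pos.2 hs).ne'
    have r3 := Real.sq_sqrt hs.le
    rw [slopeFn, Real.sqrt_div' _ hs.le]
    field_simp
    rw [r3]
  simp only [e]
  generalize √(varFn c s / s) = a
  field_simp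
  ring

/-- Let s and u be the two inverses at x and G the common slope. Both G² s and G² u are 1 + o(1 /
log), so s / u → 1 fast enough that x / s - x / u → 0, although each term is of logarithmic size.
Comparing the limits of x / s + log s and x / u + log u then equates the step entropies. -/
lemma eq_stepEntropy_of_slopeFn_eq {c c' : WalkCase}
    (h : ∀ x, 0 < x → slopeFn c (entropyInv c x) = slopeFn c' (entropyInv c' x)) :
    stepEntropy c = stepEntropy c' := by
  have lim (c : WalkCase) : Tendsto (fun x => (slopeFn c (entropyInv c x) * √(entropyInv c x)) ^ 2)
      (𝓝[>] 0) (𝓝 1) ∧ Tendsto (fun x => x / entropyInv c x *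
      ((slopeFn c (entropyInv c x) * √(entropyInv c x)) ^ 2 - 1)) (𝓝[>] 0) (𝓝 0) ∧
      Tendsto (fun x => x / entropyInv c x + Real.log (entropyInv c x)) (𝓝[>] 0)
        (𝓝 (stepEntropy c + 1)) := by
    have hS := tendsto_entropyInv_zero c
    have hW := tendsto_slopeFn_mul_sqrt c
    refine ⟨?_, ?_, ?_⟩
    · have h1 := ((hW.neg.div_atTop tendsto_neg_log_zero).add_const 1).comp hS
      rw [zero_add] at h1
      refine h1.congr' ?_
      filter_upwards [(tendsto_neg_log_zero.comp hS).eventually_gt_atTop 0] with x hl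
      have hl' : Real.log (entropyInv c x) ≠ 0 := (neg_pos.1 hl).ne
      simp only [Function.comp_apply]
      field_simp
      ring
    · have h1 := ((tendsto_entropyFn_div_mul_neg_log c).mul hW.neg).comp hS
      rw [neg_zero, mul_zero] at h1
      refine h1.congr' ?_
      filter_upwards [self_mem_nhdsWithin,
        (tendsto_neg_log_zero.comp hS).eventually_gt_atTop 0] with x hx hl
      have hl' : Real.log (entropyInv c x) ≠ 0 := (neg_pos.1 hl).ne
      simp only [Function.comp_apply, entropyFn_entropyInv c (le_of_lt hx)]
      field_simp
    · refine ((tendsto_entropyFn_div_add_log c).comp hS).congr' ?_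
      filter_upwards [self_mem_nhdsWithin] with x hx
      simp only [Function.comp_apply, entropyFn_entropyInv c (le_of_lt hx)]
  obtain ⟨a1, a2, a3⟩ := lim c
  obtain ⟨b1, b2, b3⟩ := lim c'
  -- The combination is identically 0: the first difference equals x / u - x / s and cancels the
  -- rest. Its limit is the difference of the step entropies.
  have key := (((a2.div b1 one_ne_zero).sub (b2.div a1 one_ne_zero)).add
    ((b1.div a1 one_ne_zero).log (by norm_num))).add (a3.sub b3)
  norm_num at key
  refine sub_eq_zero.1 (tendsto_nhds_unique key (tendsto_const_nhds.congr' ?_))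
  filter_upwards [self_mem_nhdsWithin] with x hx
  have hx : 0 < x := hx
  have hs := entropyInv_pos c hx
  have hu := entropyInv_pos c' hx
  have hG := slopeFn_pos c' hu
  simp only [h x hx, mul_pow, Real.sq_sqrt hs.le, Real.sq_sqrt hu.le]
  rw [mul_div_mul_left _ _ (pow_pos hG 2).ne', Real.log_div hu.ne' hs.ne']
  field_simp
  ring

lemma stepEntropy_directed_ne : stepEntropy .directed ≠ stepEntropy .undirected := by
  have h : Real.log 2 ≠ 0 := (Real.log_pos one_lt_two).ne'
  have e : stepEntropy .directed = 0 := by simp [stepEntropy, stepProb, stepProb']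
  have e' : stepEntropy .undirected = Real.log 2 := by
    simp only [stepEntropy, stepProb, stepProb', one_div, Real.log_inv]
    ring
  rw [e, e']
  exact h.symm

/-! ### The three regimes -/

/-- Compactness of [0, ∞]: every ultrafilter has a limit there. -/
lemma tendsto_trichotomy (U : Ultrafilter ℕ) {h : ℕ → ℝ} (hh : ∀ᶠ N in U, 0 < h N) :
    Tendsto h U (𝓝[>] 0) ∨ (∃ η, 0 < η ∧ Tendsto h U (𝓝 η)) ∨ Tendsto h U atTop := by
  have hx : Tendsto (fun N => ENNReal.ofReal (h N)) U
      (𝓝 (U.map fun N => ENNReal.ofReal (h N)).lim) :=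
    (U.map fun N => ENNReal.ofReal (h N)).le_nhds_lim
  generalize (U.map fun N => ENNReal.ofReal (h N)).lim = x at hx
  rcases eq_or_ne x ⊤ with rfl | hne
  · exact .inr (.inr (ENNReal.tendsto_ofReal_nhds_top.1 hx))
  have h1 : Tendsto h U (𝓝 x.toReal) := by
    refine ((ENNReal.tendsto_toReal hne).comp hx).congr' ?_
    filter_upwards [hh] with N hN
    exact ENNReal.toReal_ofReal hN.le
  rcases ENNReal.toReal_nonneg.eq_or_lt' with h0 | h0
  · rw [h0] at h1
    exact .inl (tendsto_nhdsWithin_iff.2 ⟨h1, hh⟩)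
  · exact .inr (.inl ⟨_, h0, h1⟩)

section

variable {n k : ℕ → ℕ}

lemma eventually_log_div_pos {l : Filter ℕ} (hn : Tendsto n l atTop) (hk : Tendsto k l atTop) :
    ∀ᶠ N in l, 0 < Real.log (n N) / k N := by
  filter_upwards [hn.eventually_gt_atTop 1, hk.eventually_gt_atTop 0] with N a b
  exact div_pos (Real.log_pos (Nat.one_lt_cast.2 a)) (Nat.cast_pos.2 b)

/-- A sequence may alternate between regimes, but an ultrafilter selects one. Eventual positivity
and the limit of the ratio can both be tested on ultrafilters. -/
lemma hasCutoffExpansion_ultrafilter (c : WalkCase) (hn : Tendsto n atTop atTop)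
    (hk : Tendsto k atTop atTop)
    (hlog : (fun N => Real.log (k N)) =o[atTop] fun N => Real.log (n N)) (α : ℝ)
    (U : Ultrafilter ℕ) (hU : (U : Filter ℕ) ≤ atTop) : HasCutoffExpansion c n k α U := by
  have hn' := hn.mono_left hU
  have hk' := hk.mono_left hU
  rcases tendsto_trichotomy U (eventually_log_div_pos hn' hk') with h | ⟨η, hη, h⟩ | h
  · exact hasCutoffExpansion_of_zero hk' hn' (hlog.mono hU) h
  · exact hasCutoffExpansion_of_pos hη hk' h
  · exact hasCutoffExpansion_of_atTop hk' h

lemma eventually_pos_add_entropyShift (c : WalkCase) (hn : Tendsto n atTop atTop)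
    (hk : Tendsto k atTop atTop)
    (hlog : (fun N => Real.log (k N)) =o[atTop] fun N => Real.log (n N)) (α : ℝ) :
    ∀ᶠ N in atTop, 0 < Real.log (n N) / k N + entropyShift c (n N) (k N) α :=
  mem_iff_ultrafilter.2 fun U hU => (hasCutoffExpansion_ultrafilter c hn hk hlog α U hU).pos

lemma tendsto_unitCutoffTime_div (c : WalkCase) (hn : Tendsto n atTop atTop)
    (hk : Tendsto k atTop atTop)
    (hlog : (fun N => Real.log (k N)) =o[atTop] fun N => Real.log (n N)) (α : ℝ) :
    Tendsto (fun N => unitCutoffTime c (n N) (k N) α / unitEntropicTime c (n N) (k N)) atTop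
      (𝓝 1) :=
  (tendsto_iff_ultrafilter _ _ _).2 fun U hU =>
    (hasCutoffExpansion_ultrafilter c hn hk hlog α U hU).ratio

lemma tendsto_log_div_atTop (hn : Tendsto n atTop atTop) (hk : Tendsto k atTop atTop)
    (h : (fun N => (k N : ℝ)) =o[atTop] fun N => Real.log (n N)) :
    Tendsto (fun N => Real.log (n N) / k N) atTop atTop := by
  have h1 : Tendsto (fun N => (k N : ℝ) / Real.log (n N)) atTop (𝓝[>] 0) := by
    refine tendsto_nhdsWithin_iff.2 ⟨h.tendsto_div_nhds_zero, ?_⟩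
    filter_upwards [eventually_log_div_pos hn hk] with N a
    rw [← inv_div]
    exact inv_pos.2 a
  refine h1.inv_tendsto_nhdsGT_zero.congr fun N => ?_
  simp

lemma tendsto_log_div_of_isEquivalent (hk : Tendsto k atTop atTop) {l : ℝ} (hl : 0 < l)
    (h : (fun N => (k N : ℝ)) ~[atTop] fun N => l * Real.log (n N)) :
    Tendsto (fun N => Real.log (n N) / k N) atTop (𝓝 (1 / l)) := by
  have hk0 : ∀ᶠ N in atTop, (k N : ℝ) ≠ 0 := by
    filter_upwards [hk.eventually_gt_atTop 0] with N a using (Nat.cast_pos.2 a).ne'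
  have h1 := ((isEquivalent_iff_tendsto_one hk0).1 h.symm).div_const l
  refine h1.congr fun N => ?_
  simp only [Pi.div_apply]
  field_simp

lemma tendsto_log_div_zero (hn : Tendsto n atTop atTop) (hk : Tendsto k atTop atTop)
    (h : (fun N => Real.log (n N)) =o[atTop] fun N => (k N : ℝ)) :
    Tendsto (fun N => Real.log (n N) / k N) atTop (𝓝[>] 0) :=
  tendsto_nhdsWithin_iff.2 ⟨h.tendsto_div_nhds_zero, eventually_log_div_pos hn hk⟩

lemma entropicTime_isEquivalent (c : WalkCase) (hk : Tendsto k atTop atTop) {F : ℕ → ℝ}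
    (hF : (fun N => unitEntropicTime c (n N) (k N)) ~[atTop] F) :
    (fun N => entropicTime c (n N) (k N)) ~[atTop] fun N => (k N : ℝ) * F N := by
  refine ((IsEquivalent.refl (u := fun N => (k N : ℝ))).mul hF).congr_left ?_
  filter_upwards [hk.eventually_gt_atTop 0] with N a
  simp only [Pi.mul_apply, entropicTime_eq c (n N) a]

lemma cutoffTime_sub_isEquivalent (c : WalkCase) (hk : Tendsto k atTop atTop) {α : ℝ} {F : ℕ → ℝ}
    (h : HasCutoffExpansion c n k α atTop)
    (hF : (fun N => slopeFn c (unitEntropicTime c (n N) (k N))) ~[atTop] F) :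
    (fun N => cutoffTime c (n N) (k N) α - entropicTime c (n N) (k N)) ~[atTop]
      fun N => α / √(k N) * entropicTime c (n N) (k N) * F N := by
  have h1 := (IsEquivalent.refl (u := fun N => (k N : ℝ))).mul (h.diff.trans
    ((IsEquivalent.refl (u := fun N => α / √(k N) * unitEntropicTime c (n N) (k N))).mul hF))
  refine (h1.congr_left ?_).congr_right ?_
  · filter_upwards [hk.eventually_gt_atTop 0, h.pos] with N a b
    simp only [Pi.mul_apply, entropicTime_eq c (n N) a, cutoffTime_eq c (n N) a b]
    ring
  · filter_upwards [hk.eventually_gt_atTop 0] with N a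
    simp only [Pi.mul_apply, entropicTime_eq c (n N) a]
    ring

end

end RandomCayley

end

/-! ### Assembly of the theorem -/

theorem mainTheorem3 :
    ∃ f g : WalkCase → ℝ → ℝ,
      (∀ c : WalkCase,
        ContinuousOn (f c) (Set.Ioi 0) ∧ ContinuousOn (g c) (Set.Ioi 0) ∧
        ∀ l : ℝ, 0 < l → 0 < f c l ∧ 0 < g c l) ∧
      (∃ l : ℝ, 0 < l ∧ f .directed l ≠ f .undirected l) ∧
      (∃ l : ℝ, 0 < l ∧ g .directed l ≠ g .undirected l) ∧
      ∀ (c : WalkCase) (n k : ℕ → ℕ),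
        Tendsto n atTop atTop →
        Tendsto k atTop atTop →
        ((fun N => Real.log (k N)) =o[atTop] fun N => Real.log (n N)) →
        -- the entropic and cutoff times are well defined
        (∀ᶠ N in atTop, ∃! t : ℝ, IsEntropicTime c (n N) (k N) t) ∧
        (∀ α : ℝ, ∀ᶠ N in atTop, ∃! t : ℝ, IsCutoffTime c (n N) (k N) α t) ∧
        -- the entropic time
        (((fun N => (k N : ℝ)) =o[atTop] fun N => Real.log (n N)) →
          (fun N => entropicTime c (n N) (k N)) ~[atTop]
            fun N => (k N : ℝ) * ((n N : ℝ) ^ ((2 : ℝ) / (k N : ℝ)) /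
              (2 * Real.pi * Real.exp 1))) ∧
        (∀ l : ℝ, 0 < l →
          ((fun N => (k N : ℝ)) ~[atTop] fun N => l * Real.log (n N)) →
          (fun N => entropicTime c (n N) (k N)) ~[atTop] fun N => (k N : ℝ) * f c l) ∧
        (((fun N => Real.log (n N)) =o[atTop] fun N => (k N : ℝ)) →
          (fun N => entropicTime c (n N) (k N)) ~[atTop]
            fun N => (k N : ℝ) * (1 / ((k N : ℝ) / Real.log (n N) *
              Real.log ((k N : ℝ) / Real.log (n N))))) ∧
        -- the cutoff times
        ∀ α : ℝ,
          ((fun N => cutoffTime c (n N) (k N) α) ~[atTop]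
            fun N => entropicTime c (n N) (k N)) ∧
          (((fun N => (k N : ℝ)) =o[atTop] fun N => Real.log (n N)) →
            (fun N => cutoffTime c (n N) (k N) α - entropicTime c (n N) (k N)) ~[atTop]
              fun N => α / Real.sqrt (k N) * entropicTime c (n N) (k N) * Real.sqrt 2) ∧
          (∀ l : ℝ, 0 < l →
            ((fun N => (k N : ℝ)) ~[atTop] fun N => l * Real.log (n N)) →
            (fun N => cutoffTime c (n N) (k N) α - entropicTime c (n N) (k N)) ~[atTop]
              fun N => α / Real.sqrt (k N) * entropicTime c (n N) (k N) * g c l) ∧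
          (((fun N => Real.log (n N)) =o[atTop] fun N => (k N : ℝ)) →
            (fun N => cutoffTime c (n N) (k N) α - entropicTime c (n N) (k N)) ~[atTop]
              fun N => α / Real.sqrt (k N) * entropicTime c (n N) (k N) *
                Real.sqrt ((k N : ℝ) / Real.log (n N) *
                  Real.log ((k N : ℝ) / Real.log (n N)))) := by
  -- For k asymptotic to λ log n the entropy level log n / k tends to 1 / λ, so f and g are the
  -- inverse entropy and the slope at that level.
  refine ⟨fun c l => entropyInv c (1 / l), fun c l => slopeFn c (entropyInv c (1 / l)),
    fun c => ?_, ?_, ?_, ?_⟩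
  · have h1 : ContinuousOn (fun l => entropyInv c (1 / l)) (Set.Ioi 0) := fun l hl => by
      have hl : 0 < l := hl
      exact ((continuousAt_entropyInv c (one_div_pos.2 hl)).comp
        (continuousAt_const.div continuousAt_id hl.ne')).continuousWithinAt
    have h2 : ∀ l : ℝ, 0 < l → 0 < entropyInv c (1 / l) :=
      fun l hl => entropyInv_pos c (one_div_pos.2 hl)
    exact ⟨h1, (continuousOn_slopeFn c).comp h1 h2, fun l hl => ⟨h2 l hl, slopeFn_pos c (h2 l hl)⟩⟩
  · by_contra! h
    refine stepEntropy_directed_ne (eq_stepEntropy_of_entropyInv_eq fun x hx => ?_)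
    have := h (1 / x) (one_div_pos.2 hx)
    rwa [one_div_one_div] at this
  · by_contra! h
    refine stepEntropy_directed_ne (eq_stepEntropy_of_slopeFn_eq fun x hx => ?_)
    have := h (1 / x) (one_div_pos.2 hx)
    rwa [one_div_one_div] at this
  intro c n k hn hk hlog
  have hk0 := hk.eventually_gt_atTop 0
  have hpos := eventually_log_div_pos hn hk
  refine ⟨?_, fun α => ?_, fun h => ?_, fun l hl h => ?_, fun h => ?_, fun α => ⟨?_, fun h => ?_,
    fun l hl h => ?_, fun h => ?_⟩⟩
  · filter_upwards [hk0] with N a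
    exact ⟨_, (isEntropicTime_iff c (n N) a _).2 rfl, fun t => (isEntropicTime_iff c (n N) a t).1⟩
  · filter_upwards [hk0, eventually_pos_add_entropyShift c hn hk hlog α] with N a b
    exact ⟨_, (isCutoffTime_iff c (n N) a b _).2 rfl, fun t => (isCutoffTime_iff c (n N) a b t).1⟩
  · refine entropicTime_isEquivalent c hk (isEquivalent_of_tendsto_one ?_)
    refine ((tendsto_entropyInv_div_exp c).comp (tendsto_log_div_atTop hn hk h)).congr' ?_
    filter_upwards [hn.eventually_gt_atTop 0] with N a
    have a' : (0 : ℝ) < n N := Nat.cast_pos.2 a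
    have e : 2 * (Real.log (n N) / k N) = Real.log (n N) * (2 / k N) := by ring
    simp only [Function.comp_apply, Pi.div_apply, unitEntropicTime, Real.rpow_def_of_pos a', e]
  · have h1 := one_div_pos.2 hl
    refine entropicTime_isEquivalent c hk ?_
    exact (isEquivalent_const_iff_tendsto (entropyInv_pos c h1).ne').2
      ((continuousAt_entropyInv c h1).tendsto.comp (tendsto_log_div_of_isEquivalent hk hl h))
  · refine entropicTime_isEquivalent c hk (isEquivalent_of_tendsto_one ?_)
    refine ((tendsto_entropyInv_mul_neg_log_div c).comp (tendsto_log_div_zero hn hk h)).congr ?_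
    intro N
    have e : (k N : ℝ) / Real.log (n N) = (Real.log (n N) / k N)⁻¹ := (inv_div _ _).symm
    simp only [Function.comp_apply, Pi.div_apply, unitEntropicTime, e, Real.log_inv]
    rw [one_div, div_inv_eq_mul]
    ring
  · have h1 := tendsto_unitCutoffTime_div c hn hk hlog α
    refine isEquivalent_of_tendsto_one (h1.congr' ?_)
    filter_upwards [hk0, eventually_pos_add_entropyShift c hn hk hlog α] with N a b
    have a' : (k N : ℝ) ≠ 0 := (Nat.cast_pos.2 a).ne'
    rw [Pi.div_apply, cutoffTime_eq c (n N) a b, entropicTime_eq c (n N) a,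
      mul_div_mul_left _ _ a']
  · have hh := tendsto_log_div_atTop hn hk h
    refine cutoffTime_sub_isEquivalent c hk (hasCutoffExpansion_of_atTop hk hh) ?_
    exact (isEquivalent_const_iff_tendsto (by positivity)).2
      ((tendsto_slopeFn_atTop c).comp ((tendsto_entropyInv_atTop c).comp hh))
  · have h1 := one_div_pos.2 hl
    have h2 := entropyInv_pos c h1
    have hh := tendsto_log_div_of_isEquivalent hk hl h
    refine cutoffTime_sub_isEquivalent c hk (hasCutoffExpansion_of_pos h1 hk hh) ?_
    exact (isEquivalent_const_iff_tendsto (slopeFn_pos c h2).ne').2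
      (((continuousOn_slopeFn c).continuousAt (Ioi_mem_nhds h2)).tendsto.comp
        ((continuousAt_entropyInv c h1).tendsto.comp hh))
  · have hh := tendsto_log_div_zero hn hk h
    refine cutoffTime_sub_isEquivalent c hk (hasCutoffExpansion_of_zero hk hn hlog hh) ?_
    refine isEquivalent_of_tendsto_one (((tendsto_slopeFn_entropyInv_zero c).comp hh).congr ?_)
    intro N
    have e : (k N : ℝ) / Real.log (n N) = (Real.log (n N) / k N)⁻¹ := (inv_div _ _).symm
    simp only [Function.comp_apply, Pi.div_apply, unitEntropicTime, e, Real.log_inv]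
    rw [inv_mul_eq_div]
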